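/- Fix integers $d,m\ge 0$ and real numbers $\frac13<\alpha<\nu\le\frac12$. **Noise.** Let $T^2_1(\mathbb R^m)=1\oplus\mathbb R^m\oplus(\mathbb R^m\otimes\mathbb R^m)$ with the product $(1,g^1,g^2)\otimes(1,h^1,h^2)=(1,g^1+h^1,g^1\otimes h^1+g^2+h^2)$, and let $\Omega$ be the space of paths $\omega:\mathbb R\to T^2_1(\mathbb R^m)$ with $\omega_0=(1,0,0)$ which on every compact interval are $\alpha$-Hölder rough paths and belong to the closure of the smooth paths in the $\alpha$-Hölder rough path metric. Write $\omega_s^{-1}\otimes\omega_t=(1,x_{s,t}(\omega),\mathbb X_{s,t}(\omega))$. Equip $\Omega$ with the Borel $\sigma$-algebra of $\alpha$-Hölder convergence on compact intervals, and let $(\theta_t\omega)_s=\omega_t^{-1}\otimes\omega_{t+s}$ for $s,t\in\mathbb R$. Let $\mathbb P$ be a probability measure on $\Omega$ which is invariant under all $\theta_t$ (stationary increments) and for which the flow $(\theta_t)_{t\in\mathbb R}$ is ergodic, and suppose that for every $p$ with $p\nu\ge1$ and every $T>0$ there is a constant $C$ with $$\mathbb E\big(\|x_{s,t}\|^p+\|\mathbb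 X_{s,t}\|^{p/2}\big)\le C|t-s|^{p\nu}\qquad\text{for all } s,t\in[0,T].$$ **Coefficients.** Let $f:\mathbb R^d\to\mathbb R^d$ be $C^1$ with $L_f:=\|Df\|_\infty<\infty$ and strictly dissipative: there is $D>0$ with $\langle y_1-y_2,f(y_1)-f(y_2)\rangle\le-D\|y_1-y_2\|^2$ for all $y_1,y_2\in\mathbb R^d$. For $g\in C^3_b(\mathbb R^d,\mathcal L(\mathbb R^m,\mathbb R^d))$ put $$L_g:=\max\Big\{\|Dg\|_\infty,\ \|D^2g\|_\infty,\ \big[\|g\|_\infty(\|Dg\|_\infty\vee\|D^2g\|_\infty\vee\|D^3g\|_\infty)\big]^{1/2},\ \big(\|g\|_\infty^2\|D^3g\|_\infty\big)^{1/3}\Big\}.$$ **Scheme.** For $\Delta>0$ and $t_k=k\Delta$ consider $$y_{t_{k+1}}=y_{t_k}+f(y_{t_k})\Delta+g(y_{t_k})x_{t_k,t_{k+1}}+Dg(y_{t_k})g(y_{t_k})\mathbb X_{t_k,t_{k+1}},\qquad k\in\mathbb N,$$ and let $\varphi(k,\omega)y_0:=y_{t_k}$ denote its solution started at $y_0\in\mathbb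 R^d$. A *stationary solution* is a measurable $a:\Omega\to\mathbb R^d$ such that, almost surely, $\varphi(k,\omega)a(\omega)=a(\theta_{k\Delta}\omega)$ for all $k\in\mathbb N$. A family of sets $S(\omega)\subseteq\mathbb R^d$ is *tempered* if almost surely $S(\omega)\subseteq \bar B(0,r(\omega))$ for a measurable $r$ with $\frac1k\log^+ r(\theta_{\pm k\Delta}\omega)\to0$ almost surely as $k\to\infty$. A *pullback attractor* is a nonempty compact random set $A(\omega)$ that is tempered, satisfies almost surely $\varphi(k,\omega)A(\omega)=A(\theta_{k\Delta}\omega)$ for all $k\in\mathbb N$, and for every tempered family $S$ satisfies, almost surely, $\sup_{y\in S(\theta_{-k\Delta}\omega)}\operatorname{dist}\big(\varphi(k,\theta_{-k\Delta}\omega)y,A(\omega)\big)\to0$ as $k\to\infty$. **Statement.** There is $\Delta^*>0$ depending only on $f$, and there is $C^*>0$ depending only on $f$ and on the law $\mathbb P$ of the noise (with $m,\alpha,\nu$), such that for every $g\in C^3_b$ with $L_g<C^*$ and every $0<\Delta<\Delta^*$ the following hold. 1. The scheme has a stationary solution $a$, and any stationary solution is almost surely equal to $a$. 2. $\{a(\omega)\}$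 is a pullback attractor of the scheme. 3. $a$ is almost surely exponentially stable. That is, first, for every $\varepsilon>0$ there is a positive random variable $r$ such that almost surely every $y_0$ with $\|y_0-a(\omega)\|<r(\omega)$ satisfies $\sup_k\|\varphi(k,\omega)y_0-a(\theta_{k\Delta}\omega)\|<\varepsilon$. Second, there are positive random variables $r,\beta$ and a constant $\mu>0$ such that almost surely every $y_0$ with $\|y_0-a(\omega)\|<r(\omega)$ satisfies $\|\varphi(k,\omega)y_0-a(\theta_{k\Delta}\omega)\|\le\beta(\omega)e^{-\mu k\Delta}$ for all $k\in\mathbb N$. -/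

import Mathlib

open MeasureTheory Filter Topology
open scoped ENNReal ContDiff

noncomputable section

namespace RoughEuler

/-- `ℝ^n` with the Euclidean norm. -/
abbrev Vec (n : ℕ) : Type := EuclideanSpace ℝ (Fin n)

/-- `ℝ^m ⊗ ℝ^m`, coordinatised by pairs of indices, with the Euclidean norm. -/
abbrev Tens (m : ℕ) : Type := EuclideanSpace ℝ (Fin m × Fin m)

/-- The tensor product `a ⊗ b` of two vectors. -/
def tens {m : ℕ} (a b : Vec m) : Tens m := WithLp.toLp 2 fun ij => a ij.1 * b ij.2

/-! ### The group `T²₁(ℝ^m) = 1 ⊕ ℝ^m ⊕ (ℝ^m ⊗ ℝ^m)` -/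

/-- An element `(1, g¹, g²)` of `T²₁(ℝ^m)` is recorded by the pair `(g¹, g²)`. -/
abbrev T2 (m : ℕ) : Type := Vec m × Tens m

/-- `(1, g¹, g²) ⊗ (1, h¹, h²) = (1, g¹ + h¹, g¹ ⊗ h¹ + g² + h²)`. -/
def T2.mul {m : ℕ} (g h : T2 m) : T2 m := (g.1 + h.1, tens g.1 h.1 + g.2 + h.2)

/-- `(1, g¹, g²)⁻¹ = (1, -g¹, g¹ ⊗ g¹ - g²)`. -/
def T2.inv {m : ℕ} (g : T2 m) : T2 m := (-g.1, tens g.1 g.1 - g.2)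

/-- The increment `w_s⁻¹ ⊗ w_t = (1, x_{s,t}, 𝕏_{s,t})` of a path `w` in `T²₁(ℝ^m)`. -/
def incr {m : ℕ} (w : ℝ → T2 m) (s t : ℝ) : T2 m := T2.mul (T2.inv (w s)) (w t)

theorem T2.mul_inv_self {m : ℕ} (g : T2 m) : T2.mul (T2.inv g) g = 0 := by
  refine Prod.ext ?_ ?_
  · ext i; simp [T2.mul, T2.inv]
  · ext i; simp [T2.mul, T2.inv, tens]; ring

theorem incr_shift {m : ℕ} (w : ℝ → T2 m) (c : T2 m) (t s u : ℝ) :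
    incr (fun r => T2.mul c (w (t + r))) s u = incr w (t + s) (t + u) := by
  refine Prod.ext ?_ ?_
  · ext i; simp [incr, T2.mul, T2.inv]
  · ext i; simp [incr, T2.mul, T2.inv, tens]; ring

/-- The rough path `α`-Hölder distance of `v` and `w` on `[-T, T]` is at most `ε`
(at both levels, with exponents `α` and `2α`). -/
def HolderClose {m : ℕ} (α T ε : ℝ) (v w : ℝ → T2 m) : Prop :=
  ∀ s ∈ Set.Icc (-T) T, ∀ t ∈ Set.Icc (-T) T,
    ‖(incr v s t).1 - (incr w s t).1‖ ≤ ε * |t - s| ^ α ∧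
    ‖(incr v s t).2 - (incr w s t).2‖ ≤ ε * |t - s| ^ (2 * α)

/-- The space `C_0^{0,α}(ℝ, T²₁(ℝ^m))`: paths started at the unit which, on every compact
interval, are `α`-Hölder rough paths and lie in the `α`-Hölder closure of the smooth paths. -/
def PathSpace (m : ℕ) (α : ℝ) : Type :=
  {w : ℝ → T2 m // w 0 = 0 ∧
    (∀ T : ℝ, 0 < T → ∃ K : ℝ, HolderClose α T K w (fun _ => 0)) ∧
    (∀ T : ℝ, 0 < T → ∀ ε : ℝ, 0 < ε →
      ∃ η : ℝ → T2 m, ContDiff ℝ ∞ η ∧ HolderClose α T ε w η)}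

/-- The topology of `α`-Hölder convergence on compact intervals. -/
instance {m : ℕ} {α : ℝ} : TopologicalSpace (PathSpace m α) :=
  TopologicalSpace.generateFrom
    {U | ∃ (w : PathSpace m α) (T r : ℝ), 0 < T ∧ 0 < r ∧
      U = {v : PathSpace m α | ∃ r' < r, HolderClose α T r' v.1 w.1}}

instance {m : ℕ} {α : ℝ} : MeasurableSpace (PathSpace m α) := borel _

instance {m : ℕ} {α : ℝ} : BorelSpace (PathSpace m α) := ⟨rfl⟩

theorem HolderClose.shift {m : ℕ} {α T ε t : ℝ} {v w : ℝ → T2 m}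
    (h : HolderClose α (T + |t|) ε v w) (c e : T2 m) :
    HolderClose α T ε (fun r => T2.mul c (v (t + r))) (fun r => T2.mul e (w (t + r))) := by
  intro s hs u hu
  have h1 := neg_abs_le t
  have h2 := le_abs_self t
  have key := h (t + s) ⟨by linarith [hs.1], by linarith [hs.2]⟩
    (t + u) ⟨by linarith [hu.1], by linarith [hu.2]⟩
  have e1 : t + u - (t + s) = u - s := by ring
  rw [e1] at key
  rw [incr_shift, incr_shift]
  exact key

theorem T2.zero_mul {m : ℕ} (g : T2 m) : T2.mul 0 g = g := by
  refine Prod.ext ?_ ?_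
  · ext i; simp [T2.mul]
  · ext i; simp [T2.mul, tens]

/-- The Wiener-type shift `(θ_t ω)_s = ω_t⁻¹ ⊗ ω_{t+s}`. -/
def shift {m : ℕ} {α : ℝ} (t : ℝ) (w : PathSpace m α) : PathSpace m α :=
  ⟨fun s => T2.mul (T2.inv (w.1 t)) (w.1 (t + s)), by
    refine ⟨by simpa using T2.mul_inv_self (w.1 t), fun T hT => ?_, fun T hT ε hε => ?_⟩
    · obtain ⟨K, hK⟩ := w.2.2.1 (T + |t|) (by positivity)
      exact ⟨K, by simpa only [T2.zero_mul] using hK.shift (T2.inv (w.1 t)) 0⟩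
    · obtain ⟨η, hη, hc⟩ := w.2.2.2 (T + |t|) (by positivity) ε hε
      refine ⟨fun r => η (t + r), hη.comp (contDiff_const.add contDiff_id), ?_⟩
      simpa only [T2.zero_mul] using hc.shift (T2.inv (w.1 t)) 0⟩

/-- The first level increment `x_{s,t}(ω)`. -/
def lvl1 {m : ℕ} {α : ℝ} (w : PathSpace m α) (s t : ℝ) : Vec m := (incr w.1 s t).1

/-- The second level increment `𝕏_{s,t}(ω)`. -/
def lvl2 {m : ℕ} {α : ℝ} (w : PathSpace m α) (s t : ℝ) : Tens m := (incr w.1 s t).2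

/-! ### Assumptions on the noise and on the coefficients -/

/-- The canonical process has stationary increments under `P`: the shift preserves `P`. -/
def StationaryIncrements {m : ℕ} {α : ℝ} (P : Measure (PathSpace m α)) : Prop :=
  ∀ t : ℝ, MeasurePreserving (shift (m := m) (α := α) t) P P

/-- Ergodicity of the flow of shifts: invariant events are trivial. -/
def ShiftErgodic {m : ℕ} {α : ℝ} (P : Measure (PathSpace m α)) : Prop :=
  ∀ A : Set (PathSpace m α), MeasurableSet A → (∀ t : ℝ, shift t ⁻¹' A = A) → P A = 0 ∨ P A = 1

/-- `E(‖x_{s,t}‖^p + ‖𝕏_{s,t}‖^{p/2}) ≤ C |t-s|^{pν}` on `[0,T]`, for each `T` and each exponent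
`p` with `p ν ≥ 1`, where `C` depends on `T` and `p`. -/
def MomentBound {m : ℕ} {α : ℝ} (ν : ℝ) (P : Measure (PathSpace m α)) : Prop :=
  ∀ p : ℝ, 1 ≤ p * ν → ∀ T : ℝ, 0 < T → ∃ C : ℝ, 0 < C ∧
    ∀ s ∈ Set.Icc 0 T, ∀ t ∈ Set.Icc 0 T,
      ∫⁻ w, (‖lvl1 w s t‖ₑ ^ p + ‖lvl2 w s t‖ₑ ^ (p / 2)) ∂P
        ≤ ENNReal.ofReal (C * |t - s| ^ (p * ν))

/-- `⟨y₁ - y₂, f(y₁) - f(y₂)⟩ ≤ -D ‖y₁ - y₂‖²` for some `D > 0`. -/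
def StrictlyDissipative {d : ℕ} (f : Vec d → Vec d) : Prop :=
  ∃ D : ℝ, 0 < D ∧ ∀ y₁ y₂ : Vec d, inner ℝ (y₁ - y₂) (f y₁ - f y₂) ≤ -D * ‖y₁ - y₂‖ ^ 2

/-- `g ∈ C³_b`. -/
def IsC3b {d m : ℕ} (g : Vec d → (Vec m →L[ℝ] Vec d)) : Prop :=
  ContDiff ℝ 3 g ∧
    ∀ k : ℕ, k ≤ 3 → BddAbove (Set.range fun y : Vec d => ‖iteratedFDeriv ℝ k g y‖)

/-- `‖D^k g‖_∞`. -/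
def supD {d m : ℕ} (k : ℕ) (g : Vec d → (Vec m →L[ℝ] Vec d)) : ℝ :=
  ⨆ y : Vec d, ‖iteratedFDeriv ℝ k g y‖

/-- The size parameter `L_g` of the diffusion coefficient. -/
def Lg {d m : ℕ} (g : Vec d → (Vec m →L[ℝ] Vec d)) : ℝ :=
  max (max (supD 1 g) (supD 2 g))
    (max (√(supD 0 g * max (supD 1 g) (max (supD 2 g) (supD 3 g))))
      ((supD 0 g ^ 2 * supD 3 g) ^ ((1 : ℝ) / 3)))

/-! ### The discretization scheme -/

/-- `Dg(y) g(y) 𝕏 = ∑_{i,j} 𝕏^{ij} Dg(y)[g(y) e_i] e_j`. -/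
def secondOrder {d m : ℕ} (g : Vec d → (Vec m →L[ℝ] Vec d)) (y : Vec d) (X : Tens m) : Vec d :=
  ∑ i : Fin m, ∑ j : Fin m,
    X (i, j) • (fderiv ℝ g y (g y (EuclideanSpace.single i 1))) (EuclideanSpace.single j 1)

/-- The solution `y_{t_k}`, `t_k = k Δ`, of the scheme with `y_0 = y`:
`y_{t_{k+1}} = y_{t_k} + f(y_{t_k}) Δ + g(y_{t_k}) x_{t_k,t_{k+1}}
  + Dg(y_{t_k}) g(y_{t_k}) 𝕏_{t_k,t_{k+1}}`. -/
def euler {d m : ℕ} {α : ℝ} (f : Vec d → Vec d) (g : Vec d → (Vec m →L[ℝ] Vec d)) (Δ : ℝ) :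
    ℕ → PathSpace m α → Vec d → Vec d
  | 0, _, y => y
  | k + 1, w, y =>
    euler f g Δ k w y + Δ • f (euler f g Δ k w y)
      + g (euler f g Δ k w y) (lvl1 w (k * Δ) ((k + 1) * Δ))
      + secondOrder g (euler f g Δ k w y) (lvl2 w (k * Δ) ((k + 1) * Δ))

/-- A stationary solution of the scheme: a random point `a` such that, almost surely,
`k ↦ a (θ_{kΔ} ω)` is the solution started at `a ω`. -/
def IsStationarySolution {d m : ℕ} {α : ℝ} (P : Measure (PathSpace m α)) (f : Vec d → Vec d)
    (g : Vec d → (Vec m →L[ℝ] Vec d)) (Δ : ℝ) (a : PathSpace m α → Vec d) : Prop :=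
  Measurable a ∧ ∀ᵐ w ∂P, ∀ k : ℕ, euler f g Δ k w (a w) = a (shift (k * Δ) w)

/-- A family of sets is tempered if it is contained in balls `B(0, r(ω))` with a random radius
`r` such that `log⁺ r(θ_{kΔ} ω) / |k| → 0` as `k → ±∞`, almost surely. -/
def IsTempered {d m : ℕ} {α : ℝ} (P : Measure (PathSpace m α)) (Δ : ℝ)
    (S : PathSpace m α → Set (Vec d)) : Prop :=
  ∃ r : PathSpace m α → ℝ, Measurable r ∧
    (∀ᵐ w ∂P, S w ⊆ Metric.closedBall 0 (r w)) ∧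
    ∀ᵐ w ∂P,
      Tendsto (fun k : ℕ => Real.posLog (r (shift (k * Δ) w)) / k) atTop (𝓝 0) ∧
      Tendsto (fun k : ℕ => Real.posLog (r (shift (-(k * Δ)) w)) / k) atTop (𝓝 0)

/-- `A` is the random pullback attractor of the random dynamical system generated by the scheme:
a tempered, invariant, nonempty compact random set that attracts every tempered family `S` in
the pullback sense, i.e. the Hausdorff semi-distance of `φ(k, θ_{-kΔ} ω) S(θ_{-kΔ} ω)`
to `A(ω)` tends to `0` almost surely. -/
structure IsPullbackAttractor {d m : ℕ} {α : ℝ} (P : Measure (PathSpace m α))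
    (f : Vec d → Vec d) (g : Vec d → (Vec m →L[ℝ] Vec d)) (Δ : ℝ)
    (A : PathSpace m α → Set (Vec d)) : Prop where
  nonempty : ∀ w, (A w).Nonempty
  compact : ∀ w, IsCompact (A w)
  measurable : ∀ y : Vec d, Measurable fun w => Metric.infDist y (A w)
  tempered : IsTempered P Δ A
  invariant : ∀ᵐ w ∂P, ∀ k : ℕ, euler f g Δ k w '' A w = A (shift (k * Δ) w)
  attracts : ∀ S : PathSpace m α → Set (Vec d), IsTempered P Δ S →
    ∀ᵐ w ∂P, Tendsto
      (fun k : ℕ => ⨆ y ∈ S (shift (-(k * Δ)) w),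
        Metric.infEDist (euler f g Δ k (shift (-(k * Δ)) w) y) (A w))
      atTop (𝓝 0)

/-- Almost sure Lyapunov stability of the stationary solution `a` on the grid. -/
def IsStable {d m : ℕ} {α : ℝ} (P : Measure (PathSpace m α)) (f : Vec d → Vec d)
    (g : Vec d → (Vec m →L[ℝ] Vec d)) (Δ : ℝ) (a : PathSpace m α → Vec d) : Prop :=
  ∀ ε : ℝ, 0 < ε → ∃ r : PathSpace m α → ℝ, Measurable r ∧ (∀ w, 0 < r w) ∧
    ∀ᵐ w ∂P, ∀ y : Vec d, ‖y - a w‖ < r w →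
      ⨆ k : ℕ, edist (euler f g Δ k w y) (a (shift (k * Δ) w)) < ENNReal.ofReal ε

/-- Almost sure exponential stability of the stationary solution `a` on the grid, with random
radius `r`, random constant `β` and non-random rate `μ`. -/
def IsExponentiallyStable {d m : ℕ} {α : ℝ} (P : Measure (PathSpace m α)) (f : Vec d → Vec d)
    (g : Vec d → (Vec m →L[ℝ] Vec d)) (Δ : ℝ) (a : PathSpace m α → Vec d) : Prop :=
  IsStable P f g Δ a ∧
    ∃ (r β : PathSpace m α → ℝ) (μ : ℝ), Measurable r ∧ Measurable β ∧
      (∀ w, 0 < r w) ∧ (∀ w, 0 < β w) ∧ 0 < μ ∧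
      ∀ᵐ w ∂P, ∀ y : Vec d, ‖y - a w‖ < r w →
        ∀ k : ℕ, ‖euler f g Δ k w y - a (shift (k * Δ) w)‖ ≤ β w * Real.exp (-μ * (k * Δ))

end RoughEuler

end

/-! The heart of the proof is a pathwise contraction. For two solutions driven by the same noise,
‖φ(k,ω)u − φ(k,ω)y‖ ≤ exp(−(D/16) kΔ + C(‖y‖^10 + 1 + B(ω))) ‖u − y‖ with a finite random B, and the
same bound holds with ω replaced by θ_{-kΔ}ω on the left but B still taken at ω
(`exists_isContracting`). Only one of the two initial values enters the constant.

Locally, let the noise have Hölder constant N on an interval of length T ≤ 1 and let (1+γ)Y, with γ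
= ‖g‖_∞, bound the drift along y. A discrete sewing lemma (`norm_rsum_sub_le`) shows that the noise
perturbs the difference of the solutions by at most a multiple of E·(maximal distance), E = L_g N (1
+ L_f + Y) T^α, provided E is small. Dissipativity contributes the factor exp(−DT/8), and it
tolerates perturbations that are small in supremum norm, however rough (`norm_le_of_dissipative`).
An interval on which E is large is halved until E is of order one on each piece or the piece is a
single step. Since 3α > 1, E on such a piece is at most a constant times (E/T^α)³ T, which adds up
over the pieces. So a block of length at most one has contraction exponent −DT/8 plus L_g times a
polynomial in N and Y (`exists_norm_euler_sub_le`). No power of γ survives on its own: states are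
measured in units of 1+γ, and each remaining γ meets derivatives of g in one of the products that
make up L_g.

To chain the blocks, (‖y‖/(1+γ))^10 serves as a Lyapunov function. It decreases geometrically up to
a power of the noise (`exists_block_bound`), so its sum over the blocks telescopes into the initial
value and a sum of terms of order (1+N)^50 (`exists_chain_bound`). A Kolmogorov argument bounds that
sum by a continuous time integral of V(θ_s ω) with V integrable (`dyadicSum`). By the maximal
ergodic inequality and ergodicity of the flow this integral is at most ct + B(ω) once c exceeds the
mean of V (`ae_lintegral_flow_le`). As it enters multiplied by L_g, a small L_g leaves half of the
dissipation. The integral is taken in continuous time because a single map θ_Δ need not be ergodic,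
and because c, hence the threshold on L_g, then does not depend on Δ.

The remaining claims follow from the contraction. Pullback solutions started at 0 are Cauchy, and
their limit is stationary. Forward contraction and invariance of the measure give uniqueness.
Exponential stability is the forward estimate itself. Attraction of tempered sets is the pullback
estimate, half of whose rate pays for the growth of the radius. Temperedness of the limit comes from
the linear growth of one step: log⁺‖a‖ grows at most linearly along orbits, and recurrence improves
linear to sublinear (`ae_tendsto_iterate_div_of_le`). -/

namespace RoughEuler

/-! ### The maximal ergodic inequality and its consequences -/

/-- The maximum `max_{k ≤ n} S_k f` of the Birkhoff sums. -/
noncomputable def birkhoffMax {Ω : Type*} (T : Ω → Ω) (f : Ω → ℝ) : ℕ → Ω → ℝ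
  | 0, _ => 0
  | n + 1, x => max 0 (f x + birkhoffMax T f n (T x))

section BirkhoffMax

variable {Ω : Type*} {T : Ω → Ω} {f : Ω → ℝ}

theorem birkhoffMax_nonneg (n : ℕ) (x : Ω) : 0 ≤ birkhoffMax T f n x := by
  cases n with
  | zero => exact le_rfl
  | succ n => exact le_max_left _ _

theorem birkhoffMax_le_succ (n : ℕ) : ∀ x : Ω, birkhoffMax T f n x ≤ birkhoffMax T f (n + 1) x := by
  induction n with
  | zero => exact fun x => birkhoffMax_nonneg 1 x
  | succ n ih => exact fun x => max_le_max le_rfl (add_le_add le_rfl (ih (T x)))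

theorem birkhoffMax_mono (x : Ω) : Monotone fun n => birkhoffMax T f n x :=
  monotone_nat_of_le_succ fun n => birkhoffMax_le_succ n x

theorem birkhoffSum_le_birkhoffMax (n : ℕ) : ∀ x : Ω, birkhoffSum T f n x ≤ birkhoffMax T f n x := by
  induction n with
  | zero => intro x; simp [birkhoffSum_zero, birkhoffMax]
  | succ n ih =>
    intro x
    rw [birkhoffSum_succ']
    exact (add_le_add le_rfl (ih (T x))).trans (le_max_right _ _)

variable [MeasurableSpace Ω] {μ : Measure Ω}

theorem measurable_birkhoffMax (hT : Measurable T) (hf : Measurable f) (n : ℕ) :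
    Measurable (birkhoffMax T f n) := by
  induction n with
  | zero => exact measurable_const
  | succ n ih => exact measurable_const.max (hf.add (ih.comp hT))

theorem integrable_birkhoffMax (hT : MeasurePreserving T μ μ) (hf : Integrable f μ) (n : ℕ) :
    Integrable (birkhoffMax T f n) μ := by
  induction n with
  | zero => exact integrable_zero _ _ _
  | succ n ih =>
    have h := (hf.add (hT.integrable_comp_of_integrable ih)).pos_part
    refine h.congr (Eventually.of_forall fun x => ?_)
    simp [birkhoffMax, max_comm]

/-- The maximal ergodic inequality. -/
theorem setIntegral_birkhoffMax_pos_nonneg (hT : MeasurePreserving T μ μ) (hfm : Measurable f)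
    (hf : Integrable f μ) : 0 ≤ ∫ x in {x | ∃ n, 0 < birkhoffMax T f n x}, f x ∂μ := by
  set E : ℕ → Set Ω := fun n => {x | 0 < birkhoffMax T f (n + 1) x} with hE
  have hEm : ∀ n, MeasurableSet (E n) := fun n =>
    measurableSet_lt measurable_const (measurable_birkhoffMax hT.measurable hfm _)
  have hU : {x | ∃ n, 0 < birkhoffMax T f n x} = ⋃ n, E n := by
    ext x
    simp only [Set.mem_ofPred_eq, Set.mem_iUnion, hE]
    exact ⟨fun ⟨n, hn⟩ => ⟨n, hn.trans_le (birkhoffMax_le_succ n x)⟩, fun ⟨n, hn⟩ => ⟨_, hn⟩⟩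
  have hmono : Monotone E := fun a b hab x hx =>
    lt_of_lt_of_le hx (birkhoffMax_mono x (by omega))
  rw [hU]
  refine ge_of_tendsto' (tendsto_setIntegral_of_monotone hEm hmono hf.integrableOn) fun n => ?_
  have hi := integrable_birkhoffMax hT hf (n + 1)
  have hi' : Integrable (fun x => birkhoffMax T f (n + 1) (T x)) μ :=
    hT.integrable_comp_of_integrable hi
  -- Garsia's argument: where the maximum M is positive, f ≥ M − M∘T. The integral of M over this
  -- set is the full integral, that of M∘T is at most the full integral, and the two full integrals
  -- agree by invariance.
  have h1 : ∫ x in E n, (birkhoffMax T f (n + 1) x - birkhoffMax T f (n + 1) (T x)) ∂μ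
      ≤ ∫ x in E n, f x ∂μ := by
    refine setIntegral_mono_on (hi.sub hi').integrableOn hf.integrableOn (hEm n) fun x hx => ?_
    have h2 : birkhoffMax T f (n + 1) x = f x + birkhoffMax T f n (T x) := by
      have hx' : 0 < max 0 (f x + birkhoffMax T f n (T x)) := hx
      change max 0 (f x + birkhoffMax T f n (T x)) = _
      rcases le_total (f x + birkhoffMax T f n (T x)) 0 with h | h
      · rw [max_eq_left h] at hx'; exact absurd hx' (lt_irrefl _)
      · exact max_eq_right h
    have h3 := birkhoffMax_le_succ (T := T) (f := f) n (T x)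
    linarith
  refine le_trans ?_ h1
  have e1 : ∫ x in E n, birkhoffMax T f (n + 1) x ∂μ = ∫ x, birkhoffMax T f (n + 1) x ∂μ := by
    refine setIntegral_eq_integral_of_forall_compl_eq_zero fun x hx => ?_
    exact le_antisymm (not_lt.mp hx) (birkhoffMax_nonneg _ _)
  have e2 : ∫ x in E n, birkhoffMax T f (n + 1) (T x) ∂μ
      ≤ ∫ x, birkhoffMax T f (n + 1) (T x) ∂μ :=
    setIntegral_le_integral hi' (Eventually.of_forall fun x => birkhoffMax_nonneg _ _)
  have e3 : ∫ x, birkhoffMax T f (n + 1) (T x) ∂μ = ∫ x, birkhoffMax T f (n + 1) x ∂μ := by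
    have h := hT.map_eq
    conv_rhs => rw [← h]
    rw [integral_map hT.measurable.aemeasurable]
    exact (measurable_birkhoffMax hT.measurable hfm _).aestronglyMeasurable
  rw [integral_sub hi.integrableOn hi'.integrableOn]
  linarith

/-- The set in the maximal inequality has full measure here. Applied to F − c it turns "some
Birkhoff average of F exceeds c at almost every point" into ∫F ≥ c, which is all that is needed in
place of the pointwise ergodic theorem. -/
theorem integral_nonneg_of_exists_birkhoffSum_pos (hT : MeasurePreserving T μ μ)
    (hfm : Measurable f) (hf : Integrable f μ) (h : ∀ᵐ x ∂μ, ∃ n, 0 < birkhoffSum T f n x) :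
    0 ≤ ∫ x, f x ∂μ := by
  have h1 := setIntegral_birkhoffMax_pos_nonneg hT hfm hf
  rwa [setIntegral_congr_set (t := Set.univ), setIntegral_univ] at h1
  filter_upwards [h] with x hx
  obtain ⟨n, hn⟩ := hx
  exact propext ⟨fun _ => trivial, fun _ => ⟨n, hn.trans_le (birkhoffSum_le_birkhoffMax n x)⟩⟩

/-- The weak type inequality for visits to a set `B`. -/
theorem mul_measureReal_birkhoffSum_gt_le [IsFiniteMeasure μ] (hT : MeasurePreserving T μ μ)
    {B : Set Ω} (hB : MeasurableSet B) {δ : ℝ} (hδ : 0 ≤ δ) :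
    δ * μ.real {x | ∃ n : ℕ, δ * n < birkhoffSum T (B.indicator fun _ => (1 : ℝ)) n x}
      ≤ μ.real B := by
  -- The maximal inequality is applied to 1_B − δ, whose Birkhoff sums are positive exactly when the
  -- visits to B exceed frequency δ.
  set f : Ω → ℝ := fun x => B.indicator (fun _ => (1 : ℝ)) x - δ with hf
  have hfm : Measurable f := (measurable_const.indicator hB).sub_const δ
  have hfi : Integrable f μ := ((integrable_const (1 : ℝ)).indicator hB).sub (integrable_const δ)
  have h1 := setIntegral_birkhoffMax_pos_nonneg hT hfm hfi
  set E := {x | ∃ n, 0 < birkhoffMax T f n x}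
  rw [hf, integral_sub ((integrable_const (1 : ℝ)).indicator hB).integrableOn
    (integrable_const δ).integrableOn, setIntegral_const, setIntegral_indicator hB,
    setIntegral_const] at h1
  simp only [smul_eq_mul, mul_one] at h1
  have h2 : μ.real (E ∩ B) ≤ μ.real B := measureReal_mono Set.inter_subset_right
  have h3 : μ.real {x | ∃ n : ℕ, δ * n < birkhoffSum T (B.indicator fun _ => (1 : ℝ)) n x}
      ≤ μ.real E := by
    refine measureReal_mono fun x hx => ?_
    obtain ⟨n, hn⟩ := hx
    refine ⟨n, lt_of_lt_of_le ?_ (birkhoffSum_le_birkhoffMax n x)⟩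
    have : birkhoffSum T f n x
        = birkhoffSum T (B.indicator fun _ => (1 : ℝ)) n x - δ * n := by
      simp [birkhoffSum, hf, Finset.sum_sub_distrib, mul_comm]
    linarith
  have h4 := mul_le_mul_of_nonneg_left h3 hδ
  linarith

end BirkhoffMax

/-! ### Sublinear growth along orbits -/

section Sublinear

variable {Ω : Type*} {T : Ω → Ω}

/-- Pigeonhole: a window of m consecutive times cannot lie wholly outside G if fewer than m of all
the times do. -/
theorem exists_mem_window_of_birkhoffSum_le {G : Set Ω} {x : Ω} {a m : ℕ} {B : ℝ}
    (h : birkhoffSum T (Gᶜ.indicator fun _ => (1 : ℝ)) (a + m) x ≤ B) (hm : B < m) :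
    ∃ j < m, T^[a + j] x ∈ G := by
  by_contra! hcon
  have h0 : ∀ i, 0 ≤ Gᶜ.indicator (fun _ => (1 : ℝ)) (T^[i] x) := fun i =>
    Set.indicator_nonneg (fun _ _ => zero_le_one) _
  have h1 : (m : ℝ) ≤ birkhoffSum T (Gᶜ.indicator fun _ => (1 : ℝ)) (a + m) x := by
    rw [birkhoffSum, Finset.sum_range_add]
    have : (m : ℝ) = ∑ i ∈ Finset.range m, Gᶜ.indicator (fun _ => (1 : ℝ)) (T^[a + i] x) := by
      rw [Finset.sum_congr rfl fun i hi => Set.indicator_of_mem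
        (show T^[a + i] x ∈ Gᶜ from hcon i (Finset.mem_range.mp hi)) _]
      simp
    rw [← this]
    have := Finset.sum_nonneg fun i (_ : i ∈ Finset.range a) => h0 i
    linarith
  linarith

/-- The orbit misses the good set with frequency at most δ, so among the last ⌊2δk⌋ + 1 times up to
k there is a visit. From that visit the slope c acts over at most 2δk steps, which replaces the
slope c by 2cδ. The condition k ≥ 1 serves δ(k+1) ≤ 2δk. -/
theorem iterate_le_of_visits_forward {u : Ω → ℝ} {C c δ : ℝ} (hc : 0 ≤ c) (hδ0 : 0 < δ)
    (hδ : δ ≤ 1 / 2) {x : Ω}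
    (h : ∀ n : ℕ, birkhoffSum T ({w | ∀ k : ℕ, u (T^[k] w) ≤ C + c * k}ᶜ.indicator
      fun _ => (1 : ℝ)) n x ≤ δ * n) (k : ℕ) (hk : 1 ≤ k) :
    u (T^[k] x) ≤ (C + c) + 2 * c * δ * k := by
  set m := ⌊2 * δ * k⌋₊ + 1 with hm
  have hk' : (1 : ℝ) ≤ k := by exact_mod_cast hk
  have hfl : (⌊2 * δ * k⌋₊ : ℝ) ≤ 2 * δ * k := Nat.floor_le (by positivity)
  have hmk : m ≤ k + 1 := by
    have : ⌊2 * δ * k⌋₊ ≤ k := by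
      have : (⌊2 * δ * k⌋₊ : ℝ) ≤ k := by nlinarith
      exact_mod_cast this
    omega
  have hlt : 2 * δ * k < m := by rw [hm]; push_cast; exact Nat.lt_floor_add_one _
  have h1 := h ((k + 1 - m) + m)
  have e1 : k + 1 - m + m = k + 1 := by omega
  obtain ⟨j, hj, hG⟩ := exists_mem_window_of_birkhoffSum_le h1
    (by rw [e1]; push_cast; nlinarith)
  have e2 : T^[k] x = T^[m - 1 - j] (T^[k + 1 - m + j] x) := by
    rw [← Function.iterate_add_apply]; congr 1; omega
  rw [e2]
  refine (hG (m - 1 - j)).trans ?_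
  have h3 : ((m - 1 - j : ℕ) : ℝ) ≤ 2 * δ * k := by
    refine le_trans ?_ hfl
    exact_mod_cast (by omega : m - 1 - j ≤ ⌊2 * δ * k⌋₊)
  nlinarith

/-- Now the visit is sought further in the past, at T'^[k+j] x with j ≤ 2δk, and the forward bound
is run from there for j steps back up to T'^[k] x. The window works because δ(k+m) < m when 2δk < m
and δ ≤ 1/2. -/
theorem iterate_le_of_visits_backward {T' : Ω → Ω} (hTT : ∀ x, T (T' x) = x) {u : Ω → ℝ}
    {C c δ : ℝ} (hc : 0 ≤ c) (hδ0 : 0 < δ) (hδ : δ ≤ 1 / 2) {x : Ω}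
    (h : ∀ n : ℕ, birkhoffSum T' ({w | ∀ k : ℕ, u (T^[k] w) ≤ C + c * k}ᶜ.indicator
      fun _ => (1 : ℝ)) n x ≤ δ * n) (k : ℕ) :
    u (T'^[k] x) ≤ (C + c) + 2 * c * δ * k := by
  set m := ⌊2 * δ * k⌋₊ + 1 with hm
  have hfl : (⌊2 * δ * k⌋₊ : ℝ) ≤ 2 * δ * k := Nat.floor_le (by positivity)
  have hlt : 2 * δ * k < m := by rw [hm]; push_cast; exact Nat.lt_floor_add_one _
  have hm1 : (1 : ℝ) ≤ m := by rw [hm]; push_cast; linarith [Nat.cast_nonneg (α := ℝ) ⌊2 * δ * k⌋₊]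
  have h1 := h (k + m)
  obtain ⟨j, hj, hG⟩ := exists_mem_window_of_birkhoffSum_le h1 (by push_cast; nlinarith)
  have hinv : ∀ (j : ℕ) (y : Ω), T^[j] (T'^[j] y) = y := fun j y =>
    Function.LeftInverse.iterate hTT j y
  have e2 : T'^[k] x = T^[j] (T'^[k + j] x) := by
    rw [add_comm k j, Function.iterate_add_apply T', hinv]
  rw [e2]
  refine (hG j).trans ?_
  have h3 : (j : ℝ) ≤ 2 * δ * k := by
    refine le_trans ?_ hfl
    exact_mod_cast (by omega : j ≤ ⌊2 * δ * k⌋₊)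
  nlinarith

variable [MeasurableSpace Ω] {μ : Measure Ω}

/-- If all but a null set of points lie in one of the increasing sets `G n`, then for almost every
point there is an `n` such that the orbit leaves `G n` with frequency at most `δ`. -/
theorem ae_exists_birkhoffSum_compl_le [IsFiniteMeasure μ] (hT : MeasurePreserving T μ μ)
    {G : ℕ → Set Ω} (hG : ∀ n, MeasurableSet (G n)) (hmono : Monotone G)
    (hfull : ∀ᵐ x ∂μ, ∃ n, x ∈ G n) {δ : ℝ} (hδ : 0 < δ) :
    ∀ᵐ x ∂μ, ∃ n, ∀ N : ℕ,
      birkhoffSum T ((G n)ᶜ.indicator fun _ => (1 : ℝ)) N x ≤ δ * N := by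
  have h1 : Tendsto (fun n => μ.real (G n)ᶜ) atTop (𝓝 0) := by
    have h := tendsto_measure_iInter_atTop (μ := μ) (s := fun n => (G n)ᶜ)
      (fun n => (hG n).compl.nullMeasurableSet)
      (fun a b hab => Set.compl_subset_compl.mpr (hmono hab)) ⟨0, measure_ne_top _ _⟩
    have h0 : μ (⋂ n, (G n)ᶜ) = 0 := by
      refine measure_mono_null (fun x hx => ?_) (ae_iff.mp hfull)
      simp only [Set.mem_iInter, Set.mem_compl_iff] at hx
      exact fun ⟨n, hn⟩ => hx n hn
    rw [h0] at h
    exact (ENNReal.tendsto_toReal ENNReal.zero_ne_top).comp h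
  rw [ae_iff]
  -- A point of the exceptional set visits the complement of every G n too often, so the weak type
  -- bound holds for each n; the measures of the complements tend to 0.
  have key : ∀ n, μ.real {x | ¬ ∃ n, ∀ N : ℕ,
      birkhoffSum T ((G n)ᶜ.indicator fun _ => (1 : ℝ)) N x ≤ δ * N} ≤ μ.real (G n)ᶜ / δ := by
    intro n
    rw [le_div_iff₀ hδ, mul_comm]
    refine le_trans (mul_le_mul_of_nonneg_left (measureReal_mono ?_) hδ.le)
      (mul_measureReal_birkhoffSum_gt_le hT (hG n).compl hδ.le)
    intro x hx
    have hx' : ¬ ∃ n, ∀ N : ℕ,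
      birkhoffSum T ((G n)ᶜ.indicator fun _ => (1 : ℝ)) N x ≤ δ * N := hx
    push Not at hx'
    exact hx' n
  have h2 := ge_of_tendsto' (h1.div_const δ) key
  rw [zero_div] at h2
  exact (measureReal_eq_zero_iff).mp (le_antisymm h2 measureReal_nonneg)

theorem tendsto_div_of_forall_le {v : ℕ → ℝ} (h0 : ∀ k, 0 ≤ v k) {c : ℝ}
    (h : ∀ j : ℕ, ∃ C : ℝ, ∀ k : ℕ, 1 ≤ k → v k ≤ C + 2 * c * (1 / (j + 2)) * k) :
    Tendsto (fun k : ℕ => v k / k) atTop (𝓝 0) := by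
  rw [Metric.tendsto_atTop]
  intro ε hε
  obtain ⟨j, hj⟩ := exists_nat_gt (4 * c / ε)
  obtain ⟨C, hC⟩ := h j
  obtain ⟨K, hK⟩ := exists_nat_gt (2 * |C| / ε)
  refine ⟨K + 1, fun k hk => ?_⟩
  have hk1 : 1 ≤ k := by omega
  have hk0 : (0 : ℝ) < k := by exact_mod_cast hk1
  have hkK : (K : ℝ) ≤ k := by exact_mod_cast (by omega : K ≤ k)
  rw [Real.dist_eq, sub_zero, abs_of_nonneg (div_nonneg (h0 k) hk0.le), div_lt_iff₀ hk0]
  have h1 := hC k hk1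
  have h2 : 2 * c * (1 / ((j : ℝ) + 2)) ≤ ε / 2 := by
    rw [mul_one_div, div_le_iff₀ (by positivity)]
    rw [div_lt_iff₀ hε] at hj
    nlinarith
  have h3 : |C| < ε / 2 * k := by
    rw [div_lt_iff₀ hε] at hK
    nlinarith
  have h4 := le_abs_self C
  nlinarith

/-- If a nonnegative function grows at most linearly, with a fixed slope, along almost every forward
orbit of an invertible measure preserving map, then it grows sublinearly along almost every
forward and backward orbit. -/
theorem ae_tendsto_iterate_div_of_le [IsFiniteMeasure μ] {T' : Ω → Ω}
    (hT : MeasurePreserving T μ μ) (hT' : MeasurePreserving T' μ μ) (hTT : ∀ x, T (T' x) = x)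
    {u : Ω → ℝ} (hu : Measurable u) (hu0 : ∀ x, 0 ≤ u x) {c : ℝ} (hc : 0 ≤ c)
    (h : ∀ᵐ x ∂μ, ∃ C : ℝ, ∀ k : ℕ, u (T^[k] x) ≤ C + c * k) :
    ∀ᵐ x ∂μ, Tendsto (fun k : ℕ => u (T^[k] x) / k) atTop (𝓝 0) ∧
      Tendsto (fun k : ℕ => u (T'^[k] x) / k) atTop (𝓝 0) := by
  set G : ℕ → Set Ω := fun n => {w | ∀ k : ℕ, u (T^[k] w) ≤ (n : ℝ) + c * k} with hGdef
  have hG : ∀ n, MeasurableSet (G n) := fun n => by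
    have : G n = ⋂ k : ℕ, {w | u (T^[k] w) ≤ (n : ℝ) + c * k} := by ext; simp [hGdef]
    rw [this]
    exact MeasurableSet.iInter fun k =>
      measurableSet_le (hu.comp (hT.measurable.iterate k)) measurable_const
  have hmono : Monotone G := fun a b hab w hw k => (hw k).trans
    (by have : (a : ℝ) ≤ b := by exact_mod_cast hab
        linarith)
  have hfull : ∀ᵐ x ∂μ, ∃ n, x ∈ G n := by
    filter_upwards [h] with x ⟨C, hC⟩
    obtain ⟨n, hn⟩ := exists_nat_ge C
    exact ⟨n, fun k => (hC k).trans (by linarith)⟩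
  have hδ : ∀ j : ℕ, (0 : ℝ) < 1 / (j + 2) ∧ (1 : ℝ) / (j + 2) ≤ 1 / 2 := fun j =>
    ⟨by positivity, one_div_le_one_div_of_le two_pos (by linarith [Nat.cast_nonneg (α := ℝ) j])⟩
  have hf := ae_all_iff.mpr fun j : ℕ =>
    ae_exists_birkhoffSum_compl_le hT hG hmono hfull (hδ j).1
  have hb := ae_all_iff.mpr fun j : ℕ =>
    ae_exists_birkhoffSum_compl_le hT' hG hmono hfull (hδ j).1
  filter_upwards [hf, hb] with x hxf hxb
  constructor
  · refine tendsto_div_of_forall_le (c := c) (fun k => hu0 _) fun j => ?_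
    obtain ⟨n, hn⟩ := hxf j
    exact ⟨_, fun k hk => iterate_le_of_visits_forward hc (hδ j).1 (hδ j).2 hn k hk⟩
  · refine tendsto_div_of_forall_le (c := c) (fun k => hu0 _) fun j => ?_
    obtain ⟨n, hn⟩ := hxb j
    exact ⟨_, fun k _ => iterate_le_of_visits_backward hTT hc (hδ j).1 (hδ j).2 hn k⟩

end Sublinear

/-! ### Time averages along an ergodic flow -/

section Flow

variable {Ω : Type*} {φ : ℝ → Ω → Ω} {V : Ω → ℝ≥0∞}

theorem lintegral_flow_shift (hadd : ∀ s t w, φ (s + t) w = φ s (φ t w)) (a b t : ℝ) (w : Ω) :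
    ∫⁻ s in Set.Ico a b, V (φ s (φ t w)) = ∫⁻ s in Set.Ico (a + t) (b + t), V (φ s w) := by
  have h := (measurePreserving_add_right volume t).setLIntegral_comp_emb
    (MeasurableEquiv.addRight t).measurableEmbedding (fun s => V (φ s w)) (Set.Ico a b)
  rw [Set.image_add_const_Ico] at h
  rw [← h]
  exact lintegral_congr fun s => by
    rw [hadd]

/-- For an ergodic flow, the time integrals of a function grow at most linearly with any slope
exceeding the space average. -/
theorem ae_lintegral_flow_le [MeasurableSpace Ω] {μ : Measure Ω} [IsProbabilityMeasure μ]
    (hzero : ∀ w, φ 0 w = w)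
    (hadd : ∀ s t w, φ (s + t) w = φ s (φ t w)) (hmp : ∀ t, MeasurePreserving (φ t) μ μ)
    (herg : ∀ A : Set Ω, MeasurableSet A → (∀ t : ℝ, φ t ⁻¹' A = A) → μ A = 0 ∨ μ A = 1)
    (hV : Measurable fun p : ℝ × Ω => V (φ p.1 p.2)) {c : ℝ} (hc : 0 < c)
    (hVc : ∫⁻ w, V w ∂μ < ENNReal.ofReal c) :
    ∀ᵐ w ∂μ, ∃ C : ℕ, ∀ n : ℕ,
      ∫⁻ s in Set.Ico (0 : ℝ) n, V (φ s w) ≤ ENNReal.ofReal (c * n) + C := by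
  have hVm : Measurable V := by
    have : V = (fun p : ℝ × Ω => V (φ p.1 p.2)) ∘ fun w => ((0 : ℝ), w) := by
      funext w; simp [hzero]
    rw [this]
    exact hV.comp measurable_prodMk_left
  have hmeas : ∀ a b : ℝ, Measurable fun w => ∫⁻ s in Set.Ico a b, V (φ s w) := fun a b =>
    Measurable.lintegral_prod_left' (μ := volume.restrict (Set.Ico a b)) hV
  have hmean : ∀ a b : ℝ, ∫⁻ w, (∫⁻ s in Set.Ico a b, V (φ s w)) ∂μ
      = ENNReal.ofReal (b - a) * ∫⁻ w, V w ∂μ := by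
    intro a b
    rw [lintegral_lintegral_swap (f := fun w s => V (φ s w)) (hV.comp measurable_swap).aemeasurable]
    simp only [fun s => (hmp s).lintegral_comp hVm]
    rw [setLIntegral_const, Real.volume_Ico, mul_comm]
  have hVtop : ∫⁻ w, V w ∂μ ≠ ⊤ := (hVc.trans ENNReal.ofReal_lt_top).ne
  have hfin : ∀ᵐ w ∂μ, ∀ n : ℕ, ∫⁻ s in Set.Ico (-(n : ℝ)) n, V (φ s w) ≠ ⊤ := by
    refine ae_all_iff.mpr fun n => ?_
    refine (ae_lt_top (hmeas _ _) ?_).mono fun _ h => h.ne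
    rw [hmean]
    exact ENNReal.mul_ne_top ENNReal.ofReal_ne_top hVtop
  -- Ergodicity is assumed for strictly invariant sets, so local integrability is made part of the
  -- bad set: it allows finite pieces of the time integral to be moved under φ t without discarding
  -- a null set.
  set A : Set Ω := {w | (∀ n : ℕ, ∫⁻ s in Set.Ico (-(n : ℝ)) n, V (φ s w) ≠ ⊤) ∧
    ∀ C : ℕ, ∃ n : ℕ, ENNReal.ofReal (c * n) + C < ∫⁻ s in Set.Ico (0 : ℝ) n, V (φ s w)}
    with hA
  have hAm : MeasurableSet A := by
    have e : A = (⋂ n : ℕ, {w | ∫⁻ s in Set.Ico (-(n : ℝ)) n, V (φ s w) ≠ ⊤}) ∩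
        ⋂ C : ℕ, ⋃ n : ℕ, {w | ENNReal.ofReal (c * n) + C
          < ∫⁻ s in Set.Ico (0 : ℝ) n, V (φ s w)} := by
      ext; simp [hA]
    rw [e]
    refine MeasurableSet.inter (MeasurableSet.iInter fun n => ?_)
      (MeasurableSet.iInter fun C => MeasurableSet.iUnion fun n => ?_)
    · exact (hmeas _ _) (measurableSet_singleton ⊤).compl
    · exact measurableSet_lt measurable_const (hmeas _ _)
  have hAt : ∀ t w, w ∈ A → φ t w ∈ A := by
    rintro t w ⟨h1, h2⟩
    obtain ⟨m, hm⟩ := exists_nat_ge |t|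
    have ht1 := neg_abs_le t
    have ht2 := le_abs_self t
    refine ⟨fun n => ?_, fun C => ?_⟩
    · rw [lintegral_flow_shift hadd]
      refine ne_top_of_le_ne_top (h1 (n + m)) (lintegral_mono_set (Set.Ico_subset_Ico ?_ ?_)) <;>
      push_cast <;> linarith
    · set I := ∫⁻ s in Set.Ico (-(m : ℝ)) m, V (φ s w) with hI
      -- With |t| ≤ m, a shift by t loses at most the finite integral over [−m, m), and replacing n
      -- by n + m costs c·m; both are absorbed into the additive constant.
      obtain ⟨C', hC'⟩ := ENNReal.exists_nat_gt
        (ENNReal.add_ne_top.mpr ⟨ENNReal.add_ne_top.mpr ⟨ENNReal.natCast_ne_top C,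
          ENNReal.ofReal_ne_top (r := c * m)⟩, h1 m⟩)
      obtain ⟨n, hn⟩ := h2 C'
      refine ⟨n + m, ?_⟩
      rw [lintegral_flow_shift hadd]
      have hsub : ∫⁻ s in Set.Ico (0 : ℝ) n, V (φ s w)
          ≤ I + ∫⁻ s in Set.Ico (0 + t) (((n + m : ℕ) : ℝ) + t), V (φ s w) := by
        refine le_trans (lintegral_mono_set ?_) (lintegral_union_le _ _ _)
        intro s hs
        by_cases hsm : s < m
        · left
          exact ⟨by linarith [hs.1, Nat.cast_nonneg (α := ℝ) m], hsm⟩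
        · right
          push Not at hsm
          refine ⟨by linarith, ?_⟩
          push_cast
          linarith [hs.2]
      have h3 : ENNReal.ofReal (c * n) + (C + ENNReal.ofReal (c * m) + I)
          < I + ∫⁻ s in Set.Ico (0 + t) (((n + m : ℕ) : ℝ) + t), V (φ s w) :=
        lt_of_le_of_lt (add_le_add le_rfl hC'.le) (hn.trans_le hsub)
      have e : ENNReal.ofReal (c * n) + (C + ENNReal.ofReal (c * m) + I)
          = I + (ENNReal.ofReal (c * (n + m : ℕ)) + C) := by
        have : c * ((n + m : ℕ) : ℝ) = c * n + c * m := by push_cast; ring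
        rw [this, ENNReal.ofReal_add (by positivity) (by positivity)]
        ring
      rw [e] at h3
      exact lt_of_add_lt_add_left h3
  have hAinv : ∀ t : ℝ, φ t ⁻¹' A = A := by
    intro t
    ext w
    refine ⟨fun h => ?_, hAt t w⟩
    have h' := hAt (-t) _ h
    rwa [← hadd, neg_add_cancel, hzero] at h'
  have hA0 : μ A = 0 := by
    refine (herg A hAm hAinv).resolve_right fun hA1 => ?_
    have hAae : ∀ᵐ w ∂μ, w ∈ A := (prob_compl_eq_zero_iff hAm).mpr hA1
    set F : Ω → ℝ≥0∞ := fun w => ∫⁻ s in Set.Ico (0 : ℝ) 1, V (φ s w) with hF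
    have hFm : Measurable F := hmeas 0 1
    have hFi : ∫⁻ w, F w ∂μ = ∫⁻ w, V w ∂μ := by rw [hF, hmean]; simp
    have hFint : Integrable (fun w => (F w).toReal) μ :=
      integrable_toReal_of_lintegral_ne_top hFm.aemeasurable (by rw [hFi]; exact hVtop)
    -- If A had full measure, the unit-time integral F of V would have, at almost every point, a
    -- Birkhoff sum under φ 1 above cn, so the mean of V would be at least c. The time-one map is
    -- only used as measure preserving here; ergodicity was spent on the flow.
    have hpos := integral_nonneg_of_exists_birkhoffSum_pos (hmp 1)
      (f := fun w => (F w).toReal - c) (hFm.ennreal_toReal.sub_const c)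
      (hFint.sub (integrable_const c)) ?_
    · rw [integral_sub hFint (integrable_const c), integral_toReal hFm.aemeasurable
        (ae_lt_top hFm (by rw [hFi]; exact hVtop)), hFi] at hpos
      simp only [integral_const, probReal_univ, smul_eq_mul, one_mul] at hpos
      have := (ENNReal.lt_ofReal_iff_toReal_lt hVtop).mp hVc
      linarith
    · filter_upwards [hAae] with w hw
      obtain ⟨n, hn⟩ := hw.2 0
      refine ⟨n, ?_⟩
      have hit : ∀ k : ℕ, (φ 1)^[k] w = φ k w := by
        intro k
        induction k with
        | zero => simp [hzero]
        | succ k ih => rw [Function.iterate_succ_apply', ih, ← hadd]; push_cast; rw [add_comm]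
      have hsum : ∀ k : ℕ, ∫⁻ s in Set.Ico (0 : ℝ) k, V (φ s w)
          = ∑ i ∈ Finset.range k, F ((φ 1)^[i] w) := by
        intro k
        induction k with
        | zero => simp
        | succ k ih =>
          rw [Finset.sum_range_succ, ← ih, hit, hF]
          simp only
          rw [lintegral_flow_shift hadd, ← lintegral_union measurableSet_Ico]
          · rw [zero_add, Set.Ico_union_Ico_eq_Ico (Nat.cast_nonneg k) (by linarith)]
            push_cast
            rw [add_comm (1 : ℝ)]
          · rw [zero_add]
            exact Set.Ico_disjoint_Ico_same
      have hne : ∀ i ∈ Finset.range n, F ((φ 1)^[i] w) ≠ ⊤ := by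
        intro i hi
        refine ne_top_of_le_ne_top (hw.1 n) (le_trans ?_ (lintegral_mono_set
          (Set.Ico_subset_Ico_left (a₁ := -(n : ℝ)) (a₂ := 0) (by simp))))
        rw [hsum n]
        exact Finset.single_le_sum (f := fun i => F ((φ 1)^[i] w)) (fun _ _ => zero_le) hi
      rw [hsum n, Nat.cast_zero, add_zero,
        ENNReal.ofReal_lt_iff_lt_toReal (by positivity) (ENNReal.sum_ne_top.mpr hne),
        ENNReal.toReal_sum hne] at hn
      simp only [birkhoffSum, Finset.sum_sub_distrib, Finset.sum_const, Finset.card_range,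
        nsmul_eq_mul]
      linarith
  have hAae : ∀ᵐ w ∂μ, w ∉ A := measure_eq_zero_iff_ae_notMem.mp hA0
  filter_upwards [hfin, hAae] with w h1 h2
  by_contra! hcon
  exact h2 ⟨h1, hcon⟩

end Flow

/-! ### The path space and the flow of shifts -/

section Paths

variable {m : ℕ} {α : ℝ}

theorem norm_tens (a b : Vec m) : ‖tens a b‖ = ‖a‖ * ‖b‖ := by
  rw [EuclideanSpace.norm_eq, EuclideanSpace.norm_eq, EuclideanSpace.norm_eq,
    ← Real.sqrt_mul (Finset.sum_nonneg fun _ _ => sq_nonneg _), Fintype.sum_prod_type,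
    Finset.sum_mul_sum]
  congr 1
  refine Finset.sum_congr rfl fun i _ => Finset.sum_congr rfl fun j _ => ?_
  simp only [tens, norm_mul]
  ring

theorem continuous_tens : Continuous fun p : Vec m × Vec m => tens p.1 p.2 := by
  unfold tens
  refine (PiLp.continuous_toLp 2 _).comp (continuous_pi fun ij => ?_)
  fun_prop

theorem continuous_mul : Continuous fun p : T2 m × T2 m => T2.mul p.1 p.2 := by
  unfold T2.mul
  refine (by fun_prop : Continuous fun p : T2 m × T2 m => p.1.1 + p.2.1).prodMk ?_
  have : Continuous fun p : T2 m × T2 m => tens p.1.1 p.2.1 :=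
    continuous_tens.comp (by fun_prop : Continuous fun p : T2 m × T2 m => (p.1.1, p.2.1))
  fun_prop

theorem continuous_inv : Continuous fun g : T2 m => T2.inv g := by
  unfold T2.inv
  refine (by fun_prop : Continuous fun g : T2 m => -g.1).prodMk ?_
  have : Continuous fun g : T2 m => tens g.1 g.1 :=
    continuous_tens.comp (by fun_prop : Continuous fun g : T2 m => (g.1, g.1))
  fun_prop

theorem incr_const_zero (s t : ℝ) : incr (fun _ => (0 : T2 m)) s t = 0 := by
  refine Prod.ext ?_ ?_
  · ext i; simp [incr, T2.mul, T2.inv]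
  · ext i; simp [incr, T2.mul, T2.inv, tens]

theorem mul_incr (w : ℝ → T2 m) (s t : ℝ) : T2.mul (w s) (incr w s t) = w t := by
  refine Prod.ext ?_ ?_
  · ext i; simp [incr, T2.mul, T2.inv]
  · ext i; simp [incr, T2.mul, T2.inv, tens]; ring

theorem incr_self (w : ℝ → T2 m) (s : ℝ) : incr w s s = 0 := T2.mul_inv_self _

theorem PathSpace.continuous (hα : 0 < α) (w : PathSpace m α) : Continuous w.1 := by
  rw [continuous_iff_continuousAt]
  intro t
  obtain ⟨K, hK⟩ := w.2.2.1 (|t| + 1) (by positivity)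
  have hev : ∀ᶠ u in 𝓝 t, u ∈ Set.Icc (-(|t| + 1)) (|t| + 1) := by
    refine Icc_mem_nhds ?_ ?_
    · linarith [neg_abs_le t]
    · linarith [le_abs_self t]
  have hlim : ∀ β : ℝ, 0 < β → Tendsto (fun u => K * |u - t| ^ β) (𝓝 t) (𝓝 0) := by
    intro β hβ
    have h : Tendsto (fun u : ℝ => K * |u - t| ^ β) (𝓝 t) (𝓝 (K * |t - t| ^ β)) :=
      ((((continuous_id.sub continuous_const).abs).rpow_const fun _ => Or.inr hβ.le).const_mul
        K).tendsto t
    simpa [Real.zero_rpow hβ.ne'] using h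
  have h1 : Tendsto (fun u => (incr w.1 t u).1) (𝓝 t) (𝓝 0) := by
    refine squeeze_zero_norm' ?_ (hlim α hα)
    filter_upwards [hev] with u hu
    simpa [incr_const_zero] using (hK t (mem_of_mem_nhds hev) u hu).1
  have h2 : Tendsto (fun u => (incr w.1 t u).2) (𝓝 t) (𝓝 0) := by
    refine squeeze_zero_norm' ?_ (hlim (2 * α) (by positivity))
    filter_upwards [hev] with u hu
    simpa [incr_const_zero] using (hK t (mem_of_mem_nhds hev) u hu).2
  have h3 : Tendsto (fun u => T2.mul (w.1 t) (incr w.1 t u)) (𝓝 t) (𝓝 (T2.mul (w.1 t) 0)) :=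
    (continuous_mul.tendsto (w.1 t, 0)).comp
      (tendsto_const_nhds.prodMk_nhds (h1.prodMk_nhds h2))
  have h4 : T2.mul (w.1 t) 0 = w.1 t := 
    (congrArg (T2.mul (w.1 t)) (incr_self w.1 t).symm).trans (mul_incr w.1 t t)
  simp only [mul_incr, h4] at h3
  exact h3

theorem PathSpace.continuous_incr (hα : 0 < α) (w : PathSpace m α) :
    Continuous fun p : ℝ × ℝ => incr w.1 p.1 p.2 := by
  have h := w.continuous hα
  exact continuous_mul.comp ((continuous_inv.comp (h.comp continuous_fst)).prodMk
    (h.comp continuous_snd))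

theorem exists_holderClose_nhds (w : PathSpace m α) (s t : ℝ) {ε : ℝ} (hε : 0 < ε) :
    ∀ᶠ v in 𝓝 w, ‖(incr v.1 s t).1 - (incr w.1 s t).1‖ < ε ∧
      ‖(incr v.1 s t).2 - (incr w.1 s t).2‖ < ε := by
  set T := max |s| |t| + 1 with hT
  -- b strictly dominates both Hölder weights, and the added 1 keeps it positive when s = t; an
  -- (ε/b)-neighbourhood of w then fits.
  set b := max (|t - s| ^ α) (|t - s| ^ (2 * α)) + 1 with hb
  have h0 : 0 ≤ |t - s| ^ α := by positivity
  have h0' : 0 ≤ |t - s| ^ (2 * α) := by positivity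
  have hb0 : 0 < b := by
    have := le_max_left (|t - s| ^ α) (|t - s| ^ (2 * α)); linarith
  have hopen : IsOpen {v : PathSpace m α | ∃ r' < ε / b, HolderClose α T r' v.1 w.1} :=
    TopologicalSpace.isOpen_generateFrom_of_mem
      ⟨w, T, ε / b, by positivity, by positivity, rfl⟩
  have hmem : w ∈ {v : PathSpace m α | ∃ r' < ε / b, HolderClose α T r' v.1 w.1} :=
    ⟨0, by positivity, fun s _ t _ => by simp⟩
  filter_upwards [hopen.mem_nhds hmem] with v hv
  obtain ⟨r', hr', hc⟩ := hv
  have hs : s ∈ Set.Icc (-T) T := by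
    have := le_max_left |s| |t|
    exact ⟨by linarith [neg_abs_le s], by linarith [le_abs_self s]⟩
  have ht : t ∈ Set.Icc (-T) T := by
    have := le_max_right |s| |t|
    exact ⟨by linarith [neg_abs_le t], by linarith [le_abs_self t]⟩
  have aux : ∀ x y : ℝ, 0 ≤ y → y < b → x ≤ r' * y → x < ε := by
    intro x y hy0 hy hx
    have h1 : r' * y ≤ ε / b * y := mul_le_mul_of_nonneg_right hr'.le hy0
    have h2 : ε / b * y < ε / b * b := mul_lt_mul_of_pos_left hy (by positivity)
    rw [div_mul_cancel₀ _ hb0.ne'] at h2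
    linarith
  have hl := le_max_left (|t - s| ^ α) (|t - s| ^ (2 * α))
  have hr := le_max_right (|t - s| ^ α) (|t - s| ^ (2 * α))
  exact ⟨aux _ _ h0 (by linarith) (hc s hs t ht).1, aux _ _ h0' (by linarith) (hc s hs t ht).2⟩

theorem measurable_lvl1 (s t : ℝ) : Measurable fun w : PathSpace m α => lvl1 w s t := by
  refine Continuous.measurable (continuous_iff_continuousAt.mpr fun w => ?_)
  refine Metric.tendsto_nhds.mpr fun ε hε => ?_
  filter_upwards [exists_holderClose_nhds w s t hε] with v hv
  rw [dist_eq_norm]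
  exact hv.1

theorem measurable_lvl2 (s t : ℝ) : Measurable fun w : PathSpace m α => lvl2 w s t := by
  refine Continuous.measurable (continuous_iff_continuousAt.mpr fun w => ?_)
  refine Metric.tendsto_nhds.mpr fun ε hε => ?_
  filter_upwards [exists_holderClose_nhds w s t hε] with v hv
  rw [dist_eq_norm]
  exact hv.2

theorem lvl1_shift (t : ℝ) (w : PathSpace m α) (s u : ℝ) :
    lvl1 (shift t w) s u = lvl1 w (t + s) (t + u) :=
  congrArg Prod.fst (incr_shift w.1 _ t s u)

theorem lvl2_shift (t : ℝ) (w : PathSpace m α) (s u : ℝ) :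
    lvl2 (shift t w) s u = lvl2 w (t + s) (t + u) :=
  congrArg Prod.snd (incr_shift w.1 _ t s u)

theorem shift_zero (w : PathSpace m α) : shift 0 w = w := by
  refine Subtype.ext (funext fun s => ?_)
  change incr w.1 0 (0 + s) = w.1 s
  have h := mul_incr w.1 0 s
  rw [w.2.1, T2.zero_mul] at h
  rw [zero_add, h]

theorem shift_add (s t : ℝ) (w : PathSpace m α) : shift (s + t) w = shift s (shift t w) := by
  refine Subtype.ext (funext fun u => ?_)
  change incr w.1 (s + t) (s + t + u)
    = incr (fun r => T2.mul (T2.inv (w.1 t)) (w.1 (t + r))) s (s + u)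
  rw [incr_shift, add_comm s t, add_assoc]

theorem lvl1_add (w : PathSpace m α) (s t u : ℝ) : lvl1 w s u = lvl1 w s t + lvl1 w t u := by
  ext i; simp [lvl1, incr, T2.mul, T2.inv]

/-- Chen's relation. -/
theorem lvl2_add (w : PathSpace m α) (s t u : ℝ) :
    lvl2 w s u = lvl2 w s t + lvl2 w t u + tens (lvl1 w s t) (lvl1 w t u) := by
  ext i; simp [lvl1, lvl2, incr, T2.mul, T2.inv, tens]; ring

theorem lvl1_self (w : PathSpace m α) (s : ℝ) : lvl1 w s s = 0 :=
  congrArg Prod.fst (incr_self w.1 s)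

theorem lvl2_self (w : PathSpace m α) (s : ℝ) : lvl2 w s s = 0 :=
  congrArg Prod.snd (incr_self w.1 s)

/-! ### A homogeneous norm and the Kolmogorov criterion -/

/-- A homogeneous norm of the increment `w_s⁻¹ ⊗ w_t`. -/
noncomputable def hnorm (w : PathSpace m α) (s t : ℝ) : ℝ := max ‖lvl1 w s t‖ √(2 * ‖lvl2 w s t‖)

theorem hnorm_nonneg (w : PathSpace m α) (s t : ℝ) : 0 ≤ hnorm w s t :=
  (norm_nonneg _).trans (le_max_left _ _)

theorem hnorm_self (w : PathSpace m α) (s : ℝ) : hnorm w s s = 0 := by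
  simp [hnorm, lvl1_self, lvl2_self]

theorem norm_lvl1_le_hnorm (w : PathSpace m α) (s t : ℝ) : ‖lvl1 w s t‖ ≤ hnorm w s t :=
  le_max_left _ _

theorem two_mul_norm_lvl2_le_hnorm (w : PathSpace m α) (s t : ℝ) :
    2 * ‖lvl2 w s t‖ ≤ hnorm w s t ^ 2 :=
  (Real.sqrt_le_left (hnorm_nonneg w s t)).mp (le_max_right _ _)

/-- The factor 2 under the root is chosen for this: with p and q the two norms on the right, Chen's
relation gives 2‖𝕏_{s,u}‖ ≤ p² + q² + 2pq = (p + q)². The triangle inequality lets both levels be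
chained at once. -/
theorem hnorm_add_le (w : PathSpace m α) (s t u : ℝ) :
    hnorm w s u ≤ hnorm w s t + hnorm w t u := by
  have h1 := norm_lvl1_le_hnorm w s t
  have h2 := norm_lvl1_le_hnorm w t u
  have h3 := two_mul_norm_lvl2_le_hnorm w s t
  have h4 := two_mul_norm_lvl2_le_hnorm w t u
  have h5 := hnorm_nonneg w s t
  have h6 := hnorm_nonneg w t u
  refine max_le ?_ ?_
  · rw [lvl1_add w s t u]
    exact (norm_add_le _ _).trans (add_le_add h1 h2)
  · refine Real.sqrt_le_iff.mpr ⟨by positivity, ?_⟩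
    rw [lvl2_add w s t u]
    have h7 := norm_add₃_le (a := lvl2 w s t) (b := lvl2 w t u)
      (c := tens (lvl1 w s t) (lvl1 w t u))
    rw [norm_tens] at h7
    have h8 := mul_le_mul h1 h2 (norm_nonneg _) h5
    nlinarith

theorem hnorm_shift (t : ℝ) (w : PathSpace m α) (s u : ℝ) :
    hnorm (shift t w) s u = hnorm w (t + s) (t + u) := by
  simp only [hnorm, lvl1_shift, lvl2_shift]

theorem measurable_hnorm (s t : ℝ) : Measurable fun w : PathSpace m α => hnorm w s t :=
  (measurable_lvl1 s t).norm.max ((measurable_lvl2 s t).norm.const_mul 2).sqrt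

theorem continuous_hnorm (hα : 0 < α) (w : PathSpace m α) :
    Continuous fun p : ℝ × ℝ => hnorm w p.1 p.2 := by
  have h := w.continuous_incr hα
  exact h.fst.norm.max (continuous_const.mul h.snd.norm).sqrt

/-- The dyadic sum `∑ₙ ∑ₖ 2^{nαp} |w_{k2⁻ⁿ, (k+1)2⁻ⁿ}|^p` over the interval `[0, 2]`. -/
noncomputable def dyadicSum (p : ℝ) (w : PathSpace m α) : ℝ≥0∞ :=
  ∑' n : ℕ, ∑ k ∈ Finset.range (2 ^ (n + 1)),
    ENNReal.ofReal ((2 : ℝ) ^ (n * α * p)) *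
      ENNReal.ofReal (hnorm w (k / 2 ^ n) ((k + 1) / 2 ^ n) ^ p)

theorem continuous_hnorm_add (hα : 0 < α) (w : PathSpace m α) (a b : ℝ) :
    Continuous fun t : ℝ => hnorm w (t + a) (t + b) := by
  have h1 : Continuous fun t : ℝ => (t + a, t + b) := by fun_prop
  have e : (fun t : ℝ => hnorm w (t + a) (t + b))
      = (fun p : ℝ × ℝ => hnorm w p.1 p.2) ∘ fun t : ℝ => (t + a, t + b) := rfl
  rw [e]
  exact (continuous_hnorm hα w).comp h1

/-- Continuous in time and measurable in the path, hence jointly measurable; this is what Fubini for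
the time integrals along the flow requires. -/
theorem measurable_hnorm_shift (hα : 0 < α) (a b : ℝ) :
    Measurable fun q : ℝ × PathSpace m α => hnorm (shift q.1 q.2) a b := by
  have h := measurable_uncurry_of_continuous_of_measurable
    (u := fun (t : ℝ) (w : PathSpace m α) => hnorm w (t + a) (t + b))
    (fun w => continuous_hnorm_add hα w a b)
    (fun t => measurable_hnorm _ _)
  have e : (fun q : ℝ × PathSpace m α => hnorm (shift q.1 q.2) a b)
      = Function.uncurry fun (t : ℝ) (w : PathSpace m α) => hnorm w (t + a) (t + b) :=
    funext fun q => hnorm_shift q.1 q.2 a b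
  rw [e]
  exact h

theorem measurable_dyadicSum_shift (hα : 0 < α) (p : ℝ) :
    Measurable fun q : ℝ × PathSpace m α => dyadicSum p (shift q.1 q.2) :=
  Measurable.tsum fun n => Finset.measurable_fun_sum _ fun k _ =>
    (((measurable_hnorm_shift hα (k / 2 ^ n) ((k + 1) / 2 ^ n)).pow_const p).ennreal_ofReal).const_mul
      (ENNReal.ofReal ((2 : ℝ) ^ (n * α * p)))

theorem ofReal_hnorm_rpow_le {p : ℝ} (hp : 0 < p) (w : PathSpace m α) (s t : ℝ) :
    ENNReal.ofReal (hnorm w s t ^ p)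
      ≤ ENNReal.ofReal (2 ^ (p / 2)) * (‖lvl1 w s t‖ₑ ^ p + ‖lvl2 w s t‖ₑ ^ (p / 2)) := by
  have h2 : (1 : ℝ) ≤ 2 ^ (p / 2) := Real.one_le_rpow one_le_two (by positivity)
  have hb : √(2 * ‖lvl2 w s t‖) ^ p = 2 ^ (p / 2) * ‖lvl2 w s t‖ ^ (p / 2) := by
    rw [Real.sqrt_eq_rpow, ← Real.rpow_mul (by positivity), Real.mul_rpow two_pos.le
      (norm_nonneg _)]
    congr 2 <;> ring
  have h : hnorm w s t ^ p ≤ 2 ^ (p / 2) * (‖lvl1 w s t‖ ^ p + ‖lvl2 w s t‖ ^ (p / 2)) := by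
    have h0 : 0 ≤ ‖lvl1 w s t‖ ^ p := by positivity
    have h0' : 0 ≤ ‖lvl2 w s t‖ ^ (p / 2) := by positivity
    rcases max_cases ‖lvl1 w s t‖ √(2 * ‖lvl2 w s t‖) with ⟨e, _⟩ | ⟨e, _⟩
    · rw [hnorm, e]; nlinarith
    · rw [hnorm, e, hb]; nlinarith
  refine (ENNReal.ofReal_le_ofReal h).trans (le_of_eq ?_)
  rw [ENNReal.ofReal_mul (by positivity), ENNReal.ofReal_add (by positivity) (by positivity),
    ← ENNReal.ofReal_rpow_of_nonneg (norm_nonneg _) hp.le,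
    ← ENNReal.ofReal_rpow_of_nonneg (norm_nonneg _) (by positivity), ofReal_norm, ofReal_norm]

/-- Level n has 2^(n+1) intervals, each of expected weight at most a constant times 2^{nαp}
2^{-npν}. The levels are dominated by a geometric series of ratio 2^{1 − p(ν−α)} < 1. -/
theorem lintegral_dyadicSum_lt_top {ν p : ℝ} {P : Measure (PathSpace m α)}
    (hP : MomentBound ν P) (hp : 0 < p) (hpν : 1 ≤ p * ν) (hpα : 1 < p * (ν - α)) :
    ∫⁻ w, dyadicSum p w ∂P < ⊤ := by
  obtain ⟨C, hC0, hC⟩ := hP p hpν 2 two_pos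
  have hm : ∀ s t : ℝ, Measurable fun w : PathSpace m α => ENNReal.ofReal (hnorm w s t ^ p) :=
    fun s t => ((measurable_hnorm s t).pow_const p).ennreal_ofReal
  unfold dyadicSum
  rw [lintegral_tsum fun n => (Finset.measurable_fun_sum _ fun k _ =>
    (hm _ _).const_mul _).aemeasurable]
  set r : ℝ := 2 ^ (1 - p * (ν - α)) with hr
  have hr1 : r < 1 := Real.rpow_lt_one_of_one_lt_of_neg one_lt_two (by linarith)
  have hr0 : 0 < r := by positivity
  have hterm : ∀ n : ℕ, ∫⁻ w, ∑ k ∈ Finset.range (2 ^ (n + 1)),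
      ENNReal.ofReal ((2 : ℝ) ^ (n * α * p)) *
        ENNReal.ofReal (hnorm w (k / 2 ^ n) ((k + 1) / 2 ^ n) ^ p) ∂P
      ≤ ENNReal.ofReal (2 * 2 ^ (p / 2) * C * r ^ n) := by
    intro n
    rw [lintegral_finsetSum _ fun k _ => (hm _ _).const_mul _]
    have h1 : ∀ k ∈ Finset.range (2 ^ (n + 1)), ∫⁻ w, ENNReal.ofReal ((2 : ℝ) ^ (n * α * p)) *
        ENNReal.ofReal (hnorm w (k / 2 ^ n) ((k + 1) / 2 ^ n) ^ p) ∂P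
        ≤ ENNReal.ofReal (2 ^ (n * α * p) * (2 ^ (p / 2) * (C * 2 ^ (-(n * (p * ν)))))) := by
      intro k hk
      have hk' : (k : ℝ) + 1 ≤ 2 * 2 ^ n := by
        have : k + 1 ≤ 2 ^ (n + 1) := Finset.mem_range.mp hk
        have : ((k + 1 : ℕ) : ℝ) ≤ ((2 ^ (n + 1) : ℕ) : ℝ) := by exact_mod_cast this
        push_cast at this
        rw [pow_succ] at this; linarith
      have hn0 : (0 : ℝ) < 2 ^ n := by positivity
      rw [lintegral_const_mul _ (hm _ _), ENNReal.ofReal_mul (by positivity)]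
      refine mul_le_mul_right (le_trans (lintegral_mono fun w => ofReal_hnorm_rpow_le hp w _ _) ?_) _
      rw [lintegral_const_mul' _ _ ENNReal.ofReal_ne_top, ENNReal.ofReal_mul (by positivity)]
      refine mul_le_mul_right ((hC _ ⟨by positivity, ?_⟩ _ ⟨by positivity, ?_⟩).trans
        (le_of_eq ?_)) _
      · rw [div_le_iff₀ hn0]; linarith
      · rw [div_le_iff₀ hn0]; linarith
      · congr 2
        rw [← sub_div, add_sub_cancel_left, abs_of_pos (by positivity), one_div,
          Real.inv_rpow hn0.le, ← Real.rpow_natCast, ← Real.rpow_mul two_pos.le,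
          Real.rpow_neg two_pos.le]
    refine (Finset.sum_le_sum h1).trans (le_of_eq ?_)
    rw [Finset.sum_const, Finset.card_range, nsmul_eq_mul, ← ENNReal.ofReal_natCast,
      ← ENNReal.ofReal_mul (by positivity)]
    congr 1
    have e1 : ((2 ^ (n + 1) : ℕ) : ℝ) = 2 * (2 : ℝ) ^ (n : ℝ) := by
      rw [Real.rpow_natCast]; push_cast; ring
    have e2 : r ^ n = (2 : ℝ) ^ (n : ℝ) * (2 ^ (n * α * p) * 2 ^ (-(n * (p * ν)))) := by
      rw [← Real.rpow_natCast r n, hr, ← Real.rpow_mul two_pos.le, ← Real.rpow_add two_pos,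
        ← Real.rpow_add two_pos]
      congr 1; ring
    rw [e1, e2]; ring
  refine lt_of_le_of_lt (ENNReal.tsum_le_tsum hterm) ?_
  rw [← ENNReal.ofReal_tsum_of_nonneg (fun n => by positivity)
    ((summable_geometric_of_lt_one hr0.le hr1).mul_left _)]
  exact ENNReal.ofReal_lt_top

end Paths

/-! ### Hölder constants from dyadic sums. -/

section Holder

variable {m : ℕ} {α : ℝ}

/-- The `ℓ¹` norm on `ℝ^m ⊗ ℝ^m`. -/
noncomputable def l1 (X : Tens m) : ℝ := ∑ i : Fin m, ∑ j : Fin m, |X (i, j)|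

theorem l1_nonneg (X : Tens m) : 0 ≤ l1 X :=
  Finset.sum_nonneg fun _ _ => Finset.sum_nonneg fun _ _ => abs_nonneg _

theorem l1_le (X : Tens m) : l1 X ≤ m ^ 2 * ‖X‖ := by
  have h : ∀ i j : Fin m, |X (i, j)| ≤ ‖X‖ := fun i j => PiLp.norm_apply_le X (i, j)
  calc l1 X ≤ ∑ _i : Fin m, ∑ _j : Fin m, ‖X‖ :=
        Finset.sum_le_sum fun i _ => Finset.sum_le_sum fun j _ => h i j
    _ = m ^ 2 * ‖X‖ := by simp; ring

/-- The path has `α`-Hölder constant `N`, in homogeneous normalisation, on `[0, τ]`. -/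
def IsHolderOn (w : PathSpace m α) (N τ : ℝ) : Prop :=
  ∀ s t : ℝ, 0 ≤ s → s ≤ t → t ≤ τ →
    ‖lvl1 w s t‖ ≤ N * (t - s) ^ α ∧ l1 (lvl2 w s t) ≤ N ^ 2 * (t - s) ^ (2 * α)

theorem IsHolderOn.shift {w : PathSpace m α} {N τ h τ' : ℝ} (hw : IsHolderOn w N τ) (hh : 0 ≤ h)
    (hτ : h + τ' ≤ τ) : IsHolderOn (shift h w) N τ' := by
  intro s t hs hst ht
  rw [lvl1_shift, lvl2_shift]
  have := hw (h + s) (h + t) (by linarith) (by linarith) (by linarith)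
  rwa [add_sub_add_left_eq_sub] at this

theorem hnorm_grid_le {w : PathSpace m α} {U r : ℝ} (hU : 0 ≤ U) (hr : 0 ≤ r) {n : ℕ}
    (h : ∀ k : ℕ, k < 2 ^ (n + 1) → hnorm w (k / 2 ^ n) ((k + 1) / 2 ^ n) ≤ U * r ^ n)
    {i j l : ℕ} (hij : i ≤ j) (hjl : j ≤ i + l) (hj : j ≤ 2 ^ (n + 1)) :
    hnorm w (i / 2 ^ n) (j / 2 ^ n) ≤ l * (U * r ^ n) := by
  have hUr : 0 ≤ U * r ^ n := by positivity
  have key : ∀ e : ℕ, i + e ≤ 2 ^ (n + 1) →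
      hnorm w (i / 2 ^ n) ((i + e : ℕ) / 2 ^ n) ≤ e * (U * r ^ n) := by
    intro e
    induction e with
    | zero => intro _; simp [hnorm_self]
    | succ e ih =>
      intro he
      have h1 := ih (by omega)
      have h2 := h (i + e) (by omega)
      have h3 := hnorm_add_le w (i / 2 ^ n) ((i + e : ℕ) / 2 ^ n) (((i + e : ℕ) + 1) / 2 ^ n)
      have e1 : ((i + (e + 1) : ℕ) : ℝ) = ((i + e : ℕ) : ℝ) + 1 := by push_cast; ring
      rw [e1]
      push_cast at h1 h2 h3 ⊢
      linarith
  obtain ⟨e, rfl⟩ := Nat.exists_eq_add_of_le hij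
  have h1 : (e : ℝ) ≤ l := by exact_mod_cast (by omega : e ≤ l)
  exact (key e hj).trans (mul_le_mul_of_nonneg_right h1 hUr)

/-- Chaining along dyadic points. -/
theorem hnorm_le_of_grid (hα : 0 < α) {w : PathSpace m α} {U : ℝ} (hU : 0 ≤ U)
    (h : ∀ n k : ℕ, k < 2 ^ (n + 1) →
      hnorm w (k / 2 ^ n) ((k + 1) / 2 ^ n) ≤ U * ((2 : ℝ) ^ (-α)) ^ n)
    {s t : ℝ} (hs : 0 ≤ s) (hst : s < t) (ht : t ≤ 2) :
    hnorm w s t ≤ 2 / (1 - 2 ^ (-α)) * U * (t - s) ^ α := by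
  set r : ℝ := 2 ^ (-α) with hr
  have hr0 : 0 < r := by positivity
  have hr1 : r < 1 := Real.rpow_lt_one_of_one_lt_of_neg one_lt_two (by linarith)
  -- The level n₀ satisfies 1 < (t − s) 2^{n₀} ≤ 2, so [s, t] contains a grid point of that level
  -- and at most two grid steps separate its extreme ones.
  obtain ⟨n₀, hn₀, hn₀'⟩ := exists_nat_pow_near_of_lt_one (x := (t - s) / 2) (y := 1 / 2)
    (by linarith) (by linarith) (by norm_num) (by norm_num)
  have hp0 : ∀ n : ℕ, (0 : ℝ) < 2 ^ n := fun n => by positivity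
  have hn1 : 1 < (t - s) * 2 ^ n₀ := by
    rw [pow_succ, one_div, inv_pow] at hn₀
    have := mul_lt_mul_of_pos_right hn₀ (hp0 n₀)
    field_simp at this
    linarith
  have hn2 : (t - s) * 2 ^ n₀ ≤ 2 := by
    rw [one_div, inv_pow] at hn₀'
    have := mul_le_mul_of_nonneg_right hn₀' (hp0 n₀).le
    rw [inv_mul_cancel₀ (hp0 n₀).ne'] at this
    linarith
  set a : ℕ → ℕ := fun n => ⌈s * 2 ^ n⌉₊ with ha
  set b : ℕ → ℕ := fun n => ⌊t * 2 ^ n⌋₊ with hb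
  have ha1 : ∀ n, s * 2 ^ n ≤ a n := fun n => Nat.le_ceil _
  have ha2 : ∀ n, (a n : ℝ) < s * 2 ^ n + 1 := fun n =>
    Nat.ceil_lt_add_one (mul_nonneg hs (hp0 n).le)
  have hb1 : ∀ n, (b n : ℝ) ≤ t * 2 ^ n := fun n =>
    Nat.floor_le (mul_nonneg (hs.trans hst.le) (hp0 n).le)
  have hb2 : ∀ n, t * 2 ^ n < b n + 1 := fun n => Nat.lt_floor_add_one _
  have hale : ∀ n, a n ≤ 2 ^ (n + 1) := fun n => Nat.ceil_le.mpr (by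
    push_cast; rw [pow_succ]; nlinarith [hp0 n])
  have hble : ∀ n, b n ≤ 2 ^ (n + 1) := fun n => by
    have : (b n : ℝ) ≤ 2 ^ (n + 1) := (hb1 n).trans (by rw [pow_succ]; nlinarith [hp0 n])
    exact_mod_cast this
  -- Each refinement adds at most one grid step at either end, hence at most 2 U r^n at level n. The
  -- endpoints converge to s and t, and continuity passes to the limit.
  have hstep : ∀ l : ℕ, hnorm w (a (n₀ + l) / 2 ^ (n₀ + l)) (b (n₀ + l) / 2 ^ (n₀ + l))
      ≤ 2 * U * r ^ n₀ * ∑ j ∈ Finset.range (l + 1), r ^ j := by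
    intro l
    induction l with
    | zero =>
      have h1 : a n₀ ≤ b n₀ := by
        refine Nat.le_floor ?_
        linarith [ha2 n₀]
      have h2 : b n₀ ≤ a n₀ + 2 := by
        have : (b n₀ : ℝ) ≤ a n₀ + 2 := by linarith [hb1 n₀, ha1 n₀]
        exact_mod_cast this
      have h3 := hnorm_grid_le hU hr0.le (h n₀) h1 h2 (hble n₀)
      simp only [add_zero, zero_add, Finset.range_one, Finset.sum_singleton, pow_zero, mul_one]
      push_cast at h3
      linarith
    | succ l ih =>
      set n := n₀ + l with hn
      have e2 : (2 : ℝ) ^ (n + 1) = 2 * 2 ^ n := by rw [pow_succ]; ring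
      have a1 : a (n + 1) ≤ 2 * a n := Nat.ceil_le.mpr (by
        push_cast; rw [e2]; linarith [ha1 n])
      have a2 : 2 * a n ≤ a (n + 1) + 1 := by
        have h1 := ha1 (n + 1)
        rw [e2] at h1
        have : ((2 * a n : ℕ) : ℝ) < ((a (n + 1) + 1 + 1 : ℕ) : ℝ) := by
          push_cast; linarith [ha2 n]
        exact Nat.lt_succ_iff.mp (by exact_mod_cast this)
      have b1 : 2 * b n ≤ b (n + 1) := Nat.le_floor (by
        push_cast; rw [e2]; linarith [hb1 n])
      have b2 : b (n + 1) ≤ 2 * b n + 1 := by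
        have h1 := hb1 (n + 1)
        rw [e2] at h1
        have : ((b (n + 1) : ℕ) : ℝ) < ((2 * b n + 1 + 1 : ℕ) : ℝ) := by
          push_cast; linarith [hb2 n]
        exact Nat.lt_succ_iff.mp (by exact_mod_cast this)
      have hA := hnorm_grid_le hU hr0.le (h (n + 1)) a1 a2 (by
        have := hale n; rw [pow_succ 2 (n + 1)]; omega)
      have hB := hnorm_grid_le hU hr0.le (h (n + 1)) b1 b2 (hble (n + 1))
      have ea : ((2 * a n : ℕ) : ℝ) / 2 ^ (n + 1) = a n / 2 ^ n := by
        rw [e2]; push_cast; rw [mul_div_mul_left _ _ two_ne_zero]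
      have eb : ((2 * b n : ℕ) : ℝ) / 2 ^ (n + 1) = b n / 2 ^ n := by
        rw [e2]; push_cast; rw [mul_div_mul_left _ _ two_ne_zero]
      rw [ea] at hA
      rw [eb] at hB
      have h1 := hnorm_add_le w (a (n + 1) / 2 ^ (n + 1)) (a n / 2 ^ n) (b (n + 1) / 2 ^ (n + 1))
      have h2 := hnorm_add_le w (a n / 2 ^ n) (b n / 2 ^ n) (b (n + 1) / 2 ^ (n + 1))
      have e3 : n₀ + (l + 1) = n + 1 := by omega
      have e4 : r ^ (n + 1) = r ^ n₀ * r ^ (l + 1) := by rw [← pow_add, ← e3]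
      rw [e3, Finset.sum_range_succ, mul_add]
      rw [e4] at hA hB
      push_cast at hA hB
      linarith
  have hgeo : ∀ l : ℕ, ∑ j ∈ Finset.range (l + 1), r ^ j ≤ (1 - r)⁻¹ := fun l => by
    rw [← tsum_geometric_of_lt_one hr0.le hr1]
    exact (summable_geometric_of_lt_one hr0.le hr1).sum_le_tsum _ fun i _ => by positivity
  have hrn : r ^ n₀ ≤ (t - s) ^ α := by
    have h1 : ((2 : ℝ) ^ n₀)⁻¹ ≤ t - s := by
      rw [inv_le_iff_one_le_mul₀ (hp0 n₀)]; linarith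
    have h2 : r ^ n₀ = (((2 : ℝ) ^ n₀)⁻¹) ^ α := by
      rw [hr, ← Real.rpow_natCast, ← Real.rpow_mul two_pos.le, ← Real.rpow_natCast,
        ← Real.rpow_neg two_pos.le, ← Real.rpow_mul two_pos.le]
      congr 1; ring
    rw [h2]
    exact Real.rpow_le_rpow (by positivity) h1 hα.le
  have hbound : ∀ l : ℕ, hnorm w (a (n₀ + l) / 2 ^ (n₀ + l)) (b (n₀ + l) / 2 ^ (n₀ + l))
      ≤ 2 / (1 - r) * U * (t - s) ^ α := by
    intro l
    refine (hstep l).trans ?_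
    have hr' : 0 < 1 - r := by linarith
    calc 2 * U * r ^ n₀ * ∑ j ∈ Finset.range (l + 1), r ^ j
        ≤ 2 * U * (t - s) ^ α * (1 - r)⁻¹ := by
          gcongr
          exact hgeo l
      _ = 2 / (1 - r) * U * (t - s) ^ α := by ring
  have hz : Tendsto (fun l : ℕ => ((1 : ℝ) / 2) ^ (n₀ + l)) atTop (𝓝 0) :=
    (tendsto_pow_atTop_nhds_zero_of_lt_one (by norm_num) (by norm_num)).comp
      (tendsto_atTop_mono (fun l => Nat.le_add_left l n₀) tendsto_id)
  have hlim : ∀ (c : ℕ → ℕ) (x : ℝ), (∀ n, |(c n : ℝ) - x * 2 ^ n| ≤ 1) →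
      Tendsto (fun l : ℕ => (c (n₀ + l) : ℝ) / 2 ^ (n₀ + l)) atTop (𝓝 x) := by
    intro c x hc
    rw [tendsto_iff_norm_sub_tendsto_zero]
    refine squeeze_zero (fun _ => norm_nonneg _) (fun l => ?_) hz
    have h1 : (c (n₀ + l) : ℝ) / 2 ^ (n₀ + l) - x
        = (c (n₀ + l) - x * 2 ^ (n₀ + l)) / 2 ^ (n₀ + l) := by
      rw [sub_div, mul_div_cancel_right₀ _ (hp0 _).ne']
    rw [h1, norm_div, Real.norm_eq_abs, Real.norm_of_nonneg (hp0 _).le, one_div, inv_pow,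
      ← one_div]
    exact div_le_div_of_nonneg_right (hc _) (hp0 _).le
  have hla := hlim a s fun n => abs_le.mpr ⟨by linarith [ha1 n], by linarith [ha2 n]⟩
  have hlb := hlim b t fun n => abs_le.mpr ⟨by linarith [hb2 n], by linarith [hb1 n]⟩
  exact le_of_tendsto' (((continuous_hnorm hα w).tendsto (s, t)).comp (hla.prodMk_nhds hlb)) hbound

theorem hnorm_le_of_dyadicSum_le (hα : 0 < α) {p : ℝ} (hp : 0 < p) {w : PathSpace m α} {v : ℝ}
    (hv : 0 ≤ v) (h : dyadicSum p w ≤ ENNReal.ofReal v) {s t : ℝ} (hs : 0 ≤ s) (hst : s ≤ t)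
    (ht : t ≤ 2) : hnorm w s t ≤ 2 / (1 - 2 ^ (-α)) * v ^ (1 / p) * (t - s) ^ α := by
  rcases hst.eq_or_lt with rfl | hst
  · rw [hnorm_self, sub_self, Real.zero_rpow hα.ne', mul_zero]
  refine hnorm_le_of_grid hα (by positivity) (fun n k hk => ?_) hs hst ht
  have h1 : ENNReal.ofReal ((2 : ℝ) ^ (n * α * p)) *
      ENNReal.ofReal (hnorm w (k / 2 ^ n) ((k + 1) / 2 ^ n) ^ p) ≤ ENNReal.ofReal v := by
    refine le_trans ?_ ((ENNReal.le_tsum n).trans h)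
    exact Finset.single_le_sum (f := fun k : ℕ => ENNReal.ofReal ((2 : ℝ) ^ (n * α * p)) *
      ENNReal.ofReal (hnorm w (k / 2 ^ n) ((k + 1) / 2 ^ n) ^ p)) (fun _ _ => zero_le)
      (Finset.mem_range.mpr hk)
  have h0 := hnorm_nonneg w (k / 2 ^ n) ((k + 1) / 2 ^ n)
  rw [← ENNReal.ofReal_mul (by positivity), ENNReal.ofReal_le_ofReal_iff hv] at h1
  have h2 : ((2 : ℝ) ^ (n * α) * hnorm w (k / 2 ^ n) ((k + 1) / 2 ^ n)) ^ p ≤ v := by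
    rwa [Real.mul_rpow (by positivity) h0, ← Real.rpow_mul two_pos.le]
  have h3 := Real.rpow_le_rpow (by positivity) h2 (by positivity : 0 ≤ 1 / p)
  rw [← Real.rpow_mul (by positivity), mul_one_div_cancel hp.ne', Real.rpow_one] at h3
  have h4 : ((2 : ℝ) ^ (-α)) ^ n = ((2 : ℝ) ^ (n * α))⁻¹ := by
    rw [← Real.rpow_natCast, ← Real.rpow_mul two_pos.le, ← Real.rpow_neg two_pos.le]
    congr 1; ring
  rw [h4, ← div_eq_mul_inv, le_div_iff₀ (by positivity)]
  linarith

/-- N is of order v^{1/p}, so p ≥ 50 makes (1+N)^50 linear in v. The exponent 50 is 5·10: absorption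
over a block costs (1+N)^5 and the Lyapunov function is a tenth power. The factor m + 1 in N pays
for the ℓ¹ norm on the second level. -/
theorem exists_isHolderOn (m : ℕ) {α : ℝ} (hα : 0 < α) {p : ℝ} (hp : 50 ≤ p) :
    ∃ C : ℝ, 0 < C ∧ ∀ (w : PathSpace m α) (v : ℝ), 0 ≤ v → dyadicSum p w ≤ ENNReal.ofReal v →
      ∃ N : ℝ, 0 ≤ N ∧ IsHolderOn w N 2 ∧ (1 + N) ^ 50 ≤ C * (1 + v) := by
  have hp0 : 0 < p := by linarith
  have hr1 : (2 : ℝ) ^ (-α) < 1 := Real.rpow_lt_one_of_one_lt_of_neg one_lt_two (by linarith)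
  set A : ℝ := 2 / (1 - 2 ^ (-α)) with hA
  have hA0 : 0 < A := div_pos two_pos (by linarith)
  set K : ℝ := (m + 1) * A with hK
  have hK0 : 0 < K := by positivity
  refine ⟨2 ^ p * (1 + K ^ p), by positivity, fun w v hv h => ⟨K * v ^ (1 / p), by positivity,
    fun s t hs hst ht => ?_, ?_⟩⟩
  · have h1 := hnorm_le_of_dyadicSum_le hα hp0 hv h hs hst ht
    rw [← hA] at h1
    set z := v ^ (1 / p) with hz
    have hz0 : 0 ≤ z := by positivity
    have hts : 0 ≤ (t - s) ^ α := Real.rpow_nonneg (by linarith) _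
    have hts2 : (t - s) ^ (2 * α) = ((t - s) ^ α) ^ 2 := by
      rw [mul_comm, Real.rpow_mul (by linarith), Real.rpow_two]
    have hm0 : (0 : ℝ) ≤ m := Nat.cast_nonneg m
    have hn0 := hnorm_nonneg w s t
    constructor
    · refine (norm_lvl1_le_hnorm w s t).trans (h1.trans ?_)
      rw [hK]
      have : 0 ≤ (m : ℝ) * (A * z * (t - s) ^ α) := by positivity
      linarith
    · have h2 := two_mul_norm_lvl2_le_hnorm w s t
      have h3 : hnorm w s t ^ 2 ≤ (A * z * (t - s) ^ α) ^ 2 := by gcongr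
      have h4 := l1_le (lvl2 w s t)
      have h5 : (m : ℝ) ^ 2 * ‖lvl2 w s t‖ ≤ (m + 1) ^ 2 * (A * z * (t - s) ^ α) ^ 2 := by
        have := norm_nonneg (lvl2 w s t)
        gcongr
        · linarith
        · linarith
      rw [hts2, hK]
      calc _ ≤ _ := h4.trans h5
        _ = _ := by ring
  · set z := v ^ (1 / p) with hz
    have hz0 : 0 ≤ z := by positivity
    have hzp : z ^ p = v := by
      rw [hz, ← Real.rpow_mul hv, one_div_mul_cancel hp0.ne', Real.rpow_one]
    have h1 : (1 + K * z) ^ (50 : ℕ) ≤ (1 + K * z) ^ p := by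
      rw [← Real.rpow_natCast]
      exact Real.rpow_le_rpow_of_exponent_le (by nlinarith) (by exact_mod_cast hp)
    refine h1.trans ?_
    clear h1
    have hKz : (K * z) ^ p = K ^ p * v := by rw [Real.mul_rpow hK0.le hz0, hzp]
    have hKp : 0 < K ^ p := by positivity
    have h2p : (0 : ℝ) < 2 ^ p := by positivity
    rcases le_total (K * z) 1 with h | h
    · calc (1 + K * z) ^ p ≤ 2 ^ p := Real.rpow_le_rpow (by positivity) (by linarith) hp0.le
        _ ≤ 2 ^ p * (1 + K ^ p) * (1 + v) := by
          rw [mul_assoc]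
          exact le_mul_of_one_le_right h2p.le
            (one_le_mul_of_one_le_of_one_le (by linarith) (by linarith))
    · calc (1 + K * z) ^ p ≤ (2 * (K * z)) ^ p :=
            Real.rpow_le_rpow (by positivity) (by linarith) hp0.le
        _ = 2 ^ p * (K ^ p * v) := by rw [Real.mul_rpow two_pos.le (by positivity), hKz]
        _ ≤ 2 ^ p * ((1 + K ^ p) * (1 + v)) := by
          refine mul_le_mul_of_nonneg_left ?_ h2p.le
          exact mul_le_mul (by linarith) (by linarith) hv (by linarith)
        _ = _ := by ring

end Holder

/-! ### A discrete sewing lemma -/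

/-- A superlinear power gains when an interval is split into parts of at most two thirds of its
length; this gain closes the sewing induction. -/
theorem two_thirds_split {θ a b : ℝ} (hθ : 1 ≤ θ) (ha : 0 ≤ a) (hb : 0 ≤ b)
    (ha' : a ≤ 2 / 3 * (a + b)) (hb' : b ≤ 2 / 3 * (a + b)) :
    a ^ θ + b ^ θ ≤ (2 / 3) ^ (θ - 1) * (a + b) ^ θ := by
  rcases (add_nonneg ha hb).eq_or_lt with h0 | h0
  · have ha0 : a = 0 := by linarith
    have hb0 : b = 0 := by linarith
    simp [ha0, hb0, Real.zero_rpow (by linarith : θ ≠ 0)]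
  have key : ∀ x : ℝ, 0 ≤ x → x ≤ 2 / 3 * (a + b) → x ^ θ ≤ (2 / 3 * (a + b)) ^ (θ - 1) * x := by
    intro x hx hx'
    rcases hx.eq_or_lt with rfl | hx0
    · rw [Real.zero_rpow (by linarith), mul_zero]
    · calc x ^ θ = x ^ (θ - 1) * x := by
            rw [← Real.rpow_add_one hx0.ne', sub_add_cancel]
        _ ≤ _ := mul_le_mul_of_nonneg_right (Real.rpow_le_rpow hx hx' (by linarith)) hx
  calc a ^ θ + b ^ θ ≤ (2 / 3 * (a + b)) ^ (θ - 1) * (a + b) := by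
        rw [mul_add]; exact add_le_add (key a ha ha') (key b hb hb')
    _ = (2 / 3) ^ (θ - 1) * (a + b) ^ θ := by
        rw [Real.mul_rpow (by norm_num) h0.le, mul_assoc, ← Real.rpow_add_one h0.ne',
          sub_add_cancel]

/-- Strong induction on the number of steps, splitting near the middle; the worst split is 3 = 1 +
2, hence the two thirds. The defect hypothesis may assume the bound already obtained on the left
part. That permits a bootstrap: the defect of a solution depends on its own remainder there, which
this bound controls. -/
theorem discrete_sewing {E : Type*} [SeminormedAddCommGroup E] {Ξ : ℕ → ℕ → E} {θ K : ℝ}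
    (hθ : 1 ≤ θ) (hK : 0 ≤ K) {n : ℕ}
    (h : ∀ i k j : ℕ, i < k → k < j → j ≤ n →
      ‖∑ l ∈ Finset.Ico i k, Ξ l (l + 1) - Ξ i k‖ ≤ K * (((k : ℝ) - i) / n) ^ θ →
      ‖Ξ i j - Ξ i k - Ξ k j‖ ≤ (1 - (2 / 3) ^ (θ - 1)) * K * (((j : ℝ) - i) / n) ^ θ)
    (i j : ℕ) (hij : i < j) (hj : j ≤ n) :
    ‖∑ l ∈ Finset.Ico i j, Ξ l (l + 1) - Ξ i j‖ ≤ K * (((j : ℝ) - i) / n) ^ θ := by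
  induction hd : j - i using Nat.strong_induction_on generalizing i j with
  | _ d ih =>
  have hn : (0 : ℝ) < n := by exact_mod_cast (by omega : 0 < n)
  have hij' : (i : ℝ) < j := by exact_mod_cast hij
  rcases Nat.lt_or_ge d 2 with h2 | h2
  · have e : j = i + 1 := by omega
    subst e
    simp only [Nat.Ico_succ_singleton, Finset.sum_singleton, sub_self, norm_zero]
    exact mul_nonneg hK (Real.rpow_nonneg (div_nonneg (by linarith) hn.le) _)
  · set k := i + d / 2 with hk
    have hik : i < k := by omega
    have hkj : k < j := by omega
    have h1 := ih (k - i) (by omega) i k hik (by omega) rfl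
    have h3 := ih (j - k) (by omega) k j hkj hj rfl
    have h4 := h i k j hik hkj hj h1
    have hsum : ∑ l ∈ Finset.Ico i j, Ξ l (l + 1) - Ξ i j
        = (∑ l ∈ Finset.Ico i k, Ξ l (l + 1) - Ξ i k)
          + (∑ l ∈ Finset.Ico k j, Ξ l (l + 1) - Ξ k j) - (Ξ i j - Ξ i k - Ξ k j) := by
      rw [← Finset.sum_Ico_consecutive _ hik.le hkj.le]; abel
    have c1 : (3 : ℝ) * (k - i) ≤ 2 * (j - i) := by
      have : 3 * k + 2 * i ≤ 2 * j + 3 * i := by omega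
      have : (3 : ℝ) * k + 2 * i ≤ 2 * j + 3 * i := by exact_mod_cast this
      linarith
    have c2 : (3 : ℝ) * (j - k) ≤ 2 * (j - i) := by
      have : 3 * j + 2 * i ≤ 2 * j + 3 * k := by omega
      have : (3 : ℝ) * j + 2 * i ≤ 2 * j + 3 * k := by exact_mod_cast this
      linarith
    have hik' : (i : ℝ) < k := by exact_mod_cast hik
    have hkj' : (k : ℝ) < j := by exact_mod_cast hkj
    have eab : ((k : ℝ) - i) / n + ((j : ℝ) - k) / n = ((j : ℝ) - i) / n := by ring
    have h5 := two_thirds_split (a := ((k : ℝ) - i) / n) (b := ((j : ℝ) - k) / n) hθ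
      (div_nonneg (by linarith) hn.le) (div_nonneg (by linarith) hn.le)
      (by rw [eab, ← mul_div_assoc]; exact div_le_div_of_nonneg_right (by linarith) hn.le)
      (by rw [eab, ← mul_div_assoc]; exact div_le_div_of_nonneg_right (by linarith) hn.le)
    rw [eab] at h5
    have h6 := mul_le_mul_of_nonneg_left h5 hK
    rw [hsum]
    refine (norm_sub_le _ _).trans ((add_le_add (norm_add_le _ _) le_rfl).trans ?_)
    linarith

/-! ### Dissipative recursions with a bounded perturbation -/

/-- Subtracting the accumulated perturbation s leaves a recursion without noise, whose energy is
estimated; so only the supremum of s matters, not its variation. The condition hL² ≤ D absorbs the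
square term of the explicit step into half of the dissipation, and hD ≤ 4 keeps the factor 1 − hD/4
nonnegative. The rate D/4 for squares is D/8 for norms. -/
theorem norm_le_of_dissipative {E : Type*} [NormedAddCommGroup E] [InnerProductSpace ℝ E]
    {D L σ h : ℝ} (hD : 0 < D) (hL : 0 ≤ L) (hh : 0 < h) (hhL : h * L ^ 2 ≤ D) (hhD : h * D ≤ 4)
    {w p s : ℕ → E} {n : ℕ} (hs0 : s 0 = 0) (hs : ∀ k ≤ n, ‖s k‖ ≤ σ)
    (hw : ∀ k < n, w (k + 1) = w k + h • p k + (s (k + 1) - s k))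
    (hin : ∀ k < n, inner ℝ (w k) (p k) ≤ -D * ‖w k‖ ^ 2) (hp : ∀ k < n, ‖p k‖ ≤ L * ‖w k‖)
    (k : ℕ) (hk : k ≤ n) :
    ‖w k‖ ≤ Real.exp (-(D / 8) * (k * h)) * ‖w 0‖ + (3 + 3 * (L / D)) * σ := by
  have hσ : 0 ≤ σ := by simpa [hs0] using hs 0 (Nat.zero_le n)
  set v : ℕ → E := fun k => w k - s k with hv
  set c : ℝ := (2 + 8 * (L / D) ^ 2) * σ ^ 2 with hc
  have step : ∀ k < n, ‖v (k + 1)‖ ^ 2 ≤ (1 - h * D / 4) * ‖v k‖ ^ 2 + h * D / 4 * c := by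
    intro k hk
    have e : v (k + 1) = v k + h • p k := by
      simp only [hv, hw k hk]; abel
    have hw1 : v k = w k - s k := rfl
    set x := ‖w k‖ with hx
    have hx0 : 0 ≤ x := norm_nonneg _
    have hsk := hs k hk.le
    have hi1 : inner ℝ (v k) (p k) ≤ -D * x ^ 2 + σ * (L * x) := by
      rw [hw1, inner_sub_left]
      have h1 := hin k hk
      have h2 : -inner ℝ (s k) (p k) ≤ ‖s k‖ * ‖p k‖ :=
        (neg_le_abs _).trans (abs_real_inner_le_norm _ _)
      have h3 : ‖s k‖ * ‖p k‖ ≤ σ * (L * x) :=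
        mul_le_mul hsk (hp k hk) (norm_nonneg _) hσ
      linarith
    have hvk : ‖v k‖ ≤ x + σ := (norm_sub_le _ _).trans (by linarith)
    have hvk2 : ‖v k‖ ^ 2 ≤ 2 * x ^ 2 + 2 * σ ^ 2 := by
      have := pow_le_pow_left₀ (norm_nonneg _) hvk 2
      nlinarith [sq_nonneg (x - σ)]
    have hp2 : ‖p k‖ ^ 2 ≤ L ^ 2 * x ^ 2 := by
      have := pow_le_pow_left₀ (norm_nonneg _) (hp k hk) 2
      rwa [mul_pow] at this
    have hsq : ‖v (k + 1)‖ ^ 2 = ‖v k‖ ^ 2 + 2 * h * inner ℝ (v k) (p k) + h ^ 2 * ‖p k‖ ^ 2 := by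
      rw [e, norm_add_sq_real, inner_smul_right, norm_smul, mul_pow, Real.norm_eq_abs, sq_abs]
      ring
    have h4 : h ^ 2 * ‖p k‖ ^ 2 ≤ h * (D * x ^ 2) := by
      have h41 : h ^ 2 * ‖p k‖ ^ 2 ≤ h ^ 2 * (L ^ 2 * x ^ 2) :=
        mul_le_mul_of_nonneg_left hp2 (by positivity)
      have h42 : h * L ^ 2 * (h * x ^ 2) ≤ D * (h * x ^ 2) :=
        mul_le_mul_of_nonneg_right hhL (by positivity)
      linarith
    have h5 : h * inner ℝ (v k) (p k) ≤ h * (-D * x ^ 2 + σ * (L * x)) :=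
      mul_le_mul_of_nonneg_left hi1 hh.le
    have h6 : 2 * (σ * (L * x)) ≤ D / 2 * x ^ 2 + 2 * (L / D) ^ 2 * D * σ ^ 2 := by
      have e1 : L = L / D * D := by field_simp
      set q := L / D
      rw [e1]
      nlinarith [mul_nonneg hD.le (sq_nonneg (x - 2 * q * σ))]
    have h7 : h * (2 * (σ * (L * x))) ≤ h * (D / 2 * x ^ 2 + 2 * (L / D) ^ 2 * D * σ ^ 2) :=
      mul_le_mul_of_nonneg_left h6 hh.le
    have h8 : h * D * ‖v k‖ ^ 2 ≤ h * D * (2 * x ^ 2 + 2 * σ ^ 2) :=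
      mul_le_mul_of_nonneg_left hvk2 (by positivity)
    rw [hsq, hc]
    linarith
  have hit : ∀ k ≤ n, ‖v k‖ ^ 2 ≤ (1 - h * D / 4) ^ k * ‖w 0‖ ^ 2 + c := by
    intro k
    have hc0 : 0 ≤ c := by positivity
    induction k with
    | zero => intro _; simp [hv, hs0, hc0]
    | succ k ih =>
      intro hk
      have h1 := step k (by omega)
      have h2 := mul_le_mul_of_nonneg_left (ih (by omega)) (by linarith : 0 ≤ 1 - h * D / 4)
      rw [pow_succ (1 - h * D / 4)]
      linarith
  have h1 := hit k hk
  have h2 : (1 - h * D / 4) ^ k ≤ Real.exp (-(D / 8) * (k * h)) ^ 2 := by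
    have h21 := pow_le_pow_left₀ (by linarith) (Real.one_sub_le_exp_neg (h * D / 4)) k
    refine h21.trans (le_of_eq ?_)
    rw [← Real.exp_nat_mul, ← Real.exp_nat_mul]
    congr 1; push_cast; ring
  set a := Real.exp (-(D / 8) * (k * h)) with ha
  have ha0 : 0 < a := Real.exp_pos _
  have hq : 0 ≤ L / D := by positivity
  have h3 : ‖v k‖ ≤ a * ‖w 0‖ + (2 + 3 * (L / D)) * σ := by
    refine le_of_sq_le_sq ?_ (by positivity)
    have h4 : (1 - h * D / 4) ^ k * ‖w 0‖ ^ 2 ≤ a ^ 2 * ‖w 0‖ ^ 2 :=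
      mul_le_mul_of_nonneg_right h2 (by positivity)
    have h5 : 0 ≤ a * ‖w 0‖ * ((2 + 3 * (L / D)) * σ) := by positivity
    have h6 : c ≤ ((2 + 3 * (L / D)) * σ) ^ 2 := by
      rw [hc, mul_pow]
      refine mul_le_mul_of_nonneg_right ?_ (by positivity)
      nlinarith
    nlinarith
  have h4 : ‖w k‖ ≤ ‖v k‖ + ‖s k‖ := by
    have : w k = v k + s k := by simp [hv]
    rw [this]; exact norm_add_le _ _
  have := hs k hk
  linarith

/-! ### Finite differences -/

section Differences

variable {E F : Type*} [NormedAddCommGroup E] [NormedSpace ℝ E] [NormedAddCommGroup F]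
  [NormedSpace ℝ F] {φ : E → F} {φ' : E → E →L[ℝ] F} {C₁ C₂ : ℝ}

theorem norm_sub_le_of_hasFDerivAt (h : ∀ x, HasFDerivAt φ (φ' x) x) (hb : ∀ x, ‖φ' x‖ ≤ C₁)
    (x y : E) : ‖φ y - φ x‖ ≤ C₁ * ‖y - x‖ :=
  convex_univ.norm_image_sub_le_of_norm_hasFDerivWithin_le
    (fun z _ => (h z).hasFDerivWithinAt) (fun z _ => hb z) (Set.mem_univ _) (Set.mem_univ _)

/-- One corner is moved from p to p'; what is left is the increment over p of φ(· + (x' − x)) − φ,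
whose derivative is small with x' − x. -/
theorem norm_rect_le (h : ∀ x, HasFDerivAt φ (φ' x) x) (hb : ∀ x, ‖φ' x‖ ≤ C₁)
    (hl : ∀ x y, ‖φ' x - φ' y‖ ≤ C₂ * ‖x - y‖) (x x' p p' : E) :
    ‖φ (x' + p') - φ x' - (φ (x + p) - φ x)‖ ≤ C₁ * ‖p' - p‖ + C₂ * ‖x' - x‖ * ‖p‖ := by
  have h1 := norm_sub_le_of_hasFDerivAt h hb (x' + p) (x' + p')
  rw [add_sub_add_left_eq_sub] at h1
  have h2 := norm_sub_le_of_hasFDerivAt (φ := fun y => φ ((x' - x) + y) - φ y)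
    (φ' := fun y => φ' ((x' - x) + y) - φ' y) (C₁ := C₂ * ‖x' - x‖)
    (fun y => ((hasFDerivAt_comp_add_left (x' - x)).mpr (h _)).sub (h y))
    (fun y => by simpa using hl ((x' - x) + y) y) x (x + p)
  have e1 : x' - x + (x + p) = x' + p := by abel
  have e2 : x' - x + x = x' := by abel
  rw [e1, e2, add_sub_cancel_left] at h2
  have e3 : φ (x' + p') - φ x' - (φ (x + p) - φ x)
      = (φ (x' + p') - φ (x' + p)) + (φ (x' + p) - φ (x + p) - (φ x' - φ x)) := by abel
  rw [e3]
  exact (norm_add_le _ _).trans (add_le_add h1 h2)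

theorem norm_taylor_sub_le (h : ∀ x, HasFDerivAt φ (φ' x) x)
    (hl : ∀ x y, ‖φ' x - φ' y‖ ≤ C₂ * ‖x - y‖) (hC : 0 ≤ C₂) (x : E) {a b : E} {R : ℝ}
    (ha : ‖a‖ ≤ R) (hb : ‖b‖ ≤ R) :
    ‖φ (x + b) - φ (x + a) - φ' x (b - a)‖ ≤ C₂ * R * ‖b - a‖ := by
  have h1 := (convex_closedBall (0 : E) R).norm_image_sub_le_of_norm_hasFDerivWithin_le
    (f := fun y => φ (x + y) - φ' x y) (f' := fun y => φ' (x + y) - φ' x) (C := C₂ * R)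
    (fun y _ => (((hasFDerivAt_comp_add_left x).mpr (h _)).sub (φ' x).hasFDerivAt).hasFDerivWithinAt)
    (fun y hy => by
      have h2 := hl (x + y) x
      rw [add_sub_cancel_left] at h2
      exact h2.trans (mul_le_mul_of_nonneg_left (mem_closedBall_zero_iff.mp hy) hC))
    (mem_closedBall_zero_iff.mpr ha) (mem_closedBall_zero_iff.mpr hb)
  rw [map_sub]
  convert h1 using 2
  abel

/-- The difference of the two Taylor remainders vanishes at 0, and its derivative is a rectangular
increment of φ'. The third derivative of g enters the estimates only through such increments. -/
theorem norm_taylor_rect_le {C₃ : ℝ} (h : ∀ x, HasFDerivAt φ (φ' x) x)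
    (hl : ∀ x x' p, ‖φ' (x' + p) - φ' x' - (φ' (x + p) - φ' x)‖ ≤ C₃ * ‖x' - x‖ * ‖p‖)
    (hC : 0 ≤ C₃) (x x' n : E) :
    ‖φ (x' + n) - φ x' - φ' x' n - (φ (x + n) - φ x - φ' x n)‖
      ≤ C₃ * ‖x' - x‖ * ‖n‖ * ‖n‖ := by
  have h1 := (convex_closedBall (0 : E) ‖n‖).norm_image_sub_le_of_norm_hasFDerivWithin_le
    (f := fun y => φ (x' + y) - φ' x' y - (φ (x + y) - φ' x y))
    (f' := fun y => φ' (x' + y) - φ' x' - (φ' (x + y) - φ' x)) (C := C₃ * ‖x' - x‖ * ‖n‖)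
    (x := 0) (y := n)
    (fun y _ => ((((hasFDerivAt_comp_add_left x').mpr (h _)).sub (φ' x').hasFDerivAt).sub
      (((hasFDerivAt_comp_add_left x).mpr (h _)).sub (φ' x).hasFDerivAt)).hasFDerivWithinAt)
    (fun y hy => (hl x x' y).trans
      (mul_le_mul_of_nonneg_left (mem_closedBall_zero_iff.mp hy) (by positivity)))
    (by simp) (by simp)
  simp only [add_zero, map_zero, sub_zero] at h1
  convert h1 using 2
  abel

end Differences

/-! ### Bounds for the diffusion coefficient and the additivity defect. -/

section Coefficients

variable {d m : ℕ} {g : Vec d → (Vec m →L[ℝ] Vec d)} {γ c₁ c₂ c₃ : ℝ}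

/-- Bounds on `g` and its derivatives; those on the second and the third derivative are expressed
by differences of the first one. -/
structure CoefBound (g : Vec d → (Vec m →L[ℝ] Vec d)) (γ c₁ c₂ c₃ : ℝ) : Prop where
  hasFDerivAt : ∀ y, HasFDerivAt g (fderiv ℝ g y) y
  norm_le : ∀ y, ‖g y‖ ≤ γ
  norm_fderiv_le : ∀ y, ‖fderiv ℝ g y‖ ≤ c₁
  norm_fderiv_sub_le : ∀ x y, ‖fderiv ℝ g x - fderiv ℝ g y‖ ≤ c₂ * ‖x - y‖
  norm_fderiv_rect_le : ∀ x x' p p', ‖fderiv ℝ g (x' + p') - fderiv ℝ g x'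
    - (fderiv ℝ g (x + p) - fderiv ℝ g x)‖ ≤ c₂ * ‖p' - p‖ + c₃ * ‖x' - x‖ * ‖p‖
  nonneg₂ : 0 ≤ c₂
  nonneg₃ : 0 ≤ c₃

namespace CoefBound

theorem nonneg₀ (h : CoefBound g γ c₁ c₂ c₃) : 0 ≤ γ := (norm_nonneg _).trans (h.norm_le 0)

theorem nonneg₁ (h : CoefBound g γ c₁ c₂ c₃) : 0 ≤ c₁ :=
  le_trans (norm_nonneg (fderiv ℝ g 0)) (h.norm_fderiv_le 0)

theorem norm_sub_le (h : CoefBound g γ c₁ c₂ c₃) (x y : Vec d) : ‖g x - g y‖ ≤ c₁ * ‖x - y‖ :=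
  norm_sub_le_of_hasFDerivAt h.hasFDerivAt h.norm_fderiv_le y x

end CoefBound

theorem norm_sum_smul_le {X : Tens m} {q : Fin m → Fin m → Vec d} {C : ℝ}
    (hq : ∀ i j, ‖q i j‖ ≤ C) : ‖∑ i, ∑ j, X (i, j) • q i j‖ ≤ C * l1 X := by
  rw [l1, Finset.mul_sum]
  refine norm_sum_le_of_le _ fun i _ => ?_
  rw [Finset.mul_sum]
  refine norm_sum_le_of_le _ fun j _ => ?_
  rw [norm_smul, Real.norm_eq_abs, mul_comm]
  exact mul_le_mul_of_nonneg_right (hq i j) (abs_nonneg _)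

/-- The vector field `y ↦ Dg(y)[g(y) e_i] e_j`. -/
noncomputable def field (g : Vec d → (Vec m →L[ℝ] Vec d)) (i j : Fin m) (y : Vec d) : Vec d :=
  (fderiv ℝ g y (g y (EuclideanSpace.single i 1))) (EuclideanSpace.single j 1)

theorem secondOrder_eq (g : Vec d → (Vec m →L[ℝ] Vec d)) (y : Vec d) (X : Tens m) :
    secondOrder g y X = ∑ i, ∑ j, X (i, j) • field g i j y := rfl

theorem norm_apply_single_le (B : Vec d →L[ℝ] Vec m →L[ℝ] Vec d) (b : Vec m →L[ℝ] Vec d)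
    (i j : Fin m) {β β' : ℝ} (hB : ‖B‖ ≤ β) (hb : ‖b‖ ≤ β') :
    ‖B (b (EuclideanSpace.single i 1)) (EuclideanSpace.single j 1)‖ ≤ β * β' := by
  have h0 : 0 ≤ β := le_trans (norm_nonneg B) hB
  have h1 : ‖(EuclideanSpace.single j (1 : ℝ) : Vec m)‖ = 1 := by simp
  have h2 : ‖(EuclideanSpace.single i (1 : ℝ) : Vec m)‖ = 1 := by simp
  have h3 : ‖b (EuclideanSpace.single i 1)‖ ≤ β' := by
    have := b.le_of_opNorm_le hb (EuclideanSpace.single i 1)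
    rwa [h2, mul_one] at this
  have h4 : ‖B (b (EuclideanSpace.single i 1))‖ ≤ β * β' :=
    (B.le_of_opNorm_le hB _).trans (mul_le_mul_of_nonneg_left h3 h0)
  have := (B (b (EuclideanSpace.single i 1))).le_of_opNorm_le h4 (EuclideanSpace.single j 1)
  rwa [h1, mul_one] at this

/-- Identifies the cross term of Chen's relation with the first Taylor term of g along g(y)a; their
cancellation makes the defect of third order. -/
theorem secondOrder_tens (g : Vec d → (Vec m →L[ℝ] Vec d)) (y : Vec d) (a b : Vec m) :
    secondOrder g y (tens a b) = fderiv ℝ g y (g y a) b := by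
  have hx : ∀ a : Vec m, a = ∑ i, a i • (EuclideanSpace.single i 1 : Vec m) := fun a => by
    ext j; simp [Finset.sum_apply, Pi.single_apply]
  conv_rhs => rw [hx a, hx b]
  simp only [map_sum, map_smul, _root_.sum_apply, _root_.smul_apply,
    secondOrder, tens, Finset.smul_sum, smul_smul]
  rw [Finset.sum_comm]
  exact Finset.sum_congr rfl fun i _ => Finset.sum_congr rfl fun j _ => by rw [mul_comm]

theorem secondOrder_add (g : Vec d → (Vec m →L[ℝ] Vec d)) (y : Vec d) (X Y : Tens m) :
    secondOrder g y (X + Y) = secondOrder g y X + secondOrder g y Y := by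
  simp [secondOrder, add_smul, Finset.sum_add_distrib]

namespace CoefBound

theorem norm_secondOrder_le (h : CoefBound g γ c₁ c₂ c₃) (y : Vec d) (X : Tens m) :
    ‖secondOrder g y X‖ ≤ c₁ * γ * l1 X :=
  norm_sum_smul_le fun i j => norm_apply_single_le _ _ i j (h.norm_fderiv_le y) (h.norm_le y)

theorem norm_field_sub_le (h : CoefBound g γ c₁ c₂ c₃) (i j : Fin m) (x y : Vec d) :
    ‖field g i j x - field g i j y‖ ≤ (c₁ ^ 2 + γ * c₂) * ‖x - y‖ := by
  have e : field g i j x - field g i j y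
      = fderiv ℝ g x ((g x - g y) (EuclideanSpace.single i 1)) (EuclideanSpace.single j 1)
        + (fderiv ℝ g x - fderiv ℝ g y) (g y (EuclideanSpace.single i 1))
          (EuclideanSpace.single j 1) := by
    simp [field]
  rw [e]
  have h1 := norm_apply_single_le _ _ i j (h.norm_fderiv_le x) (h.norm_sub_le x y)
  have h2 := norm_apply_single_le _ _ i j (h.norm_fderiv_sub_le x y) (h.norm_le y)
  refine (norm_add_le _ _).trans ((add_le_add h1 h2).trans (le_of_eq ?_))
  ring

theorem norm_secondOrder_sub_le (h : CoefBound g γ c₁ c₂ c₃) (x y : Vec d) (X : Tens m) :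
    ‖secondOrder g x X - secondOrder g y X‖ ≤ (c₁ ^ 2 + γ * c₂) * ‖x - y‖ * l1 X := by
  have e : secondOrder g x X - secondOrder g y X
      = ∑ i, ∑ j, X (i, j) • (field g i j x - field g i j y) := by
    simp [secondOrder_eq, smul_sub, Finset.sum_sub_distrib]
  rw [e]
  exact norm_sum_smul_le fun i j => h.norm_field_sub_le i j x y

theorem norm_field_rect_le (h : CoefBound g γ c₁ c₂ c₃) (i j : Fin m) {x x' y y' : Vec d}
    {M : ℝ} (hx : ‖x - y‖ ≤ M) (hx' : ‖x' - y'‖ ≤ M) :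
    ‖field g i j x' - field g i j x - (field g i j y' - field g i j y)‖
      ≤ (c₁ ^ 2 + γ * c₂) * ‖x' - x - (y' - y)‖ + (3 * c₁ * c₂ + γ * c₃) * M * ‖y' - y‖ := by
  have hM : 0 ≤ M := (norm_nonneg _).trans hx
  have n0 := h.nonneg₀
  have n1 := h.nonneg₁
  have n2 := h.nonneg₂
  have n3 := h.nonneg₃
  set P := ‖x' - x - (y' - y)‖ with hP
  set p := ‖y' - y‖ with hp
  have hp0 : 0 ≤ p := norm_nonneg _
  have hP0 : 0 ≤ P := norm_nonneg _
  have rg : ‖g x' - g x - (g y' - g y)‖ ≤ c₁ * P + c₂ * M * p := by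
    have := norm_rect_le h.hasFDerivAt h.norm_fderiv_le h.norm_fderiv_sub_le y x (y' - y) (x' - x)
    rw [add_sub_cancel, add_sub_cancel] at this
    refine this.trans (add_le_add le_rfl ?_)
    gcongr
  have rd : ‖fderiv ℝ g x' - fderiv ℝ g x - (fderiv ℝ g y' - fderiv ℝ g y)‖
      ≤ c₂ * P + c₃ * M * p := by
    have := h.norm_fderiv_rect_le y x (y' - y) (x' - x)
    rw [add_sub_cancel, add_sub_cancel] at this
    refine this.trans (add_le_add le_rfl ?_)
    gcongr
  have d1 : ‖fderiv ℝ g x' - fderiv ℝ g y'‖ ≤ c₂ * M :=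
    (h.norm_fderiv_sub_le _ _).trans (by gcongr)
  have d2 : ‖g y' - g y‖ ≤ c₁ * p := h.norm_sub_le _ _
  have d3 : ‖fderiv ℝ g y' - fderiv ℝ g y‖ ≤ c₂ * p := h.norm_fderiv_sub_le _ _
  have d4 : ‖g x - g y‖ ≤ c₁ * M := (h.norm_sub_le _ _).trans (by gcongr)
  -- A discrete Leibniz rule: every summand has a difference of differences in one factor, or one
  -- difference in each of the two factors.
  have e : field g i j x' - field g i j x - (field g i j y' - field g i j y)
      = (fderiv ℝ g x' - fderiv ℝ g y') ((g y' - g y) (EuclideanSpace.single i 1))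
          (EuclideanSpace.single j 1)
        + fderiv ℝ g x' ((g x' - g x - (g y' - g y)) (EuclideanSpace.single i 1))
          (EuclideanSpace.single j 1)
        + (fderiv ℝ g x' - fderiv ℝ g x - (fderiv ℝ g y' - fderiv ℝ g y))
          (g x (EuclideanSpace.single i 1)) (EuclideanSpace.single j 1)
        + (fderiv ℝ g y' - fderiv ℝ g y) ((g x - g y) (EuclideanSpace.single i 1))
          (EuclideanSpace.single j 1) := by
    simp [field]
    abel
  rw [e]
  have t1 := norm_apply_single_le _ _ i j d1 d2
  have t2 := norm_apply_single_le _ _ i j (h.norm_fderiv_le x') rg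
  have t3 := norm_apply_single_le _ _ i j rd (h.norm_le x)
  have t4 := norm_apply_single_le _ _ i j d3 d4
  refine (norm_add_le _ _).trans ((add_le_add ((norm_add₃_le).trans
    (add_le_add (add_le_add t1 t2) t3)) t4).trans (le_of_eq ?_))
  ring

theorem norm_secondOrder_rect_le (h : CoefBound g γ c₁ c₂ c₃) {x x' y y' : Vec d}
    {M : ℝ} (hx : ‖x - y‖ ≤ M) (hx' : ‖x' - y'‖ ≤ M) (X : Tens m) :
    ‖secondOrder g x' X - secondOrder g x X - (secondOrder g y' X - secondOrder g y X)‖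
      ≤ ((c₁ ^ 2 + γ * c₂) * ‖x' - x - (y' - y)‖ + (3 * c₁ * c₂ + γ * c₃) * M * ‖y' - y‖)
        * l1 X := by
  have e : secondOrder g x' X - secondOrder g x X - (secondOrder g y' X - secondOrder g y X)
      = ∑ i, ∑ j, X (i, j) •
        (field g i j x' - field g i j x - (field g i j y' - field g i j y)) := by
    simp [secondOrder_eq, smul_sub, Finset.sum_sub_distrib]
  rw [e]
  exact norm_sum_smul_le fun i j => h.norm_field_rect_le i j hx hx'

end CoefBound

/-- The defect of additivity of the germ `g(y) x + Dg(y) g(y) 𝕏` along an increment from `y` to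
`y'`. -/
noncomputable def defect (g : Vec d → (Vec m →L[ℝ] Vec d)) (y y' : Vec d) (x₁ x₂ : Vec m)
    (X : Tens m) : Vec d :=
  (g y' - g y) x₂ - secondOrder g y (tens x₁ x₂) + (secondOrder g y' X - secondOrder g y X)

namespace CoefBound

/-- The letter A stands for (elapsed fraction)^α. The linear Taylor term in g(y)x₁ cancels against
the tensor term; what remains is a remainder ρ or a square of g(y)x₁, of order A², times an
increment of order A, or an increment of order A times 𝕏 of order A². -/
theorem norm_defect_le (h : CoefBound g γ c₁ c₂ c₃) {y ρ : Vec d} {x₁ x₂ : Vec m} {X : Tens m}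
    {η A r : ℝ} (hη : 0 ≤ η) (hA : 0 ≤ A) (hA1 : A ≤ 1) (hx₁ : ‖x₁‖ ≤ η * A)
    (hx₂ : ‖x₂‖ ≤ η * A) (hX : l1 X ≤ η ^ 2 * A ^ 2) (hρ : ‖ρ‖ ≤ r * A ^ 2) :
    ‖defect g y (y + g y x₁ + ρ) x₁ x₂ X‖
      ≤ (η * (c₁ * r + c₂ * γ ^ 2 * η ^ 2) + η ^ 2 * (c₁ ^ 2 + γ * c₂) * (γ * η + r)) * A ^ 3 := by
  have n0 := h.nonneg₀
  have n1 := h.nonneg₁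
  have n2 := h.nonneg₂
  have hrA : 0 ≤ r * A ^ 2 := (norm_nonneg _).trans hρ
  set n := g y x₁ with hn
  have hn1 : ‖n‖ ≤ γ * (η * A) :=
    ((g y).le_of_opNorm_le (h.norm_le y) x₁).trans (mul_le_mul_of_nonneg_left hx₁ n0)
  have a1 : ‖g (y + n + ρ) - g (y + n)‖ ≤ c₁ * (r * A ^ 2) := by
    have := h.norm_sub_le (y + n + ρ) (y + n)
    rw [add_sub_cancel_left] at this
    exact this.trans (mul_le_mul_of_nonneg_left hρ n1)
  have a2 : ‖g (y + n) - g y - fderiv ℝ g y n‖ ≤ c₂ * (γ * (η * A)) * (γ * (η * A)) := by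
    have := norm_taylor_sub_le h.hasFDerivAt h.norm_fderiv_sub_le n2 y (a := 0) (b := n)
      (R := γ * (η * A)) (by rw [norm_zero]; positivity) hn1
    rw [add_zero, sub_zero] at this
    exact this.trans (mul_le_mul_of_nonneg_left hn1 (by positivity))
  have a3 : ‖y + n + ρ - y‖ ≤ γ * (η * A) + r * A ^ 2 := by
    have : y + n + ρ - y = n + ρ := by abel
    rw [this]
    exact (norm_add_le _ _).trans (add_le_add hn1 hρ)
  have a4 : γ * (η * A) + r * A ^ 2 ≤ (γ * η + r) * A := by
    have : r * A ^ 2 ≤ r * A := by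
      rcases hA.eq_or_lt with rfl | hA'
      · simp
      · have hr : 0 ≤ r := by
          by_contra hcon
          push Not at hcon
          nlinarith [pow_pos hA' 2]
        exact mul_le_mul_of_nonneg_left (by nlinarith) hr
    linarith
  have e : defect g y (y + n + ρ) x₁ x₂ X
      = ((g (y + n + ρ) - g (y + n)) + (g (y + n) - g y - fderiv ℝ g y n)) x₂
        + (secondOrder g (y + n + ρ) X - secondOrder g y X) := by
    rw [defect, secondOrder_tens, ← hn]
    simp
    abel
  rw [e]
  have b1 := ((g (y + n + ρ) - g (y + n)) + (g (y + n) - g y - fderiv ℝ g y n)).le_of_opNorm_le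
    ((norm_add_le _ _).trans (add_le_add a1 a2)) x₂
  have b2 := h.norm_secondOrder_sub_le (y + n + ρ) y X
  have b3 : (c₁ * (r * A ^ 2) + c₂ * (γ * (η * A)) * (γ * (η * A))) * ‖x₂‖
      ≤ (c₁ * (r * A ^ 2) + c₂ * (γ * (η * A)) * (γ * (η * A))) * (η * A) :=
    mul_le_mul_of_nonneg_left hx₂ (by positivity)
  have b4 : (c₁ ^ 2 + γ * c₂) * ‖y + n + ρ - y‖ * l1 X
      ≤ (c₁ ^ 2 + γ * c₂) * ((γ * η + r) * A) * (η ^ 2 * A ^ 2) := by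
    have := l1_nonneg X
    have := a3.trans a4
    gcongr
    exact mul_nonneg (by positivity) ((norm_nonneg _).trans this)
  refine (norm_add_le _ _).trans ((add_le_add (b1.trans b3) (b2.trans b4)).trans (le_of_eq ?_))
  ring

/-- The same cancellation for the difference of two solutions, with every term linear in the
distance M or in the remainder difference R. The Taylor remainders are compared by stripping ρ and
σ, then replacing g(z)x₁ by g(y)x₁ at the base point z, and finally moving the base point from z to
y. -/
theorem norm_defect_sub_le (h : CoefBound g γ c₁ c₂ c₃) {y ρ z σ : Vec d} {x₁ x₂ : Vec m}
    {X : Tens m} {η A r R M : ℝ} (hη : 0 ≤ η) (hA : 0 ≤ A) (hA1 : A ≤ 1) (hr : 0 ≤ r)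
    (hR : 0 ≤ R) (hx₁ : ‖x₁‖ ≤ η * A) (hx₂ : ‖x₂‖ ≤ η * A) (hX : l1 X ≤ η ^ 2 * A ^ 2)
    (hρ : ‖ρ‖ ≤ r * A ^ 2) (hσρ : ‖σ - ρ‖ ≤ R * A ^ 2) (hz : ‖z - y‖ ≤ M)
    (hz' : ‖(z + g z x₁ + σ) - (y + g y x₁ + ρ)‖ ≤ M) :
    ‖defect g z (z + g z x₁ + σ) x₁ x₂ X - defect g y (y + g y x₁ + ρ) x₁ x₂ X‖
      ≤ (η * (c₁ * R + c₂ * r * (1 + c₁ * η) * M + c₂ * γ * c₁ * η ^ 2 * M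
            + c₃ * γ ^ 2 * η ^ 2 * M)
          + η ^ 2 * ((c₁ ^ 2 + γ * c₂) * (c₁ * η * M + R)
            + (3 * c₁ * c₂ + γ * c₃) * M * (γ * η + r))) * A ^ 3 := by
  have n0 := h.nonneg₀
  have n1 := h.nonneg₁
  have n2 := h.nonneg₂
  have n3 := h.nonneg₃
  have hM : 0 ≤ M := (norm_nonneg _).trans hz
  have hA2 : A ^ 2 ≤ A := by nlinarith
  set n := g y x₁ with hn
  set n' := g z x₁ with hn'
  have hn1 : ‖n‖ ≤ γ * (η * A) :=
    ((g y).le_of_opNorm_le (h.norm_le y) x₁).trans (mul_le_mul_of_nonneg_left hx₁ n0)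
  have hn2 : ‖n'‖ ≤ γ * (η * A) :=
    ((g z).le_of_opNorm_le (h.norm_le z) x₁).trans (mul_le_mul_of_nonneg_left hx₁ n0)
  have hnn : ‖n' - n‖ ≤ c₁ * M * (η * A) := by
    have h1 : ‖g z - g y‖ ≤ c₁ * M := (h.norm_sub_le z y).trans (by gcongr)
    have h2 := (g z - g y).le_of_opNorm_le h1 x₁
    rw [_root_.sub_apply] at h2
    exact h2.trans (mul_le_mul_of_nonneg_left hx₁ (by positivity))
  have a1 : ‖g (z + n' + σ) - g (z + n') - (g (y + n + ρ) - g (y + n))‖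
      ≤ c₁ * (R * A ^ 2) + c₂ * ((1 + c₁ * η) * M) * (r * A ^ 2) := by
    refine (norm_rect_le h.hasFDerivAt h.norm_fderiv_le h.norm_fderiv_sub_le (y + n) (z + n') ρ
      σ).trans ?_
    have h1 : ‖z + n' - (y + n)‖ ≤ (1 + c₁ * η) * M := by
      have e : z + n' - (y + n) = (z - y) + (n' - n) := by abel
      rw [e]
      refine (norm_add_le _ _).trans ((add_le_add hz hnn).trans ?_)
      have : c₁ * M * (η * A) ≤ c₁ * M * (η * 1) := by gcongr
      linarith
    gcongr
  have a2 : ‖g (z + n') - g (z + n) - fderiv ℝ g z (n' - n)‖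
      ≤ c₂ * (γ * (η * A)) * (c₁ * M * (η * A)) :=
    (norm_taylor_sub_le h.hasFDerivAt h.norm_fderiv_sub_le n2 z hn1 hn2).trans
      (mul_le_mul_of_nonneg_left hnn (by positivity))
  have a3 : ‖g (z + n) - g z - fderiv ℝ g z n - (g (y + n) - g y - fderiv ℝ g y n)‖
      ≤ c₃ * M * (γ * (η * A)) * (γ * (η * A)) := by
    refine (norm_taylor_rect_le h.hasFDerivAt (C₃ := c₃) (fun x x' p => ?_) n3 y z n).trans ?_
    · simpa using h.norm_fderiv_rect_le x x' p p
    gcongr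
  have a5 : ‖z + n' + σ - z - (y + n + ρ - y)‖ ≤ (c₁ * η * M + R) * A := by
    have e : z + n' + σ - z - (y + n + ρ - y) = (n' - n) + (σ - ρ) := by abel
    rw [e]
    refine (norm_add_le _ _).trans ((add_le_add hnn hσρ).trans ?_)
    have := mul_le_mul_of_nonneg_left hA2 hR
    linarith
  have a6 : ‖y + n + ρ - y‖ ≤ (γ * η + r) * A := by
    have e : y + n + ρ - y = n + ρ := by abel
    rw [e]
    refine (norm_add_le _ _).trans ((add_le_add hn1 hρ).trans ?_)
    have := mul_le_mul_of_nonneg_left hA2 hr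
    linarith
  have e : defect g z (z + n' + σ) x₁ x₂ X - defect g y (y + n + ρ) x₁ x₂ X
      = ((g (z + n' + σ) - g (z + n') - (g (y + n + ρ) - g (y + n)))
          + (g (z + n') - g (z + n) - fderiv ℝ g z (n' - n))
          + (g (z + n) - g z - fderiv ℝ g z n - (g (y + n) - g y - fderiv ℝ g y n))) x₂
        + (secondOrder g (z + n' + σ) X - secondOrder g z X
          - (secondOrder g (y + n + ρ) X - secondOrder g y X)) := by
    rw [defect, defect, secondOrder_tens, secondOrder_tens, ← hn, ← hn']
    simp
    abel
  rw [e]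
  have b1 := ((g (z + n' + σ) - g (z + n') - (g (y + n + ρ) - g (y + n)))
          + (g (z + n') - g (z + n) - fderiv ℝ g z (n' - n))
          + (g (z + n) - g z - fderiv ℝ g z n
            - (g (y + n) - g y - fderiv ℝ g y n))).le_of_opNorm_le
    (norm_add₃_le.trans (add_le_add (add_le_add a1 a2) a3)) x₂
  have b2 := b1.trans (mul_le_mul_of_nonneg_left hx₂ (by positivity))
  have b3 := h.norm_secondOrder_rect_le hz hz' X
  have b4 : ((c₁ ^ 2 + γ * c₂) * ‖z + n' + σ - z - (y + n + ρ - y)‖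
      + (3 * c₁ * c₂ + γ * c₃) * M * ‖y + n + ρ - y‖) * l1 X
      ≤ ((c₁ ^ 2 + γ * c₂) * ((c₁ * η * M + R) * A)
      + (3 * c₁ * c₂ + γ * c₃) * M * ((γ * η + r) * A)) * (η ^ 2 * A ^ 2) := by
    have := l1_nonneg X
    gcongr
  refine (norm_add_le _ _).trans ((add_le_add b2 (b3.trans b4)).trans (le_of_eq ?_))
  ring

end CoefBound

end Coefficients

/-! ### Sewing estimates on short intervals. -/

section Pieces

variable {d m : ℕ} {α : ℝ} {g : Vec d → (Vec m →L[ℝ] Vec d)} {f : Vec d → Vec d}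
  {γ c₁ c₂ c₃ L : ℝ}

/-- The constants entering `L_g`, for `L ≤ 1`. -/
structure SizeBound (γ c₁ c₂ c₃ L : ℝ) : Prop where
  nonneg : 0 ≤ L
  le_one : L ≤ 1
  one : c₁ ≤ L
  two : c₂ ≤ L
  zero_one : γ * c₁ ≤ L ^ 2
  zero_two : γ * c₂ ≤ L ^ 2
  zero_three : γ * c₃ ≤ L ^ 2
  zero_zero_three : γ ^ 2 * c₃ ≤ L ^ 3

/-- The germ `g(y_i) x_{t_i,t_j} + Dg(y_i) g(y_i) 𝕏_{t_i,t_j}` of the rough integral. -/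
noncomputable def germ (g : Vec d → (Vec m →L[ℝ] Vec d)) (w : PathSpace m α) (Δ : ℝ)
    (y : ℕ → Vec d) (i j : ℕ) : Vec d :=
  g (y i) (lvl1 w (i * Δ) (j * Δ)) + secondOrder g (y i) (lvl2 w (i * Δ) (j * Δ))

/-- The discrete rough integral from `t_i` to `t_j`. -/
noncomputable def rsum (g : Vec d → (Vec m →L[ℝ] Vec d)) (w : PathSpace m α) (Δ : ℝ)
    (y : ℕ → Vec d) (i j : ℕ) : Vec d :=
  ∑ l ∈ Finset.Ico i j, germ g w Δ y l (l + 1)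

theorem germ_sub_sub (g : Vec d → (Vec m →L[ℝ] Vec d)) (w : PathSpace m α) (Δ : ℝ)
    (y : ℕ → Vec d) (i k j : ℕ) :
    germ g w Δ y i j - germ g w Δ y i k - germ g w Δ y k j
      = -defect g (y i) (y k) (lvl1 w (i * Δ) (k * Δ)) (lvl1 w (k * Δ) (j * Δ))
          (lvl2 w (k * Δ) (j * Δ)) := by
  rw [germ, lvl1_add w (i * Δ) (k * Δ) (j * Δ), lvl2_add w (i * Δ) (k * Δ) (j * Δ),
    secondOrder_add, secondOrder_add, germ, germ, defect]
  simp
  abel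

theorem IsHolderOn.grid {w : PathSpace m α} {N Δ : ℝ} {n : ℕ} (hΔ : 0 < Δ) (hn : 0 < n)
    (h : IsHolderOn w N (n * Δ)) {i j : ℕ} (hij : i ≤ j) (hj : j ≤ n) :
    ‖lvl1 w (i * Δ) (j * Δ)‖ ≤ N * (n * Δ) ^ α * (((j : ℝ) - i) / n) ^ α ∧
      l1 (lvl2 w (i * Δ) (j * Δ))
        ≤ (N * (n * Δ) ^ α) ^ 2 * ((((j : ℝ) - i) / n) ^ α) ^ 2 := by
  have hn' : (0 : ℝ) < n := by exact_mod_cast hn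
  have hij' : (i : ℝ) ≤ j := by exact_mod_cast hij
  have hj' : (j : ℝ) ≤ n := by exact_mod_cast hj
  have h1 := h (i * Δ) (j * Δ) (by positivity) (by gcongr) (by gcongr)
  have hs : 0 ≤ ((j : ℝ) - i) / n := div_nonneg (by linarith) hn'.le
  have e : (j : ℝ) * Δ - i * Δ = (n * Δ) * (((j : ℝ) - i) / n) := by field_simp
  have e1 : ((j : ℝ) * Δ - i * Δ) ^ α = (n * Δ) ^ α * (((j : ℝ) - i) / n) ^ α := by
    rw [e, Real.mul_rpow (by positivity) hs]
  have e2 : ((j : ℝ) * Δ - i * Δ) ^ (2 * α) = ((n * Δ) ^ α * (((j : ℝ) - i) / n) ^ α) ^ 2 := by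
    rw [← e1, mul_comm 2 α, Real.rpow_mul (by rw [e]; positivity), Real.rpow_two]
  rw [e1, e2] at h1
  constructor
  · linarith [h1.1]
  · linarith [h1.2]

/-- The condition α ≤ 1/2 gives s ≤ s^{2α}: the drift, linear in time, counts as a second order term
of the remainder. -/
theorem frac_pow_bounds (hα : 1 / 3 < α) (hα' : α ≤ 1 / 2) {s : ℝ} (hs0 : 0 ≤ s)
    (hs1 : s ≤ 1) : 0 ≤ s ^ α ∧ s ^ α ≤ 1 ∧ s ≤ (s ^ α) ^ 2 ∧ s ^ (3 * α) = (s ^ α) ^ 3 := by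
  refine ⟨by positivity, Real.rpow_le_one hs0 hs1 (by linarith), ?_, ?_⟩
  · have : (s ^ α) ^ 2 = s ^ (2 * α) := by rw [mul_comm, Real.rpow_mul hs0, Real.rpow_two]
    rw [this]
    calc s = s ^ (1 : ℝ) := (Real.rpow_one s).symm
      _ ≤ s ^ (2 * α) := by
        rcases hs0.eq_or_lt with rfl | h
        · rw [Real.zero_rpow one_ne_zero, Real.zero_rpow (by linarith)]
        · exact Real.rpow_le_rpow_of_exponent_ge h hs1 (by linarith)
  · rw [mul_comm 3 α, Real.rpow_mul hs0]
    exact_mod_cast Real.rpow_natCast (s ^ α) 3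

theorem telescope {y : ℕ → Vec d} {w : PathSpace m α} {Δ : ℝ} {n : ℕ}
    (hy : ∀ k < n, y (k + 1) = y k + Δ • f (y k) + germ g w Δ y k (k + 1)) (i j : ℕ)
    (hij : i ≤ j) (hj : j ≤ n) :
    y j = y i + Δ • ∑ l ∈ Finset.Ico i j, f (y l) + rsum g w Δ y i j := by
  induction j, hij using Nat.le_induction with
  | base => simp [rsum]
  | succ k hik ih =>
    have h := ih (by omega)
    rw [hy k (by omega), rsum, Finset.sum_Ico_succ_top hik, Finset.sum_Ico_succ_top hik, smul_add]
    rw [rsum] at h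
    generalize Δ • f (y k) = p
    generalize germ g w Δ y k (k + 1) = q
    rw [h]
    abel

theorem norm_drift_le {E : Type*} [SeminormedAddCommGroup E] [NormedSpace ℝ E] {p : ℕ → E}
    {B Δ : ℝ} (hΔ : 0 < Δ) {n i k : ℕ} (hn : 0 < n) (hp : ∀ l < n, ‖p l‖ ≤ B) (hik : i ≤ k)
    (hk : k ≤ n) :
    ‖Δ • ∑ l ∈ Finset.Ico i k, p l‖ ≤ B * (n * Δ) * (((k : ℝ) - i) / n) := by
  have hn' : (0 : ℝ) < n := by exact_mod_cast hn
  have h1 : ‖∑ l ∈ Finset.Ico i k, p l‖ ≤ ((k : ℝ) - i) * B := by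
    refine (norm_sum_le_of_le _ fun l hl => hp l ?_).trans (le_of_eq ?_)
    · exact lt_of_lt_of_le (Finset.mem_Ico.mp hl).2 hk
    · rw [Finset.sum_const, Nat.card_Ico, nsmul_eq_mul, Nat.cast_sub hik]
  rw [norm_smul, Real.norm_of_nonneg hΔ.le]
  calc Δ * ‖∑ l ∈ Finset.Ico i k, p l‖ ≤ Δ * (((k : ℝ) - i) * B) :=
        mul_le_mul_of_nonneg_left h1 hΔ.le
    _ = _ := by field_simp

/-- The contraction parameter of the sewing lemma. -/
noncomputable def sewGap (α : ℝ) : ℝ := 1 - (2 / 3 : ℝ) ^ (3 * α - 1)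

theorem sewGap_pos (hα : 1 / 3 < α) : 0 < sewGap α := by
  have : (2 / 3 : ℝ) ^ (3 * α - 1) < 1 :=
    Real.rpow_lt_one (by norm_num) (by norm_num) (by linarith)
  unfold sewGap; linarith

theorem sewGap_le_one : sewGap α ≤ 1 := by
  have : (0 : ℝ) < (2 / 3 : ℝ) ^ (3 * α - 1) := by positivity
  unfold sewGap; linarith

variable {w : PathSpace m α} {N Δ B : ℝ} {n : ℕ} {y u : ℕ → Vec d}

/-- Beyond the first level, a solution increment consists of drift, the second level term and the
sewing error. Each is of order A², the last by the sewing bound assumed on [i, k]. -/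
theorem remainder_bounds (hα : 1 / 3 < α) (hα' : α ≤ 1 / 2) (hg : CoefBound g γ c₁ c₂ c₃)
    (hs : SizeBound γ c₁ c₂ c₃ L) (hΔ : 0 < Δ) (hn : 0 < n) (hN : 0 ≤ N)
    (hw : IsHolderOn w N (n * Δ))
    (hy : ∀ k < n, y (k + 1) = y k + Δ • f (y k) + germ g w Δ y k (k + 1))
    (hB : ∀ k < n, ‖f (y k)‖ ≤ B) {K : ℝ} (hK : 0 ≤ K) {i k j : ℕ} (hik : i < k) (hkj : k < j)
    (hj : j ≤ n)
    (hJ : ‖rsum g w Δ y i k - germ g w Δ y i k‖ ≤ K * (((k : ℝ) - i) / n) ^ (3 * α)) :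
    ‖y k - y i - g (y i) (lvl1 w (i * Δ) (k * Δ))‖
      ≤ (B * (n * Δ) + (L * (N * (n * Δ) ^ α)) ^ 2 + K) * ((((j : ℝ) - i) / n) ^ α) ^ 2 := by
  have hn' : (0 : ℝ) < n := by exact_mod_cast hn
  have hik' : (i : ℝ) < k := by exact_mod_cast hik
  have hkj' : (k : ℝ) < j := by exact_mod_cast hkj
  have hi0 : (0 : ℝ) ≤ i := Nat.cast_nonneg i
  have hj' : (j : ℝ) ≤ n := by exact_mod_cast hj
  set s := ((k : ℝ) - i) / n with hsdef
  set t := ((j : ℝ) - i) / n with htdef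
  have hs0 : 0 ≤ s := div_nonneg (by linarith) hn'.le
  have hst : s ≤ t := div_le_div_of_nonneg_right (by linarith) hn'.le
  have ht1 : t ≤ 1 := by rw [htdef, div_le_one hn']; linarith
  obtain ⟨a0, a1, a2, a3⟩ := frac_pow_bounds hα hα' hs0 (hst.trans ht1)
  have hst' : s ^ α ≤ t ^ α := Real.rpow_le_rpow hs0 hst (by linarith)
  have hsq : (s ^ α) ^ 2 ≤ (t ^ α) ^ 2 := pow_le_pow_left₀ a0 hst' 2
  set η := N * (n * Δ) ^ α with hη
  have hη0 : 0 ≤ η := by positivity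
  have hB0 : 0 ≤ B := (norm_nonneg _).trans (hB 0 hn)
  have e : y k - y i - g (y i) (lvl1 w (i * Δ) (k * Δ))
      = Δ • ∑ l ∈ Finset.Ico i k, f (y l) + secondOrder g (y i) (lvl2 w (i * Δ) (k * Δ))
        + (rsum g w Δ y i k - germ g w Δ y i k) := by
    rw [telescope hy i k hik.le (by omega), germ]; abel
  have b1 := norm_drift_le hΔ hn hB hik.le (by omega : k ≤ n)
  have b2 := hg.norm_secondOrder_le (y i) (lvl2 w (i * Δ) (k * Δ))
  have b3 := (hw.grid hΔ hn hik.le (by omega : k ≤ n)).2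
  have b4 : c₁ * γ * l1 (lvl2 w (i * Δ) (k * Δ)) ≤ (L * η) ^ 2 * (s ^ α) ^ 2 := by
    have h1 : c₁ * γ ≤ L ^ 2 := by linarith [hs.zero_one]
    have h2 := mul_le_mul h1 b3 (l1_nonneg _) (by positivity)
    linarith
  have b5 : B * (n * Δ) * s ≤ B * (n * Δ) * (s ^ α) ^ 2 :=
    mul_le_mul_of_nonneg_left a2 (by positivity)
  have b6 : K * s ^ (3 * α) ≤ K * (s ^ α) ^ 2 := by
    rw [a3]
    exact mul_le_mul_of_nonneg_left (pow_le_pow_of_le_one a0 a1 (by norm_num)) hK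
  rw [e]
  calc _ ≤ B * (n * Δ) * s + c₁ * γ * l1 (lvl2 w (i * Δ) (k * Δ)) + K * s ^ (3 * α) :=
        norm_add₃_le.trans (add_le_add (add_le_add b1 b2) hJ)
    _ ≤ (B * (n * Δ) + (L * η) ^ 2 + K) * (s ^ α) ^ 2 := by linarith
    _ ≤ _ := mul_le_mul_of_nonneg_left hsq (by positivity)

/-- Every coefficient product comes with enough factors η to become a power of e = Lη ≤ 1, leaving γ
only in γη. The left side is at most 3e(BT + 1 + γη) + 3eK: the first term is half of qK by the
choice of K, the second at most half of qK by 6e ≤ q. -/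
theorem sewing_budget (hs : SizeBound γ c₁ c₂ c₃ L) (n0 : 0 ≤ γ) (n1 : 0 ≤ c₁)
    {η e q BT K : ℝ} (hη0 : 0 ≤ η) (hBT : 0 ≤ BT) (he : e = L * η) (hes : 6 * e ≤ q) (hq1 : q ≤ 1)
    (hK : 0 ≤ K) (hqK : q * K = 6 * e * (BT + 1 + γ * η)) :
    η * (c₁ * (BT + e ^ 2 + K) + c₂ * γ ^ 2 * η ^ 2)
      + η ^ 2 * (c₁ ^ 2 + γ * c₂) * (γ * η + (BT + e ^ 2 + K)) ≤ q * K := by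
  have hL := hs.nonneg
  have he0 : 0 ≤ e := by rw [he]; positivity
  have he1 : e ≤ 1 := by linarith
  set r := BT + e ^ 2 + K with hr
  have hr0 : 0 ≤ r := by positivity
  have p1 : η * (c₁ * r) ≤ e * r := by
    have := mul_le_mul_of_nonneg_right hs.one (by positivity : 0 ≤ η * r)
    rw [he]; linarith
  have p2 : η * (c₂ * γ ^ 2 * η ^ 2) ≤ e ^ 2 * (γ * η) := by
    have := mul_le_mul_of_nonneg_right hs.zero_two (by positivity : 0 ≤ γ * η ^ 3)
    rw [he]; linarith
  have p3 : η ^ 2 * (c₁ ^ 2 + γ * c₂) ≤ 2 * e ^ 2 := by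
    have h1 : c₁ ^ 2 ≤ L ^ 2 := pow_le_pow_left₀ n1 hs.one 2
    have := mul_le_mul_of_nonneg_right (add_le_add h1 hs.zero_two) (by positivity : 0 ≤ η ^ 2)
    rw [he]; linarith
  have p4 := mul_le_mul_of_nonneg_right p3 (by positivity : 0 ≤ γ * η + r)
  have he2 : e ^ 2 ≤ e := by nlinarith
  have p5 : e ^ 2 * (γ * η + r) ≤ e * (γ * η + r) :=
    mul_le_mul_of_nonneg_right he2 (by positivity)
  have p6 : e ^ 2 * (γ * η) ≤ e * (γ * η) := mul_le_mul_of_nonneg_right he2 (by positivity)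
  have p7 : e * (BT + e ^ 2 + K) ≤ e * (BT + 1 + K) :=
    mul_le_mul_of_nonneg_left (by linarith) he0
  have p8 : 6 * e * K ≤ q * K := mul_le_mul_of_nonneg_right hes hK
  rw [← hr] at p7
  linarith

/-- The sewing estimate for one solution. -/
theorem norm_rsum_sub_germ_le (hα : 1 / 3 < α) (hα' : α ≤ 1 / 2)
    (hg : CoefBound g γ c₁ c₂ c₃) (hs : SizeBound γ c₁ c₂ c₃ L) (hΔ : 0 < Δ) (hn : 0 < n)
    (hN : 0 ≤ N) (hw : IsHolderOn w N (n * Δ))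
    (hy : ∀ k < n, y (k + 1) = y k + Δ • f (y k) + germ g w Δ y k (k + 1))
    (hB : ∀ k < n, ‖f (y k)‖ ≤ B) {e : ℝ} (he : e = L * (N * (n * Δ) ^ α))
    (hes : 6 * e ≤ sewGap α) (i j : ℕ) (hij : i < j) (hj : j ≤ n) :
    ‖rsum g w Δ y i j - germ g w Δ y i j‖
      ≤ 6 / sewGap α * e * (B * (n * Δ) + 1 + γ * (N * (n * Δ) ^ α))
        * (((j : ℝ) - i) / n) ^ (3 * α) := by
  have hq0 := sewGap_pos hα
  have hq1 := sewGap_le_one (α := α)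
  have hn' : (0 : ℝ) < n := by exact_mod_cast hn
  have n0 := hg.nonneg₀
  have n1 := hg.nonneg₁
  have hL := hs.nonneg
  set η := N * (n * Δ) ^ α with hη
  have hη0 : 0 ≤ η := by positivity
  have he0 : 0 ≤ e := by rw [he]; positivity
  have he1 : e ≤ 1 := by linarith
  have hB0 : 0 ≤ B := (norm_nonneg _).trans (hB 0 hn)
  set T := (n : ℝ) * Δ with hT
  have hT0 : 0 < T := by positivity
  set K := 6 / sewGap α * e * (B * T + 1 + γ * η) with hKdef
  have hK : 0 ≤ K := by positivity
  have hqK : sewGap α * K = 6 * e * (B * T + 1 + γ * η) := by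
    rw [hKdef]; field_simp
  refine discrete_sewing (Ξ := germ g w Δ y) (by linarith : (1 : ℝ) ≤ 3 * α) hK ?_ i j hij hj
  intro i k j hik hkj hj hJ
  have hρ := remainder_bounds hα hα' hg hs hΔ hn hN hw hy hB hK hik hkj hj hJ
  have hik' : (i : ℝ) < k := by exact_mod_cast hik
  have hkj' : (k : ℝ) < j := by exact_mod_cast hkj
  have hi0 : (0 : ℝ) ≤ i := Nat.cast_nonneg i
  have hj' : (j : ℝ) ≤ n := by exact_mod_cast hj
  have hs0 : 0 ≤ ((j : ℝ) - i) / n := div_nonneg (by linarith) hn'.le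
  have hs1 : ((j : ℝ) - i) / n ≤ 1 := by rw [div_le_one hn']; linarith
  obtain ⟨a0, a1, a2, a3⟩ := frac_pow_bounds hα hα' hs0 hs1
  have hx1 := (hw.grid hΔ hn hik.le (by omega : k ≤ n)).1
  have hx2 := hw.grid hΔ hn hkj.le hj
  have m1 : (((k : ℝ) - i) / n) ^ α ≤ (((j : ℝ) - i) / n) ^ α :=
    Real.rpow_le_rpow (div_nonneg (by linarith) hn'.le)
      (div_le_div_of_nonneg_right (by linarith) hn'.le) (by linarith)
  have m2 : (((j : ℝ) - k) / n) ^ α ≤ (((j : ℝ) - i) / n) ^ α :=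
    Real.rpow_le_rpow (div_nonneg (by linarith) hn'.le)
      (div_le_div_of_nonneg_right (by linarith) hn'.le) (by linarith)
  have m20 : 0 ≤ (((j : ℝ) - k) / n) ^ α :=
    Real.rpow_nonneg (div_nonneg (by linarith) hn'.le) _
  set A := (((j : ℝ) - i) / n) ^ α with hA
  have key := hg.norm_defect_le (y := y i)
    (ρ := y k - y i - g (y i) (lvl1 w (i * Δ) (k * Δ))) hη0 a0 a1
    (hx1.trans (mul_le_mul_of_nonneg_left m1 hη0))
    (hx2.1.trans (mul_le_mul_of_nonneg_left m2 hη0))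
    (hx2.2.trans (mul_le_mul_of_nonneg_left (pow_le_pow_left₀ m20 m2 2) (by positivity))) hρ
  have e1 : y i + g (y i) (lvl1 w (i * Δ) (k * Δ))
      + (y k - y i - g (y i) (lvl1 w (i * Δ) (k * Δ))) = y k := by abel
  rw [e1] at key
  rw [germ_sub_sub, norm_neg, a3]
  refine key.trans (mul_le_mul_of_nonneg_right ?_ (by positivity))
  change _ ≤ sewGap α * K
  rw [← he]
  exact sewing_budget hs n0 n1 hη0 (by positivity) he hes hq1 hK hqK

theorem norm_germ_le (hg : CoefBound g γ c₁ c₂ c₃) (hs : SizeBound γ c₁ c₂ c₃ L) (hΔ : 0 < Δ)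
    (hn : 0 < n) (hN : 0 ≤ N) (hα : 0 < α) (hw : IsHolderOn w N (n * Δ)) (y : ℕ → Vec d) {i j : ℕ}
    (hij : i ≤ j) (hj : j ≤ n) :
    ‖germ g w Δ y i j‖ ≤ γ * (N * (n * Δ) ^ α) + (L * (N * (n * Δ) ^ α)) ^ 2 := by
  have n0 := hg.nonneg₀
  have n1 := hg.nonneg₁
  have hx := hw.grid hΔ hn hij hj
  have hn' : (0 : ℝ) < n := by exact_mod_cast hn
  have hij' : (i : ℝ) ≤ j := by exact_mod_cast hij
  have hj' : (j : ℝ) ≤ n := by exact_mod_cast hj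
  have hi0 : (0 : ℝ) ≤ i := Nat.cast_nonneg i
  have hs0 : 0 ≤ ((j : ℝ) - i) / n := div_nonneg (by linarith) hn'.le
  have a0 : 0 ≤ (((j : ℝ) - i) / n) ^ α := by positivity
  have a1 : (((j : ℝ) - i) / n) ^ α ≤ 1 :=
    Real.rpow_le_one hs0 (by rw [div_le_one hn']; linarith) hα.le
  set η := N * (n * Δ) ^ α with hη
  have hη0 : 0 ≤ η := by positivity
  have h1 : ‖lvl1 w (i * Δ) (j * Δ)‖ ≤ η := hx.1.trans (mul_le_of_le_one_right hη0 a1)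
  have h2 : l1 (lvl2 w (i * Δ) (j * Δ)) ≤ η ^ 2 :=
    hx.2.trans (mul_le_of_le_one_right (by positivity) (pow_le_one₀ a0 a1))
  have h3 : ‖g (y i) (lvl1 w (i * Δ) (j * Δ))‖ ≤ γ * η :=
    ((g (y i)).le_of_opNorm_le (hg.norm_le _) _).trans (mul_le_mul_of_nonneg_left h1 n0)
  have h4 : ‖secondOrder g (y i) (lvl2 w (i * Δ) (j * Δ))‖ ≤ (L * η) ^ 2 := by
    refine (hg.norm_secondOrder_le _ _).trans ?_
    have := mul_le_mul hs.zero_one h2 (l1_nonneg _) (by positivity)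
    linarith
  exact (norm_add_le _ _).trans (add_le_add h3 h4)

/-- The discrete rough integral along one solution, on a short interval. -/
theorem norm_rsum_le (hα : 1 / 3 < α) (hα' : α ≤ 1 / 2)
    (hg : CoefBound g γ c₁ c₂ c₃) (hs : SizeBound γ c₁ c₂ c₃ L) (hΔ : 0 < Δ)
    (hN : 0 ≤ N) (hw : IsHolderOn w N (n * Δ))
    (hy : ∀ k < n, y (k + 1) = y k + Δ • f (y k) + germ g w Δ y k (k + 1)) (hB0 : 0 ≤ B)
    (hB : ∀ k < n, ‖f (y k)‖ ≤ B) {e : ℝ} (he : e = L * (N * (n * Δ) ^ α))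
    (hes : 6 * e ≤ sewGap α) (j : ℕ) (hj : j ≤ n) :
    ‖rsum g w Δ y 0 j‖
      ≤ 2 * (1 + γ * (N * (n * Δ) ^ α)) + 6 / sewGap α * e * (B * (n * Δ)) := by
  have hq0 := sewGap_pos hα
  have hq1 := sewGap_le_one (α := α)
  have n0 := hg.nonneg₀
  have hL := hs.nonneg
  set η := N * (n * Δ) ^ α with hη
  have hη0 : 0 ≤ η := by positivity
  have he0 : 0 ≤ e := by rw [he]; positivity
  rcases Nat.eq_zero_or_pos j with rfl | hj0
  · simp only [rsum, Finset.Ico_self, Finset.sum_empty, norm_zero]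
    positivity
  have hn : 0 < n := by omega
  have hn' : (0 : ℝ) < n := by exact_mod_cast hn
  have hj' : (j : ℝ) ≤ n := by exact_mod_cast hj
  have h1 := norm_rsum_sub_germ_le hα hα' hg hs hΔ hn hN hw hy hB he hes 0 j hj0 hj
  have h2 := norm_germ_le hg hs hΔ hn hN (by linarith) hw y hj0.le hj
  rw [← he, ← hη] at h2
  rw [← hη] at h1
  set T := (n : ℝ) * Δ with hT
  have hT0 : 0 < T := by positivity
  have ha : (((j : ℝ) - (0 : ℕ)) / n) ^ (3 * α) ≤ 1 := by
    refine Real.rpow_le_one ?_ ?_ (by linarith)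
    · simp; positivity
    · rw [div_le_one hn']; simpa using hj'
  have h3 := h1.trans (mul_le_of_le_one_right (by positivity) ha)
  have h4 : rsum g w Δ y 0 j = (rsum g w Δ y 0 j - germ g w Δ y 0 j) + germ g w Δ y 0 j := by abel
  have h5 : 6 / sewGap α * e ≤ 1 := by
    rw [div_mul_eq_mul_div, div_le_one hq0]; exact hes
  have h6 := mul_le_mul_of_nonneg_right h5 (by positivity : 0 ≤ 1 + γ * η)
  have h7 : e ^ 2 ≤ 1 := by nlinarith
  rw [h4]
  refine (norm_add_le _ _).trans ((add_le_add h3 h2).trans ?_)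
  linarith

/-- This computation dictates the shape of L_g. L_g does not control γ itself, so the drift is
allowed size (1+γ)Y, and each 1+γ must be paid for by derivatives: c₂(1+γ) ≤ 2L, and (3c₁c₂ +
γc₃)(1+γ) ≤ 8L², which needs γ²c₃ ≤ L³. The result, of order e(1 + L_f + Y)M, is free of γ. -/
theorem sewing_budget_sub (hs : SizeBound γ c₁ c₂ c₃ L) (n0 : 0 ≤ γ) (n1 : 0 ≤ c₁) (n2 : 0 ≤ c₂)
    (n3 : 0 ≤ c₃) {η e q Y Lf M T K K' : ℝ} (hη0 : 0 ≤ η) (hY0 : 0 ≤ Y) (hLf0 : 0 ≤ Lf)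
    (hM0 : 0 ≤ M) (hT0 : 0 ≤ T) (hT1 : T ≤ 1) (he : e = L * η) (hes : 6 * e ≤ q) (hq1 : q ≤ 1)
    (hK : 0 ≤ K) (hK1 : K ≤ (1 + γ) * Y * T + 1 + γ * η) (hK' : 0 ≤ K')
    (hqK : q * K' = 100 * e * (1 + Lf + Y) * M) :
    η * (c₁ * (Lf * M + 2 * e ^ 2 * M + K')
          + c₂ * ((1 + γ) * Y * T + e ^ 2 + K) * (1 + c₁ * η) * M + c₂ * γ * c₁ * η ^ 2 * M
          + c₃ * γ ^ 2 * η ^ 2 * M)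
        + η ^ 2 * ((c₁ ^ 2 + γ * c₂) * (c₁ * η * M + (Lf * M + 2 * e ^ 2 * M + K'))
          + (3 * c₁ * c₂ + γ * c₃) * M * (γ * η + ((1 + γ) * Y * T + e ^ 2 + K))) ≤ q * K' := by
  have hL := hs.nonneg
  have hL1 := hs.le_one
  have he0 : 0 ≤ e := by rw [he]; positivity
  have he1 : e ≤ 1 := by linarith
  have he2 : e ^ 2 ≤ e := by nlinarith
  have he3 : e ^ 3 ≤ e := by
    have := mul_le_mul_of_nonneg_left he2 he0
    linarith
  have hB0 : 0 ≤ (1 + γ) * Y := by positivity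
  have p3 : η ^ 2 * (c₁ ^ 2 + γ * c₂) ≤ 2 * e ^ 2 := by
    have h1 : c₁ ^ 2 ≤ L ^ 2 := pow_le_pow_left₀ n1 hs.one 2
    have := mul_le_mul_of_nonneg_right (add_le_add h1 hs.zero_two) (by positivity : 0 ≤ η ^ 2)
    rw [he]; linarith
  set r := (1 + γ) * Y * T + e ^ 2 + K with hr
  have hr0 : 0 ≤ r := by positivity
  set R := Lf * M + 2 * e ^ 2 * M + K' with hR
  have hR0 : 0 ≤ R := by positivity
  have p1 : η * (c₁ * R) ≤ e * R := by
    have := mul_le_mul_of_nonneg_right hs.one (by positivity : 0 ≤ η * R)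
    rw [he]; linarith
  have hLL : L ^ 2 ≤ L := by nlinarith
  have hc2 : c₂ * (1 + γ) ≤ 2 * L := by linarith [hs.two, hs.zero_two]
  have hrB : r ≤ 2 * ((1 + γ) * (Y + 1)) + 2 * (γ * η) := by
    have h1 : (1 + γ) * Y * T ≤ (1 + γ) * Y := mul_le_of_le_one_right hB0 hT1
    have h2 : e ^ 2 ≤ 1 := he2.trans he1
    have h3 : 0 ≤ γ * η := by positivity
    rw [hr]
    linarith
  have p2a : η * (c₂ * r) ≤ 6 * e * (1 + Y) := by
    have h1 := mul_le_mul_of_nonneg_left hrB (by positivity : 0 ≤ η * c₂)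
    have h2 := mul_le_mul_of_nonneg_right hc2 (by positivity : 0 ≤ η * (Y + 1))
    have h3 := mul_le_mul_of_nonneg_right hs.zero_two (by positivity : 0 ≤ η ^ 2)
    have h4 : L ^ 2 * η ^ 2 = e ^ 2 := by rw [he]; ring
    have h5 : L * (η * (Y + 1)) = e * (1 + Y) := by rw [he]; ring
    have h6 : 0 ≤ e * Y := by positivity
    linarith
  have p2b : 1 + c₁ * η ≤ 2 := by
    have := mul_le_mul_of_nonneg_right hs.one hη0
    rw [← he] at this; linarith
  have p2 : η * (c₂ * r * (1 + c₁ * η) * M) ≤ 12 * e * (1 + Y) * M := by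
    have h1 := mul_le_mul p2a p2b (by positivity) (by positivity)
    have h2 := mul_le_mul_of_nonneg_right h1 hM0
    linarith
  have p4 : η * (c₂ * γ * c₁ * η ^ 2 * M) ≤ e * M := by
    have h1 := mul_le_mul hs.zero_two hs.one n1 (by positivity)
    have h2 := mul_le_mul_of_nonneg_right h1 (by positivity : 0 ≤ η ^ 3 * M)
    have h3 : L ^ 2 * L * (η ^ 3 * M) = e ^ 3 * M := by rw [he]; ring
    have h4 := mul_le_mul_of_nonneg_right he3 hM0
    linarith
  have p5 : η * (c₃ * γ ^ 2 * η ^ 2 * M) ≤ e * M := by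
    have h2 := mul_le_mul_of_nonneg_right hs.zero_zero_three (by positivity : 0 ≤ η ^ 3 * M)
    have h3 : L ^ 3 * (η ^ 3 * M) = e ^ 3 * M := by rw [he]; ring
    have h4 := mul_le_mul_of_nonneg_right he3 hM0
    linarith
  have p6a : c₁ * η ≤ e := by rw [he]; exact mul_le_mul_of_nonneg_right hs.one hη0
  have p6 : η ^ 2 * ((c₁ ^ 2 + γ * c₂) * (c₁ * η * M + R)) ≤ 2 * e * (M + R) := by
    have h0 : c₁ * η * M + R ≤ M + R := by
      have := mul_le_mul_of_nonneg_right (p6a.trans he1) hM0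
      linarith
    have h1 : η ^ 2 * (c₁ ^ 2 + γ * c₂) ≤ 2 * e := by linarith
    have h2 := mul_le_mul h1 h0 (by positivity) (by positivity)
    linarith
  have hc12 : c₁ * c₂ ≤ L ^ 2 := by
    have := mul_le_mul hs.one hs.two n2 hL
    linarith
  have hc12' : γ * (c₁ * c₂) ≤ L ^ 3 := by
    have := mul_le_mul hs.zero_one hs.two n2 (by positivity)
    linarith
  have hL3 : L ^ 3 ≤ L ^ 2 := pow_le_pow_of_le_one hL hL1 (by norm_num)
  have p7 : η ^ 2 * ((3 * c₁ * c₂ + γ * c₃) * M * (γ * η + r)) ≤ 28 * e * (1 + Y) * M := by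
    set b := 3 * c₁ * c₂ + γ * c₃ with hb
    have q0 : 0 ≤ b := by positivity
    have q1 : b * (1 + γ) ≤ 8 * L ^ 2 := by
      rw [hb]; linarith [hs.zero_three, hs.zero_zero_three]
    have q2 : b * γ ≤ 4 * L ^ 3 := by
      rw [hb]; linarith [hs.zero_zero_three]
    have h1 := mul_le_mul_of_nonneg_left hrB (by positivity : 0 ≤ η ^ 2 * b)
    have h2 := mul_le_mul_of_nonneg_right q1 (by positivity : 0 ≤ η ^ 2 * (Y + 1))
    have h3 := mul_le_mul_of_nonneg_right q2 (by positivity : 0 ≤ η ^ 3)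
    have h4 : L ^ 2 * (η ^ 2 * (Y + 1)) = e ^ 2 * (1 + Y) := by rw [he]; ring
    have h5 : L ^ 3 * η ^ 3 = e ^ 3 := by rw [he]; ring
    have h6 := mul_le_mul_of_nonneg_right he2 (by positivity : 0 ≤ 1 + Y)
    have h7 : 0 ≤ e * Y := by positivity
    have h8 : η ^ 2 * (b * (γ * η + r)) ≤ 28 * e * (1 + Y) := by linarith
    have h9 := mul_le_mul_of_nonneg_right h8 hM0
    linarith
  have p8 : 6 * e * K' ≤ q * K' := mul_le_mul_of_nonneg_right hes hK'
  have p9 : e * (e ^ 2 * M) ≤ e * M :=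
    mul_le_mul_of_nonneg_left (mul_le_of_le_one_left hM0 (he2.trans he1)) he0
  have p10 : 0 ≤ e * Lf * M := by positivity
  have p11 : 0 ≤ e * Y * M := by positivity
  have p12 : e * R = e * Lf * M + 2 * (e * (e ^ 2 * M)) + e * K' := by rw [hR]; ring
  linarith

/-- The discrete rough integral along the difference of two solutions, on a short interval. -/
theorem norm_rsum_sub_le (hα : 1 / 3 < α) (hα' : α ≤ 1 / 2)
    (hg : CoefBound g γ c₁ c₂ c₃) (hs : SizeBound γ c₁ c₂ c₃ L) (hΔ : 0 < Δ)
    (hT1 : n * Δ ≤ 1) (hN : 0 ≤ N) (hw : IsHolderOn w N (n * Δ))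
    (hy : ∀ k < n, y (k + 1) = y k + Δ • f (y k) + germ g w Δ y k (k + 1))
    (hu : ∀ k < n, u (k + 1) = u k + Δ • f (u k) + germ g w Δ u k (k + 1)) {Lf Y M : ℝ}
    (hLf0 : 0 ≤ Lf) (hLf : ∀ a b, ‖f a - f b‖ ≤ Lf * ‖a - b‖) (hY0 : 0 ≤ Y)
    (hB : ∀ k < n, ‖f (y k)‖ ≤ (1 + γ) * Y) (hM : ∀ k ≤ n, ‖u k - y k‖ ≤ M)
    {e : ℝ} (he : e = L * (N * (n * Δ) ^ α)) (hes : 6 * e ≤ sewGap α) (j : ℕ) (hj : j ≤ n) :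
    ‖rsum g w Δ u 0 j - rsum g w Δ y 0 j‖
      ≤ (3 + 100 / sewGap α) * e * (1 + Lf + Y) * M := by
  have hq0 := sewGap_pos hα
  have hq1 := sewGap_le_one (α := α)
  have n0 := hg.nonneg₀
  have n1 := hg.nonneg₁
  have n2 := hg.nonneg₂
  have n3 := hg.nonneg₃
  have hL := hs.nonneg
  have hL1 := hs.le_one
  have hM0 : 0 ≤ M := (norm_nonneg _).trans (hM 0 (Nat.zero_le n))
  set η := N * (n * Δ) ^ α with hη
  have hη0 : 0 ≤ η := by positivity
  have he0 : 0 ≤ e := by rw [he]; positivity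
  have he1 : e ≤ 1 := by linarith
  have he2 : e ^ 2 ≤ e := by nlinarith
  have he3 : e ^ 3 ≤ e := by nlinarith
  rcases Nat.eq_zero_or_pos j with rfl | hj0
  · simp only [rsum, Finset.Ico_self, Finset.sum_empty, sub_zero, norm_zero]
    positivity
  have hn : 0 < n := by omega
  have hn' : (0 : ℝ) < n := by exact_mod_cast hn
  set T := (n : ℝ) * Δ with hT
  have hT0 : 0 < T := by positivity
  set B := (1 + γ) * Y with hBdef
  have hB0 : 0 ≤ B := by positivity
  set K := 6 / sewGap α * e * (B * T + 1 + γ * η) with hKdef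
  have hK : 0 ≤ K := by positivity
  have hK1 : K ≤ B * T + 1 + γ * η := by
    have h5 : 6 / sewGap α * e ≤ 1 := by
      rw [div_mul_eq_mul_div, div_le_one hq0]; exact hes
    have := mul_le_mul_of_nonneg_right h5 (by positivity : 0 ≤ B * T + 1 + γ * η)
    rwa [one_mul] at this
  -- Only y needs a sewing bound of its own. The other solution enters through its distance to y, so
  -- the constant depends on the drift along y alone.
  have hJy : ∀ i j : ℕ, i < j → j ≤ n → _ :=
    norm_rsum_sub_germ_le hα hα' hg hs hΔ hn hN hw hy hB he hes
  rw [← hη, ← hKdef] at hJy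
  set K' := 100 / sewGap α * e * (1 + Lf + Y) * M with hK'def
  have hK' : 0 ≤ K' := by positivity
  have hqK : sewGap α * K' = 100 * e * (1 + Lf + Y) * M := by rw [hK'def]; field_simp
  set Ξ : ℕ → ℕ → Vec d := fun i j => germ g w Δ u i j - germ g w Δ y i j with hΞ
  have hsum : ∀ i j, ∑ l ∈ Finset.Ico i j, Ξ l (l + 1) = rsum g w Δ u i j - rsum g w Δ y i j :=
    fun i j => by simp [hΞ, rsum]
  have main : ∀ i j : ℕ, i < j → j ≤ n →
      ‖∑ l ∈ Finset.Ico i j, Ξ l (l + 1) - Ξ i j‖ ≤ K' * (((j : ℝ) - i) / n) ^ (3 * α) := by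
    refine discrete_sewing (by linarith : (1 : ℝ) ≤ 3 * α) hK' ?_
    intro i k j hik hkj hj hJ
    have hρ := remainder_bounds hα hα' hg hs hΔ hn hN hw hy hB hK hik hkj hj
      (hJy i k hik (by omega))
    have hik' : (i : ℝ) < k := by exact_mod_cast hik
    have hkj' : (k : ℝ) < j := by exact_mod_cast hkj
    have hi0 : (0 : ℝ) ≤ i := Nat.cast_nonneg i
    have hj' : (j : ℝ) ≤ n := by exact_mod_cast hj
    have hs0 : 0 ≤ ((j : ℝ) - i) / n := div_nonneg (by linarith) hn'.le
    have hs1 : ((j : ℝ) - i) / n ≤ 1 := by rw [div_le_one hn']; linarith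
    obtain ⟨a0, a1, a2, a3⟩ := frac_pow_bounds hα hα' hs0 hs1
    have hx1 := hw.grid hΔ hn hik.le (by omega : k ≤ n)
    have hx2 := hw.grid hΔ hn hkj.le hj
    have hsik : 0 ≤ ((k : ℝ) - i) / n := div_nonneg (by linarith) hn'.le
    have hsij : ((k : ℝ) - i) / n ≤ ((j : ℝ) - i) / n :=
      div_le_div_of_nonneg_right (by linarith) hn'.le
    obtain ⟨b0, b1, b2, b3⟩ := frac_pow_bounds hα hα' hsik (hsij.trans hs1)
    have m1 : (((k : ℝ) - i) / n) ^ α ≤ (((j : ℝ) - i) / n) ^ α :=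
      Real.rpow_le_rpow hsik hsij (by linarith)
    have m2 : (((j : ℝ) - k) / n) ^ α ≤ (((j : ℝ) - i) / n) ^ α :=
      Real.rpow_le_rpow (div_nonneg (by linarith) hn'.le)
        (div_le_div_of_nonneg_right (by linarith) hn'.le) (by linarith)
    have m20 : 0 ≤ (((j : ℝ) - k) / n) ^ α :=
      Real.rpow_nonneg (div_nonneg (by linarith) hn'.le) _
    set A := (((j : ℝ) - i) / n) ^ α with hA
    set A' := (((k : ℝ) - i) / n) ^ α with hA'
    have m3 : A' ^ 2 ≤ A ^ 2 := pow_le_pow_left₀ b0 m1 2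
    rw [← hη, ← he] at hρ
    set r := B * T + e ^ 2 + K with hr
    have hr0 : 0 ≤ r := by positivity
    have p3 : η ^ 2 * (c₁ ^ 2 + γ * c₂) ≤ 2 * e ^ 2 := by
      have h1 : c₁ ^ 2 ≤ L ^ 2 := pow_le_pow_left₀ n1 hs.one 2
      have := mul_le_mul_of_nonneg_right (add_le_add h1 hs.zero_two) (by positivity : 0 ≤ η ^ 2)
      rw [he]; linarith
    set R := Lf * M + 2 * e ^ 2 * M + K' with hR
    have hR0 : 0 ≤ R := by positivity
    have hσρ : ‖(u k - u i - g (u i) (lvl1 w (i * Δ) (k * Δ)))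
        - (y k - y i - g (y i) (lvl1 w (i * Δ) (k * Δ)))‖ ≤ R * A ^ 2 := by
      have e1 : (u k - u i - g (u i) (lvl1 w (i * Δ) (k * Δ)))
          - (y k - y i - g (y i) (lvl1 w (i * Δ) (k * Δ)))
          = Δ • ∑ l ∈ Finset.Ico i k, (f (u l) - f (y l))
            + (secondOrder g (u i) (lvl2 w (i * Δ) (k * Δ))
              - secondOrder g (y i) (lvl2 w (i * Δ) (k * Δ)))
            + (∑ l ∈ Finset.Ico i k, Ξ l (l + 1) - Ξ i k) := by
        rw [telescope hu i k hik.le (by omega), telescope hy i k hik.le (by omega), hsum, hΞ,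
          Finset.sum_sub_distrib, smul_sub]
        simp only [germ]
        abel
      have q1 := norm_drift_le (B := Lf * M) (p := fun l => f (u l) - f (y l)) hΔ hn (fun l hl =>
        (hLf _ _).trans (mul_le_mul_of_nonneg_left (hM l hl.le) hLf0)) hik.le (by omega : k ≤ n)
      have q2 : Lf * M * T * (((k : ℝ) - i) / n) ≤ Lf * M * A' ^ 2 := by
        have h1 : Lf * M * T ≤ Lf * M := mul_le_of_le_one_right (by positivity) hT1
        exact mul_le_mul h1 b2 hsik (by positivity)
      have q3 : ‖secondOrder g (u i) (lvl2 w (i * Δ) (k * Δ))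
          - secondOrder g (y i) (lvl2 w (i * Δ) (k * Δ))‖ ≤ 2 * e ^ 2 * M * A' ^ 2 := by
        refine (hg.norm_secondOrder_sub_le _ _ _).trans ?_
        have h1 : (c₁ ^ 2 + γ * c₂) * ‖u i - y i‖ ≤ (c₁ ^ 2 + γ * c₂) * M :=
          mul_le_mul_of_nonneg_left (hM i (by omega)) (by positivity)
        have h2 := mul_le_mul h1 hx1.2 (l1_nonneg _) (by positivity)
        have h3 := mul_le_mul_of_nonneg_right p3 (by positivity : 0 ≤ M * A' ^ 2)
        rw [← hη] at h2
        linarith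
      have q4 : K' * (((k : ℝ) - i) / n) ^ (3 * α) ≤ K' * A' ^ 2 := by
        rw [b3]
        exact mul_le_mul_of_nonneg_left (pow_le_pow_of_le_one b0 b1 (by norm_num)) hK'
      rw [e1]
      calc _ ≤ _ := norm_add₃_le.trans (add_le_add (add_le_add (q1.trans q2) q3) (hJ.trans q4))
        _ = R * A' ^ 2 := by rw [hR]; ring
        _ ≤ _ := mul_le_mul_of_nonneg_left m3 hR0
    have e1 : ∀ v : ℕ → Vec d, v i + g (v i) (lvl1 w (i * Δ) (k * Δ))
      + (v k - v i - g (v i) (lvl1 w (i * Δ) (k * Δ))) = v k := fun v => by abel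
    have key := hg.norm_defect_sub_le (y := y i) (z := u i)
      (ρ := y k - y i - g (y i) (lvl1 w (i * Δ) (k * Δ)))
      (σ := u k - u i - g (u i) (lvl1 w (i * Δ) (k * Δ))) hη0 a0 a1 hr0 hR0
      (hx1.1.trans (mul_le_mul_of_nonneg_left m1 hη0))
      (hx2.1.trans (mul_le_mul_of_nonneg_left m2 hη0))
      (hx2.2.trans (mul_le_mul_of_nonneg_left (pow_le_pow_left₀ m20 m2 2) (by positivity))) hρ
      hσρ (hM i (by omega)) (by rw [e1, e1]; exact hM k (by omega))
    rw [e1, e1] at key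
    have e2 : Ξ i j - Ξ i k - Ξ k j
        = -(defect g (u i) (u k) (lvl1 w (i * Δ) (k * Δ)) (lvl1 w (k * Δ) (j * Δ))
          (lvl2 w (k * Δ) (j * Δ))
          - defect g (y i) (y k) (lvl1 w (i * Δ) (k * Δ)) (lvl1 w (k * Δ) (j * Δ))
          (lvl2 w (k * Δ) (j * Δ))) := by
      rw [neg_sub, ← sub_eq_zero]
      have h1 := germ_sub_sub g w Δ u i k j
      have h2 := germ_sub_sub g w Δ y i k j
      rw [eq_neg_iff_add_eq_zero] at h1 h2
      have : ∀ a b c a' b' c' D D' : Vec d, a - b - c + D = 0 → a' - b' - c' + D' = 0 →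
          (a - a') - (b - b') - (c - c') - (D' - D) = 0 := by
        intro a b c a' b' c' D D' h h'
        have : (a - a') - (b - b') - (c - c') - (D' - D)
          = (a - b - c + D) - (a' - b' - c' + D') := by abel
        rw [this, h, h', sub_zero]
      exact this _ _ _ _ _ _ _ _ h1 h2
    rw [e2, norm_neg, a3]
    refine key.trans (mul_le_mul_of_nonneg_right ?_ (by positivity))
    change _ ≤ sewGap α * K'
    exact sewing_budget_sub hs n0 n1 n2 n3 hη0 hY0 hLf0 hM0 hT0.le hT1 he hes hq1 hK hK1 hK' hqK
  have h1 := main 0 j hj0 hj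
  have hj' : (j : ℝ) ≤ n := by exact_mod_cast hj
  have ha : (((j : ℝ) - (0 : ℕ)) / n) ^ (3 * α) ≤ 1 := by
    refine Real.rpow_le_one ?_ ?_ (by linarith)
    · simp; positivity
    · rw [div_le_one hn']; simpa using hj'
  have h2 := h1.trans (mul_le_of_le_one_right hK' ha)
  have hx := hw.grid hΔ hn hj0.le hj
  have hs0 : 0 ≤ ((j : ℝ) - (0 : ℕ)) / n := by simp; positivity
  have a0 : 0 ≤ (((j : ℝ) - (0 : ℕ)) / n) ^ α := by positivity
  have a1 : (((j : ℝ) - (0 : ℕ)) / n) ^ α ≤ 1 :=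
    Real.rpow_le_one hs0 (by rw [div_le_one hn']; simpa using hj') (by linarith)
  have h3 : ‖Ξ 0 j‖ ≤ e * M + 2 * e ^ 2 * M := by
    have e3 : Ξ 0 j = (g (u 0) - g (y 0)) (lvl1 w ((0 : ℕ) * Δ) (j * Δ))
        + (secondOrder g (u 0) (lvl2 w ((0 : ℕ) * Δ) (j * Δ))
          - secondOrder g (y 0) (lvl2 w ((0 : ℕ) * Δ) (j * Δ))) := by
      simp only [hΞ, germ, _root_.sub_apply]; abel
    have q1 : ‖g (u 0) - g (y 0)‖ ≤ L * M :=
      (hg.norm_sub_le _ _).trans (mul_le_mul hs.one (hM 0 (Nat.zero_le _)) (norm_nonneg _) hL)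
    have q2 := (g (u 0) - g (y 0)).le_of_opNorm_le q1 (lvl1 w ((0 : ℕ) * Δ) (j * Δ))
    have q3 : ‖lvl1 w ((0 : ℕ) * Δ) (j * Δ)‖ ≤ η := hx.1.trans (mul_le_of_le_one_right hη0 a1)
    have q4 : l1 (lvl2 w ((0 : ℕ) * Δ) (j * Δ)) ≤ η ^ 2 :=
      hx.2.trans (mul_le_of_le_one_right (by positivity) (pow_le_one₀ a0 a1))
    have q5 := mul_le_mul_of_nonneg_left q3 (by positivity : 0 ≤ L * M)
    have q6 := hg.norm_secondOrder_sub_le (u 0) (y 0) (lvl2 w ((0 : ℕ) * Δ) (j * Δ))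
    have q7 : (c₁ ^ 2 + γ * c₂) * ‖u 0 - y 0‖ ≤ 2 * L ^ 2 * M := by
      have h1 : c₁ ^ 2 ≤ L ^ 2 := pow_le_pow_left₀ n1 hs.one 2
      exact mul_le_mul (by linarith [hs.zero_two]) (hM 0 (Nat.zero_le _)) (norm_nonneg _)
        (by positivity)
    have q8 := mul_le_mul q7 q4 (l1_nonneg _) (by positivity)
    rw [e3]
    refine (norm_add_le _ _).trans ((add_le_add (q2.trans q5) (q6.trans q8)).trans (le_of_eq ?_))
    rw [he]; ring
  have h4 : rsum g w Δ u 0 j - rsum g w Δ y 0 j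
      = (∑ l ∈ Finset.Ico 0 j, Ξ l (l + 1) - Ξ 0 j) + Ξ 0 j := by rw [hsum]; abel
  rw [h4]
  refine (norm_add_le _ _).trans ((add_le_add h2 h3).trans ?_)
  have h5 := mul_le_mul_of_nonneg_right he2 hM0
  have h6 : 0 ≤ e * (Lf + Y) * M := by positivity
  have h7 : (3 + 100 / sewGap α) * e * (1 + Lf + Y) * M
      = 3 * (e * M) + 3 * (e * (Lf + Y) * M) + K' := by rw [hK'def]; ring
  linarith

end Pieces

/-! ### From iterated derivatives to finite differences. -/

section Smooth

variable {E F : Type*} [NormedAddCommGroup E] [NormedSpace ℝ E] [NormedAddCommGroup F]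
  [NormedSpace ℝ F] {φ : E → F} {c₂ c₃ : ℝ}

theorem norm_fderiv_sub_le_of_contDiff (h : ContDiff ℝ 2 φ)
    (h₂ : ∀ y, ‖iteratedFDeriv ℝ 2 φ y‖ ≤ c₂) (x y : E) :
    ‖fderiv ℝ φ x - fderiv ℝ φ y‖ ≤ c₂ * ‖x - y‖ := by
  have h1 : ContDiff ℝ 1 (fderiv ℝ φ) := h.fderiv_right (by norm_num)
  refine norm_sub_le_of_hasFDerivAt (φ' := fderiv ℝ (fderiv ℝ φ))
    (fun z => (h1.differentiable (by norm_num) z).hasFDerivAt) (fun z => ?_) y x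
  have := h₂ z
  rwa [← norm_iteratedFDeriv_fderiv, norm_iteratedFDeriv_one] at this

theorem norm_fderiv_rect_le_of_contDiff (h : ContDiff ℝ 3 φ)
    (h₂ : ∀ y, ‖iteratedFDeriv ℝ 2 φ y‖ ≤ c₂) (h₃ : ∀ y, ‖iteratedFDeriv ℝ 3 φ y‖ ≤ c₃)
    (x x' p p' : E) :
    ‖fderiv ℝ φ (x' + p') - fderiv ℝ φ x' - (fderiv ℝ φ (x + p) - fderiv ℝ φ x)‖
      ≤ c₂ * ‖p' - p‖ + c₃ * ‖x' - x‖ * ‖p‖ := by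
  have h1 : ContDiff ℝ 2 (fderiv ℝ φ) := h.fderiv_right (by norm_num)
  refine norm_rect_le (φ' := fderiv ℝ (fderiv ℝ φ))
    (fun z => (h1.differentiable (by norm_num) z).hasFDerivAt) (fun z => ?_)
    (norm_fderiv_sub_le_of_contDiff h1 fun z => ?_) x x' p p'
  · have := h₂ z
    rwa [← norm_iteratedFDeriv_fderiv, norm_iteratedFDeriv_one] at this
  · rw [norm_iteratedFDeriv_fderiv]; exact h₃ z

end Smooth

/-! ### The bounds encoded in `IsC3b` and `Lg`. -/

section Coefficients

variable {d m : ℕ} {g : Vec d → (Vec m →L[ℝ] Vec d)}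

theorem IsC3b.norm_iteratedFDeriv_le (hg : IsC3b g) {k : ℕ} (hk : k ≤ 3) (y : Vec d) :
    ‖iteratedFDeriv ℝ k g y‖ ≤ supD k g := le_ciSup (hg.2 k hk) y

theorem supD_nonneg (k : ℕ) (g : Vec d → (Vec m →L[ℝ] Vec d)) : 0 ≤ supD k g :=
  Real.iSup_nonneg fun _ => norm_nonneg _

theorem IsC3b.coefBound (hg : IsC3b g) :
    CoefBound g (supD 0 g) (supD 1 g) (supD 2 g) (supD 3 g) where
  hasFDerivAt y := (hg.1.differentiable (by norm_num) y).hasFDerivAt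
  norm_le y := by simpa using hg.norm_iteratedFDeriv_le (Nat.zero_le 3) y
  norm_fderiv_le y := by
    rw [← norm_iteratedFDeriv_one]; exact hg.norm_iteratedFDeriv_le (by norm_num) y
  norm_fderiv_sub_le := norm_fderiv_sub_le_of_contDiff (hg.1.of_le (by norm_num))
    (hg.norm_iteratedFDeriv_le (by norm_num))
  norm_fderiv_rect_le := norm_fderiv_rect_le_of_contDiff hg.1
    (hg.norm_iteratedFDeriv_le (by norm_num)) (hg.norm_iteratedFDeriv_le le_rfl)
  nonneg₂ := supD_nonneg 2 g
  nonneg₃ := supD_nonneg 3 g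

theorem sizeBound_Lg (g : Vec d → (Vec m →L[ℝ] Vec d)) (h : Lg g ≤ 1) :
    SizeBound (supD 0 g) (supD 1 g) (supD 2 g) (supD 3 g) (Lg g) := by
  have n0 := supD_nonneg 0 g
  have n3 := supD_nonneg 3 g
  have h1 : supD 1 g ≤ Lg g := (le_max_left _ _).trans (le_max_left _ _)
  have h0 : 0 ≤ Lg g := (supD_nonneg 1 g).trans h1
  have h2 : supD 0 g * max (supD 1 g) (max (supD 2 g) (supD 3 g)) ≤ Lg g ^ 2 :=
    (Real.sqrt_le_left h0).mp ((le_max_left _ _).trans (le_max_right _ _))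
  have h3 : (supD 0 g ^ 2 * supD 3 g) ^ ((1 : ℝ) / 3) ≤ Lg g :=
    (le_max_right _ _).trans (le_max_right _ _)
  refine ⟨h0, h, h1, (le_max_right _ _).trans (le_max_left _ _), ?_, ?_, ?_, ?_⟩
  · exact (mul_le_mul_of_nonneg_left (le_max_left _ _) n0).trans h2
  · exact (mul_le_mul_of_nonneg_left ((le_max_left _ _).trans (le_max_right _ _)) n0).trans h2
  · exact (mul_le_mul_of_nonneg_left ((le_max_right _ _).trans (le_max_right _ _)) n0).trans h2
  · have h4 := pow_le_pow_left₀ (by positivity) h3 3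
    rwa [← Real.rpow_natCast (_ ^ ((1 : ℝ) / 3)), ← Real.rpow_mul (by positivity), Nat.cast_ofNat,
      div_mul_cancel₀ _ (by norm_num), Real.rpow_one] at h4

end Coefficients

/-! ### Cocycle property and assumptions on the drift. -/

section Flow

variable {d m : ℕ} {α : ℝ} {f : Vec d → Vec d} {g : Vec d → (Vec m →L[ℝ] Vec d)} {Δ : ℝ}

theorem euler_succ (k : ℕ) (w : PathSpace m α) (y : Vec d) :
    euler f g Δ (k + 1) w y = euler f g Δ k w y + Δ • f (euler f g Δ k w y)
      + germ g w Δ (fun k => euler f g Δ k w y) k (k + 1) := by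
  rw [euler, germ, Nat.cast_succ, add_assoc]

theorem euler_add (p q : ℕ) (w : PathSpace m α) (y : Vec d) :
    euler f g Δ (p + q) w y = euler f g Δ q (shift (p * Δ) w) (euler f g Δ p w y) := by
  induction q with
  | zero => rfl
  | succ q ih =>
    have e1 : ((p + q : ℕ) : ℝ) * Δ = p * Δ + q * Δ := by push_cast; ring
    have e2 : (((p + q : ℕ) : ℝ) + 1) * Δ = p * Δ + (q + 1) * Δ := by push_cast; ring
    rw [← add_assoc, euler, ih, euler, lvl1_shift, lvl2_shift, e1, e2]

/-- A Lipschitz and strictly dissipative drift. -/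
structure DriftBound (f : Vec d → Vec d) (D Lf : ℝ) : Prop where
  pos : 0 < D
  nonneg : 0 ≤ Lf
  lipschitz : ∀ x y, ‖f x - f y‖ ≤ Lf * ‖x - y‖
  dissipative : ∀ x y, inner ℝ (x - y) (f x - f y) ≤ -D * ‖x - y‖ ^ 2

theorem DriftBound.norm_le {D Lf : ℝ} (hf : DriftBound f D Lf) (x : Vec d) :
    ‖f x‖ ≤ ‖f 0‖ + Lf * ‖x‖ := by
  have := hf.lipschitz x 0
  rw [sub_zero] at this
  linarith [norm_le_norm_add_norm_sub' (f x) (f 0)]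

/-- The step sizes for which the drift part of the scheme contracts. -/
structure StepBound (Δ D Lf : ℝ) : Prop where
  pos : 0 < Δ
  lip : Δ * Lf ^ 2 ≤ D
  diss : Δ * D ≤ 4

end Flow

/-! ### Contraction of two solutions over one block. -/

section Contraction

variable {d m : ℕ} {α : ℝ} {f : Vec d → Vec d} {g : Vec d → (Vec m →L[ℝ] Vec d)}
  {Δ D Lf γ c₁ c₂ c₃ L N Y : ℝ} {w : PathSpace m α} {n : ℕ}

theorem IsHolderOn.mono {τ τ' : ℝ} (h : IsHolderOn w N τ) (hτ : τ' ≤ τ) : IsHolderOn w N τ' :=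
  fun s t hs hst ht => h s t hs hst (ht.trans hτ)

theorem euler_eq_add_rsum (w : PathSpace m α) (y : Vec d) (i : ℕ) :
    euler f g Δ (i + 1) w y = euler f g Δ i w y + Δ • f (euler f g Δ i w y)
      + (rsum g w Δ (fun k => euler f g Δ k w y) 0 (i + 1)
        - rsum g w Δ (fun k => euler f g Δ k w y) 0 i) := by
  rw [rsum, rsum, Finset.sum_Ico_succ_top (Nat.zero_le i), add_sub_cancel_left, euler_succ]

theorem norm_euler_sub_le_of_rsum (hf : DriftBound f D Lf) (hΔ : StepBound Δ D Lf) {σ : ℝ}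
    (y u : Vec d)
    (h : ∀ j ≤ n, ‖rsum g w Δ (fun k => euler f g Δ k w u) 0 j
      - rsum g w Δ (fun k => euler f g Δ k w y) 0 j‖ ≤ σ) (k : ℕ) (hk : k ≤ n) :
    ‖euler f g Δ k w u - euler f g Δ k w y‖
      ≤ Real.exp (-(D / 8) * (k * Δ)) * ‖u - y‖ + (3 + 3 * (Lf / D)) * σ := by
  refine norm_le_of_dissipative hf.pos hf.nonneg hΔ.pos hΔ.lip hΔ.diss
    (w := fun k => euler f g Δ k w u - euler f g Δ k w y)
    (p := fun k => f (euler f g Δ k w u) - f (euler f g Δ k w y))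
    (s := fun j => rsum g w Δ (fun k => euler f g Δ k w u) 0 j
      - rsum g w Δ (fun k => euler f g Δ k w y) 0 j)
    (by simp [rsum]) h (fun i _ => ?_) (fun i _ => hf.dissipative _ _)
    (fun i _ => hf.lipschitz _ _) k hk
  simp only [euler_eq_add_rsum, smul_sub]
  abel

/-- Moves an additive error into the exponent, so that the factors of successive pieces can be
multiplied. -/
theorem exp_add_le {a b C : ℝ} (ha : a ≤ C) (hb : 0 ≤ b) :
    Real.exp (-a) + b ≤ Real.exp (-a + Real.exp C * b) := by
  have h1 : b ≤ Real.exp (-a) * (Real.exp C * b) := by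
    rw [← mul_assoc, ← Real.exp_add]
    exact le_mul_of_one_le_left hb (Real.one_le_exp (by linarith))
  have h2 := Real.add_one_le_exp (Real.exp C * b)
  have h3 := mul_le_mul_of_nonneg_left h2 (Real.exp_pos (-a)).le
  rw [Real.exp_add]
  linarith

/-- Let M be the maximal distance on the piece. The sewing bound makes the perturbation at most
A·E·M, and since κAE ≤ 1/2 the dissipative estimate yields M ≤ 2‖u − y‖. Inserting this at the
endpoint gives the factor exp(−DT/8) + 2κAE. -/
theorem norm_euler_sub_le_of_small (hα : 1 / 3 < α) (hα' : α ≤ 1 / 2) (hf : DriftBound f D Lf)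
    (hΔ : StepBound Δ D Lf) (hg : CoefBound g γ c₁ c₂ c₃) (hs : SizeBound γ c₁ c₂ c₃ L)
    (hT1 : n * Δ ≤ 1) (hN : 0 ≤ N) (hw : IsHolderOn w N (n * Δ)) (hY : 0 ≤ Y) (y u : Vec d)
    (hB : ∀ k < n, ‖f (euler f g Δ k w y)‖ ≤ (1 + γ) * Y)
    (h1 : 6 * (L * N * (1 + Lf + Y) * (n * Δ) ^ α) ≤ sewGap α)
    (h2 : 2 * ((3 + 3 * (Lf / D)) * (3 + 100 / sewGap α))
      * (L * N * (1 + Lf + Y) * (n * Δ) ^ α) ≤ 1) :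
    ‖euler f g Δ n w u - euler f g Δ n w y‖
      ≤ Real.exp (-(D / 8 * (n * Δ)) + Real.exp (D / 8) *
        (2 * ((3 + 3 * (Lf / D)) * (3 + 100 / sewGap α)) * (L * N * (1 + Lf + Y) * (n * Δ) ^ α)))
        * ‖u - y‖ := by
  have hq0 := sewGap_pos hα
  have hD := hf.pos
  have hL := hs.nonneg
  have hLf := hf.nonneg
  have hΔ0 := hΔ.pos
  set E := L * N * (1 + Lf + Y) * (n * Δ) ^ α with hE
  set κ := 3 + 3 * (Lf / D) with hκ
  set A := 3 + 100 / sewGap α with hA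
  have hκ0 : 0 ≤ κ := by positivity
  have hA0 : 0 ≤ A := by positivity
  set e := L * (N * (n * Δ) ^ α) with he
  have he0 : 0 ≤ e := by positivity
  have hEe : E = e * (1 + Lf + Y) := by rw [hE, he]; ring
  have hE0 : 0 ≤ E := by positivity
  have heE : e ≤ E := by
    rw [hEe]; exact le_mul_of_one_le_right he0 (by linarith)
  obtain ⟨l, hl, hlmax⟩ := Finset.exists_max_image (Finset.range (n + 1))
    (fun k => ‖euler f g Δ k w u - euler f g Δ k w y‖) ⟨0, by simp⟩
  set M := ‖euler f g Δ l w u - euler f g Δ l w y‖ with hM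
  have hM0 : 0 ≤ M := norm_nonneg _
  have hr := norm_rsum_sub_le (y := fun k => euler f g Δ k w y) (u := fun k => euler f g Δ k w u)
    hα hα' hg hs hΔ.pos hT1 hN hw (fun k _ => euler_succ k w y) (fun k _ => euler_succ k w u)
    hf.nonneg hf.lipschitz hY hB (M := M) (fun k hk => hlmax k (by simpa using by omega)) he
    (by linarith)
  have hb := norm_euler_sub_le_of_rsum hf hΔ y u hr
  have hσ : A * e * (1 + Lf + Y) * M = A * E * M := by rw [hEe]; ring
  rw [hσ] at hb
  have hMM : M ≤ 2 * ‖u - y‖ := by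
    have h3 := hb l (by have := Finset.mem_range.mp hl; omega)
    have h4 : Real.exp (-(D / 8) * (l * Δ)) * ‖u - y‖ ≤ ‖u - y‖ :=
      mul_le_of_le_one_left (norm_nonneg _) (Real.exp_le_one_iff.mpr
        (mul_nonpos_of_nonpos_of_nonneg (by linarith) (by positivity)))
    have h5 := mul_le_mul_of_nonneg_right h2 hM0
    rw [← hM] at h3
    linarith
  have h3 := hb n le_rfl
  have h4 : κ * (A * E * M) ≤ 2 * (κ * A) * E * ‖u - y‖ := by
    have := mul_le_mul_of_nonneg_left hMM (by positivity : 0 ≤ κ * A * E)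
    linarith
  have h5 := exp_add_le (a := D / 8 * (n * Δ)) (b := 2 * (κ * A) * E) (C := D / 8)
    (mul_le_of_le_one_right (by positivity) hT1) (by positivity)
  have h6 := mul_le_mul_of_nonneg_right h5 (norm_nonneg (u - y))
  rw [neg_mul] at h3
  linarith

/-- Covers a single step that is not small but cannot be subdivided. The germ is then exact and no
sewing is needed, so no smallness of e is required; the price is the quadratic term. -/
theorem norm_euler_one_sub_le (hf : DriftBound f D Lf)
    (hΔ : StepBound Δ D Lf) (hg : CoefBound g γ c₁ c₂ c₃) (hs : SizeBound γ c₁ c₂ c₃ L)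
    (hT1 : Δ ≤ 1) (hN : 0 ≤ N) (hw : IsHolderOn w N Δ) (y u : Vec d) {e : ℝ}
    (he : L * N * Δ ^ α ≤ e) :
    ‖euler f g Δ 1 w u - euler f g Δ 1 w y‖
      ≤ Real.exp (-(D / 8 * Δ) + Real.exp (D / 8) *
        ((3 + 3 * (Lf / D)) * (e + 2 * e ^ 2))) * ‖u - y‖ := by
  have hD := hf.pos
  have hL := hs.nonneg
  have hLf := hf.nonneg
  have hΔ0 := hΔ.pos
  have n0 := hg.nonneg₀
  have n1 := hg.nonneg₁
  have n2 := hg.nonneg₂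
  set κ := 3 + 3 * (Lf / D) with hκ
  have hκ0 : 0 ≤ κ := by positivity
  have he0 : 0 ≤ L * N * Δ ^ α := by positivity
  have hx := hw 0 Δ le_rfl hΔ0.le le_rfl
  rw [sub_zero] at hx
  have hx2 : N ^ 2 * Δ ^ (2 * α) = (N * Δ ^ α) ^ 2 := by
    rw [mul_comm 2 α, Real.rpow_mul hΔ0.le, Real.rpow_two]; ring
  have hr : ∀ j ≤ 1, ‖rsum g w Δ (fun k => euler f g Δ k w u) 0 j
      - rsum g w Δ (fun k => euler f g Δ k w y) 0 j‖ ≤ (e + 2 * e ^ 2) * ‖u - y‖ := by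
    intro j hj
    interval_cases j
    · simp only [rsum, Finset.Ico_self, Finset.sum_empty, sub_zero, norm_zero]
      have : 0 ≤ e := he0.trans he
      positivity
    · have e3 : rsum g w Δ (fun k => euler f g Δ k w u) 0 1
          - rsum g w Δ (fun k => euler f g Δ k w y) 0 1 = (g u - g y) (lvl1 w 0 Δ)
          + (secondOrder g u (lvl2 w 0 Δ) - secondOrder g y (lvl2 w 0 Δ)) := by
        simp [rsum, germ, euler]; abel
      have q1 : ‖g u - g y‖ ≤ L * ‖u - y‖ :=
        (hg.norm_sub_le _ _).trans (mul_le_mul_of_nonneg_right hs.one (norm_nonneg _))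
      have q2 := (g u - g y).le_of_opNorm_le q1 (lvl1 w 0 Δ)
      have q5 := mul_le_mul_of_nonneg_left hx.1 (by positivity : 0 ≤ L * ‖u - y‖)
      have q6 := hg.norm_secondOrder_sub_le u y (lvl2 w 0 Δ)
      have q7 : (c₁ ^ 2 + γ * c₂) * ‖u - y‖ ≤ 2 * L ^ 2 * ‖u - y‖ := by
        have h1 : c₁ ^ 2 ≤ L ^ 2 := pow_le_pow_left₀ n1 hs.one 2
        exact mul_le_mul_of_nonneg_right (by linarith [hs.zero_two]) (norm_nonneg _)
      have q8 := mul_le_mul q7 hx.2 (l1_nonneg _) (by positivity)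
      have q9 := mul_le_mul_of_nonneg_right he (norm_nonneg (u - y))
      have q10 := mul_le_mul_of_nonneg_right (pow_le_pow_left₀ he0 he 2) (norm_nonneg (u - y))
      rw [hx2] at q8
      rw [e3]
      refine (norm_add_le _ _).trans ((add_le_add (q2.trans q5) (q6.trans q8)).trans ?_)
      linarith
  have h3 := norm_euler_sub_le_of_rsum hf hΔ y u hr 1 le_rfl
  have he' : 0 ≤ e := he0.trans he
  have h5 := exp_add_le (a := D / 8 * Δ) (b := κ * (e + 2 * e ^ 2)) (C := D / 8)
    (mul_le_of_le_one_right (by positivity) hT1) (by positivity)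
  have h6 := mul_le_mul_of_nonneg_right h5 (norm_nonneg (u - y))
  rw [neg_mul, Nat.cast_one, one_mul, ← hκ] at h3
  linarith

theorem rpow_le_three_mul {a b α : ℝ} (ha : 0 ≤ a) (hb : 0 ≤ b) (hab : b ≤ 3 * a) (hα : 0 < α)
    (hα' : α ≤ 1) : b ^ α ≤ 3 * a ^ α := by
  calc b ^ α ≤ (3 * a) ^ α := Real.rpow_le_rpow hb hab hα.le
    _ = 3 ^ α * a ^ α := Real.mul_rpow (by norm_num) ha
    _ ≤ 3 ^ (1 : ℝ) * a ^ α := mul_le_mul_of_nonneg_right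
      (Real.rpow_le_rpow_of_exponent_le (by norm_num) hα') (by positivity)
    _ = 3 * a ^ α := by rw [Real.rpow_one]

/-- Since 3α > 1, the cube of a local error of order T^α is at most of order T, hence additive over
pieces. -/
theorem rpow_pow_three_le {T α : ℝ} (hα : 1 / 3 < α) (hT0 : 0 ≤ T) (hT1 : T ≤ 1) :
    (T ^ α) ^ 3 ≤ T := by
  have h : (T ^ α) ^ 3 = T ^ (α * 3) := by
    rw [Real.rpow_mul hT0]; exact_mod_cast (Real.rpow_natCast (T ^ α) 3).symm
  rw [h]
  rcases hT0.eq_or_lt with rfl | h0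
  · rw [Real.zero_rpow (by linarith)]
  · calc T ^ (α * 3) ≤ T ^ (1 : ℝ) := Real.rpow_le_rpow_of_exponent_ge h0 hT1 (by linarith)
      _ = T := Real.rpow_one T

/-- A property of numbers of steps that holds for pieces that are short, or consist of one step,
and passes to sums, holds for all pieces that are not too short. -/
theorem halving_induction {u ε α Δ : ℝ} (hα : 0 < α) (hα' : α ≤ 1) (hu : 0 ≤ u) (hΔ : 0 < Δ)
    (hε : 0 < ε) {p : ℕ → Prop} (small : ∀ n : ℕ, ε / 3 ≤ u * (n * Δ) ^ α →
      u * (n * Δ) ^ α ≤ ε → p n) (one : ε / 3 ≤ u * ((1 : ℕ) * Δ) ^ α → p 1)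
    (add : ∀ i j, p i → p j → p (i + j)) (n : ℕ) (hn : ε / 3 ≤ u * (n * Δ) ^ α) : p n := by
  induction n using Nat.strong_induction_on with
  | _ n ih =>
  rcases le_or_gt (u * (n * Δ) ^ α) ε with h | h
  · exact small n hn h
  rcases Nat.lt_or_ge n 2 with h2 | h2
  · interval_cases n
    · simp [Real.zero_rpow hα.ne'] at hn; linarith
    · exact one hn
  -- For n ≥ 2 both halves have at least n/3 steps. As α ≤ 1, the quantity u(jΔ)^α is then at least
  -- a third of its previous value, which exceeded ε.
  have key : ∀ j : ℕ, n ≤ 3 * j → ε / 3 ≤ u * (j * Δ) ^ α := by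
    intro j hj
    have h1 : (n : ℝ) ≤ 3 * j := by exact_mod_cast hj
    have h3 := rpow_le_three_mul (a := j * Δ) (b := n * Δ) (by positivity) (by positivity)
      (by have := mul_le_mul_of_nonneg_right h1 hΔ.le; linarith) hα hα'
    have := mul_le_mul_of_nonneg_left h3 hu
    linarith
  have e : n / 2 + (n - n / 2) = n := by omega
  rw [← e]
  exact add _ _ (ih _ (by omega) (key _ (by omega))) (ih _ (by omega) (key _ (by omega)))

/-- Contraction over a block of length at most one. -/
theorem exists_norm_euler_sub_le (hα : 1 / 3 < α) (hα' : α ≤ 1 / 2) (hD : 0 < D) (hLf : 0 ≤ Lf) :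
    ∃ C : ℝ, 0 ≤ C ∧ ∀ {d m : ℕ} {f : Vec d → Vec d} {g : Vec d → (Vec m →L[ℝ] Vec d)}
      {Δ γ c₁ c₂ c₃ L N Y : ℝ}, DriftBound f D Lf → StepBound Δ D Lf → CoefBound g γ c₁ c₂ c₃ →
      SizeBound γ c₁ c₂ c₃ L → 0 ≤ N → 0 ≤ Y → ∀ (n : ℕ) (w : PathSpace m α), n * Δ ≤ 1 →
      IsHolderOn w N (n * Δ) → ∀ y u : Vec d,
      (∀ k < n, ‖f (euler f g Δ k w y)‖ ≤ (1 + γ) * Y) →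
      ‖euler f g Δ n w u - euler f g Δ n w y‖ ≤ Real.exp (-(D / 8 * (n * Δ))
        + C * (L * N * (1 + Lf + Y) + (L * N * (1 + Lf + Y)) ^ 3)) * ‖u - y‖ := by
  have hq0 := sewGap_pos hα
  set κ := 3 + 3 * (Lf / D) with hκ
  set A := 3 + 100 / sewGap α with hA
  have hκ0 : 0 < κ := by positivity
  have hA0 : 0 < A := by positivity
  set ε := min (sewGap α / 6) (1 / (2 * (κ * A))) with hε
  have hε0 : 0 < ε := by positivity
  set C₁ := Real.exp (D / 8) * (2 * (κ * A)) with hC₁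
  set C₂ := Real.exp (D / 8) * κ with hC₂
  have hC₁0 : 0 < C₁ := by positivity
  have hC₂0 : 0 < C₂ := by positivity
  set C₃ := C₁ * (9 / ε ^ 2) + C₂ * (9 / ε ^ 2 + 6 / ε) with hC₃
  have hC₃0 : 0 < C₃ := by positivity
  refine ⟨C₁ + C₃, by positivity, ?_⟩
  intro d m f g Δ γ c₁ c₂ c₃ L N Y hf hΔ hg hs hN hY
  have hL := hs.nonneg
  have hΔ0 := hΔ.pos
  set v := L * N * (1 + Lf + Y) with hv
  have hv0 : 0 ≤ v := by positivity
  have small : ∀ (n : ℕ), v * (n * Δ) ^ α ≤ ε → ∀ w : PathSpace m α, n * Δ ≤ 1 →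
      IsHolderOn w N (n * Δ) → ∀ y u : Vec d,
      (∀ k < n, ‖f (euler f g Δ k w y)‖ ≤ (1 + γ) * Y) →
      ‖euler f g Δ n w u - euler f g Δ n w y‖
        ≤ Real.exp (-(D / 8 * (n * Δ)) + C₁ * (v * (n * Δ) ^ α)) * ‖u - y‖ := by
    intro n hn w hT1 hw y u hB
    have h1 : 6 * (v * (n * Δ) ^ α) ≤ sewGap α := by
      have := hn.trans (min_le_left _ _); linarith
    have h2 : 2 * (κ * A) * (v * (n * Δ) ^ α) ≤ 1 := by
      have := hn.trans (min_le_right _ _)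
      rw [le_div_iff₀ (by positivity)] at this; linarith
    have := norm_euler_sub_le_of_small hα hα' hf hΔ hg hs hT1 hN hw hY y u hB h1 h2
    rw [← mul_assoc (Real.exp (D / 8))] at this
    exact this
  have cube : ∀ n : ℕ, n * Δ ≤ 1 → (v * (n * Δ) ^ α) ^ 3 ≤ v ^ 3 * (n * Δ) := fun n hn => by
    rw [mul_pow]
    exact mul_le_mul_of_nonneg_left (rpow_pow_three_le hα (by positivity) hn) (by positivity)
  -- On a piece with E ≥ ε/3 lower powers of E are dominated by E³ ≤ v³T, which sums over the pieces
  -- to at most v³. A block with E below ε/3 needs no subdivision.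
  have lin : ∀ E : ℝ, ε / 3 ≤ E → E ≤ 9 / ε ^ 2 * E ^ 3 ∧ 2 * E ^ 2 ≤ 6 / ε * E ^ 3 := by
    intro E hE
    have hE0 : 0 < E := by linarith [show 0 < ε / 3 by positivity]
    have h1 : 1 ≤ 3 / ε * E := by
      rw [div_mul_eq_mul_div, one_le_div hε0]; linarith
    have h2 : 1 ≤ (3 / ε * E) ^ 2 := one_le_pow₀ h1
    constructor
    · calc E = 1 * E := (one_mul E).symm
        _ ≤ (3 / ε * E) ^ 2 * E := mul_le_mul_of_nonneg_right h2 hE0.le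
        _ = _ := by ring
    · calc 2 * E ^ 2 = 1 * (2 * E ^ 2) := (one_mul _).symm
        _ ≤ (3 / ε * E) * (2 * E ^ 2) := mul_le_mul_of_nonneg_right h1 (by positivity)
        _ = _ := by ring
  intro n w hT1 hw y u hB
  rcases le_or_gt (ε / 3) (v * (n * Δ) ^ α) with hn | hn
  · have main := halving_induction (p := fun n => ∀ w : PathSpace m α, n * Δ ≤ 1 →
      IsHolderOn w N (n * Δ) → ∀ y u : Vec d,
      (∀ k < n, ‖f (euler f g Δ k w y)‖ ≤ (1 + γ) * Y) →
      ‖euler f g Δ n w u - euler f g Δ n w y‖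
        ≤ Real.exp (-(D / 8 * (n * Δ)) + C₃ * (v ^ 3 * (n * Δ))) * ‖u - y‖)
      (by linarith : 0 < α) (by linarith : α ≤ 1) hv0 hΔ0 hε0 ?_ ?_ ?_ n hn w hT1 hw y u hB
    · refine main.trans (mul_le_mul_of_nonneg_right (Real.exp_le_exp.mpr ?_) (norm_nonneg _))
      have h1 : v ^ 3 * (n * Δ) ≤ v ^ 3 := mul_le_of_le_one_right (by positivity) hT1
      have h2 := mul_le_mul_of_nonneg_left h1 hC₃0.le
      have h3 : 0 ≤ C₁ * (v + v ^ 3) := by positivity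
      have h4 : 0 ≤ C₃ * v := by positivity
      linarith
    · intro n h1 h2 w hT1 hw y u hB
      refine (small n h2 w hT1 hw y u hB).trans
        (mul_le_mul_of_nonneg_right (Real.exp_le_exp.mpr ?_) (norm_nonneg _))
      have h3 := mul_le_mul_of_nonneg_left (lin _ h1).1 hC₁0.le
      have h4 := mul_le_mul_of_nonneg_left (cube n hT1) (by positivity : 0 ≤ C₁ * (9 / ε ^ 2))
      have h5 : 0 ≤ C₂ * (9 / ε ^ 2 + 6 / ε) * (v ^ 3 * (n * Δ)) := by positivity
      rw [hC₃]
      linarith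
    · intro h1 w hT1 hw y u hB
      have h3 := cube 1 hT1
      have hT1' : Δ ≤ 1 := by simpa using hT1
      have hw' : IsHolderOn w N Δ := by simpa using hw
      rw [Nat.cast_one, one_mul] at h1 h3 ⊢
      have he : L * N * Δ ^ α ≤ v * Δ ^ α := by
        refine mul_le_mul_of_nonneg_right ?_ (by positivity)
        exact le_mul_of_one_le_right (by positivity) (by linarith)
      refine (norm_euler_one_sub_le hf hΔ hg hs hT1' hN hw' y u he).trans
        (mul_le_mul_of_nonneg_right (Real.exp_le_exp.mpr ?_) (norm_nonneg _))
      obtain ⟨l1, l2⟩ := lin _ h1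
      have h4 := mul_le_mul_of_nonneg_left (add_le_add l1 l2) hC₂0.le
      have h5 := mul_le_mul_of_nonneg_left h3 (by positivity : 0 ≤ C₂ * (9 / ε ^ 2 + 6 / ε))
      have h6 : 0 ≤ C₁ * (9 / ε ^ 2) * (v ^ 3 * Δ) := by positivity
      rw [hC₃]
      rw [hC₂] at h4 h5 ⊢
      linarith
    · intro i j hi hj w hT1 hw y u hB
      have e : ((i + j : ℕ) : ℝ) * Δ = i * Δ + j * Δ := by push_cast; ring
      have hi0 : 0 ≤ (i : ℝ) * Δ := by positivity
      have hj0 : 0 ≤ (j : ℝ) * Δ := by positivity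
      rw [e] at hT1 hw
      have h1 := hi w (by linarith) (hw.mono (by linarith)) y u fun k hk => hB k (by omega)
      have h2 := hj (shift (i * Δ) w) (by linarith) (hw.shift hi0 le_rfl) (euler f g Δ i w y)
        (euler f g Δ i w u) fun k hk => by
          rw [← euler_add]; exact hB _ (by omega)
      rw [euler_add, euler_add, e]
      refine h2.trans ((mul_le_mul_of_nonneg_left h1 (Real.exp_pos _).le).trans (le_of_eq ?_))
      rw [← mul_assoc, ← Real.exp_add]
      congr 2
      ring
  · refine (small n (by linarith) w hT1 hw y u hB).trans
      (mul_le_mul_of_nonneg_right (Real.exp_le_exp.mpr ?_) (norm_nonneg _))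
    have h1 : v * (n * Δ) ^ α ≤ v :=
      mul_le_of_le_one_right hv0 (Real.rpow_le_one (by positivity) hT1 (by linarith))
    have h2 := mul_le_mul_of_nonneg_left h1 hC₁0.le
    have h3 : 0 ≤ C₃ * (v + v ^ 3) := by positivity
    have h4 : 0 ≤ C₁ * v ^ 3 := by positivity
    linarith

end Contraction

/-! ### Growth and absorption of one solution over a block. -/

section Absorption

variable {d m : ℕ} {α : ℝ} {f : Vec d → Vec d} {g : Vec d → (Vec m →L[ℝ] Vec d)}
  {Δ D Lf γ c₁ c₂ c₃ L N : ℝ} {w : PathSpace m α} {n : ℕ}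

/-- Comparison with the point 0: the drift f(y) − f(0) is dissipative, and the constant f(0) is
counted as part of the perturbation. -/
theorem norm_euler_le_of_rsum (hf : DriftBound f D Lf) (hΔ : StepBound Δ D Lf) {σ : ℝ}
    (hT1 : n * Δ ≤ 1) (y : Vec d)
    (h : ∀ j ≤ n, ‖rsum g w Δ (fun k => euler f g Δ k w y) 0 j‖ ≤ σ) (k : ℕ) (hk : k ≤ n) :
    ‖euler f g Δ k w y‖
      ≤ Real.exp (-(D / 8) * (k * Δ)) * ‖y‖ + (3 + 3 * (Lf / D)) * (σ + ‖f 0‖) := by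
  have hΔ0 := hΔ.pos
  refine norm_le_of_dissipative hf.pos hf.nonneg hΔ.pos hΔ.lip hΔ.diss
    (w := fun k => euler f g Δ k w y) (p := fun k => f (euler f g Δ k w y) - f 0)
    (s := fun j => rsum g w Δ (fun k => euler f g Δ k w y) 0 j + (j * Δ) • f 0)
    (by simp [rsum]) (fun j hj => ?_) (fun i _ => ?_) (fun i _ => ?_)
    (fun i _ => ?_) k hk
  · refine (norm_add_le _ _).trans (add_le_add (h j hj) ?_)
    rw [norm_smul, Real.norm_of_nonneg (by positivity)]
    have h1 : (j : ℝ) * Δ ≤ n * Δ := by gcongr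
    exact mul_le_of_le_one_left (norm_nonneg _) (h1.trans hT1)
  · simp only [euler_eq_add_rsum, smul_sub]
    push_cast
    rw [add_mul, one_mul, add_smul]
    abel
  · simpa using hf.dissipative (euler f g Δ i w y) 0
  · simpa using hf.lipschitz (euler f g Δ i w y) 0

/-- The feedback of the solution on its own perturbation is κ·S·Lf·e·T·M. It carries a factor T, so
smallness of e alone lets it consume only half of the rate D/8, and Y does not enter. -/
theorem norm_euler_le_of_small (hα : 1 / 3 < α) (hα' : α ≤ 1 / 2) (hf : DriftBound f D Lf)
    (hΔ : StepBound Δ D Lf) (hg : CoefBound g γ c₁ c₂ c₃) (hs : SizeBound γ c₁ c₂ c₃ L)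
    (hT1 : n * Δ ≤ 1) (hN : 0 ≤ N) (hw : IsHolderOn w N (n * Δ)) (y : Vec d)
    (h1 : 6 * (L * (N * (n * Δ) ^ α)) ≤ sewGap α)
    (h2 : 2 * ((3 + 3 * (Lf / D)) * (6 / sewGap α) * Lf) * (L * (N * (n * Δ) ^ α)) ≤ 1)
    (h3 : Real.exp (D / 8) * (2 * ((3 + 3 * (Lf / D)) * (6 / sewGap α) * Lf))
      * (L * (N * (n * Δ) ^ α)) ≤ D / 16) :
    (∀ k ≤ n, ‖euler f g Δ k w y‖
      ≤ 2 * ‖y‖ + 2 * ((3 + 3 * (Lf / D)) * (4 + 4 * ‖f 0‖) * ((1 + γ) * (1 + N)))) ∧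
    ‖euler f g Δ n w y‖ ≤ Real.exp (-(D / 16 * (n * Δ))) * ‖y‖
      + 2 * ((3 + 3 * (Lf / D)) * (4 + 4 * ‖f 0‖) * ((1 + γ) * (1 + N))) := by
  have hq0 := sewGap_pos hα
  have hD := hf.pos
  have hL := hs.nonneg
  have hLf := hf.nonneg
  have hΔ0 := hΔ.pos
  have n0 := hg.nonneg₀
  have hT0 : 0 ≤ n * Δ := by positivity
  have hη1 : N * (n * Δ) ^ α ≤ N :=
    mul_le_of_le_one_right hN (Real.rpow_le_one hT0 hT1 (by linarith))
  have hη0 : 0 ≤ N * (n * Δ) ^ α := by positivity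
  set η := N * (n * Δ) ^ α with hη
  set κ := 3 + 3 * (Lf / D) with hκ
  have hκ0 : 0 ≤ κ := by positivity
  set e := L * η with he
  have he0 : 0 ≤ e := by positivity
  set F := ‖f 0‖ with hF
  have hF0 : 0 ≤ F := norm_nonneg _
  set S := 6 / sewGap α with hS
  have hS0 : 0 ≤ S := by positivity
  have hSe : S * e ≤ 1 := by
    rw [hS, div_mul_eq_mul_div, div_le_one hq0]; exact h1
  obtain ⟨l, hl, hlmax⟩ := Finset.exists_max_image (Finset.range (n + 1))
    (fun k => ‖euler f g Δ k w y‖) ⟨0, by simp⟩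
  set M := ‖euler f g Δ l w y‖ with hM
  have hM0 : 0 ≤ M := norm_nonneg _
  have hr := norm_rsum_le (y := fun k => euler f g Δ k w y) (B := F + Lf * M)
    hα hα' hg hs hΔ.pos hN hw (fun k _ => euler_succ k w y) (by positivity)
    (fun k hk => (hf.norm_le _).trans (add_le_add le_rfl
      (mul_le_mul_of_nonneg_left (hlmax k (by simpa using by omega)) hLf))) he h1
  have hb := norm_euler_le_of_rsum hf hΔ hT1 y hr
  rw [← hη, ← hκ, ← hF, ← hS] at hb
  set T := (n : ℝ) * Δ with hT
  set G := κ * (4 + 4 * F) * ((1 + γ) * (1 + N)) with hG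
  have hconst : κ * (2 * (1 + γ * η) + S * e * ((F + Lf * M) * T) + F)
      ≤ G + κ * S * Lf * e * T * M := by
    have a1 : S * e * (F * T) ≤ 1 * F :=
      mul_le_mul hSe (mul_le_of_le_one_right hF0 hT1) (by positivity) zero_le_one
    have a2 : γ * η ≤ γ * N := mul_le_mul_of_nonneg_left hη1 n0
    have a3 : 2 * (1 + γ * η) + S * e * (F * T) + F ≤ (4 + 4 * F) * ((1 + γ) * (1 + N)) := by
      have : 0 ≤ γ * N := by positivity
      have : 0 ≤ F * γ := by positivity
      have : 0 ≤ F * N := by positivity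
      have : 0 ≤ F * (γ * N) := by positivity
      linarith
    have a4 := mul_le_mul_of_nonneg_left a3 hκ0
    rw [hG]
    linarith
  have hMM : M ≤ 2 * ‖y‖ + 2 * G := by
    have b1 := hb l (by have := Finset.mem_range.mp hl; omega)
    have b2 : Real.exp (-(D / 8) * (l * Δ)) * ‖y‖ ≤ ‖y‖ :=
      mul_le_of_le_one_left (norm_nonneg _) (Real.exp_le_one_iff.mpr
        (mul_nonpos_of_nonpos_of_nonneg (by linarith) (by positivity)))
    have b3 := mul_le_mul_of_nonneg_right h2 hM0
    have b4 : κ * S * Lf * e * T * M ≤ κ * S * Lf * e * M := by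
      have := mul_le_of_le_one_right (by positivity : 0 ≤ κ * S * Lf * e * M) hT1
      linarith
    rw [← hM] at b1
    linarith
  refine ⟨fun k hk => (hlmax k (by simpa using by omega)).trans hMM, ?_⟩
  have b1 := hb n le_rfl
  have b2 := exp_add_le (a := D / 8 * T) (b := 2 * (κ * S * Lf * e * T)) (C := D / 8)
    (mul_le_of_le_one_right (by positivity) hT1) (by positivity)
  have b3 : -(D / 8 * T) + Real.exp (D / 8) * (2 * (κ * S * Lf * e * T)) ≤ -(D / 16 * T) := by
    have := mul_le_mul_of_nonneg_right h3 hT0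
    linarith
  have b4 := mul_le_mul_of_nonneg_right (b2.trans (Real.exp_le_exp.mpr b3)) (norm_nonneg y)
  have b5 := mul_le_mul_of_nonneg_left hMM (by positivity : 0 ≤ κ * S * Lf * e * T)
  have b6 : 2 * (κ * S * Lf * e * T) * G ≤ G := by
    have hG0 : 0 ≤ G := by positivity
    refine mul_le_of_le_one_left hG0 ?_
    have := mul_le_of_le_one_right (by positivity : 0 ≤ κ * S * Lf * e) hT1
    linarith
  rw [neg_mul] at b1
  linarith

/-- Growth over a block of length at most one, and absorption at its end. -/
theorem exists_norm_euler_le (hα : 1 / 3 < α) (hα' : α ≤ 1 / 2) (hf : DriftBound f D Lf) :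
    ∃ C : ℝ, 0 ≤ C ∧ ∀ {m : ℕ} {g : Vec d → (Vec m →L[ℝ] Vec d)}
      {Δ γ c₁ c₂ c₃ L N : ℝ}, StepBound Δ D Lf → CoefBound g γ c₁ c₂ c₃ →
      SizeBound γ c₁ c₂ c₃ L → 0 ≤ N → ∀ (n : ℕ) (w : PathSpace m α), n * Δ ≤ 1 →
      IsHolderOn w N (n * Δ) → ∀ y : Vec d,
      (∀ k ≤ n, ‖euler f g Δ k w y‖ ≤ 2 * ‖y‖ + C * ((1 + γ) * (1 + N) ^ 5)) ∧
      ‖euler f g Δ n w y‖ ≤ Real.exp (-(D / 16 * (n * Δ))) * ‖y‖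
        + C * ((1 + γ) * (1 + N) ^ 5) := by
  have hq0 := sewGap_pos hα
  have hD := hf.pos
  have hLf := hf.nonneg
  set κ := 3 + 3 * (Lf / D) with hκ
  set S := 6 / sewGap α with hS
  set F := ‖f 0‖ with hF
  have hκ0 : 0 < κ := by positivity
  have hS0 : 0 < S := by positivity
  have hF0 : 0 ≤ F := norm_nonneg _
  set K := κ * (4 + 4 * F) with hK
  have hK0 : 0 < K := by positivity
  set R := 1 + 2 * (κ * S * Lf) with hR
  have hR0 : 0 < R := by positivity
  set ε := min (sewGap α / 6) (min (1 / R) (D / 16 / (Real.exp (D / 8) * R))) with hε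
  have hε0 : 0 < ε := by positivity
  set C := 2 * K * (3 / ε) ^ 3 with hC
  have hC0 : 0 < C := by positivity
  refine ⟨2 * C + 2 * K, by positivity, ?_⟩
  intro m g Δ γ c₁ c₂ c₃ L N hΔ hg hs hN
  have hL := hs.nonneg
  have hΔ0 := hΔ.pos
  have n0 := hg.nonneg₀
  set v := L * N with hv
  have hv0 : 0 ≤ v := by positivity
  have hvN : v ≤ N := mul_le_of_le_one_left hN hs.le_one
  have small : ∀ (n : ℕ), v * (n * Δ) ^ α ≤ ε → ∀ w : PathSpace m α, n * Δ ≤ 1 →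
      IsHolderOn w N (n * Δ) → ∀ y : Vec d,
      (∀ k ≤ n, ‖euler f g Δ k w y‖ ≤ 2 * ‖y‖ + 2 * (K * ((1 + γ) * (1 + N)))) ∧
      ‖euler f g Δ n w y‖ ≤ Real.exp (-(D / 16 * (n * Δ))) * ‖y‖
        + 2 * (K * ((1 + γ) * (1 + N))) := by
    intro n hn w hT1 hw y
    rw [hv, mul_assoc] at hn
    have he0 : 0 ≤ L * (N * (n * Δ) ^ α) := by positivity
    have h1 := hn.trans (min_le_left _ _)
    have h2 := hn.trans ((min_le_right _ _).trans (min_le_left _ _))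
    have h3 := hn.trans ((min_le_right _ _).trans (min_le_right _ _))
    rw [le_div_iff₀ (by positivity)] at h2 h3
    refine norm_euler_le_of_small hα hα' hf hΔ hg hs hT1 hN hw y (by linarith) ?_ ?_
    · rw [← hκ, ← hS]; rw [hR] at h2; linarith
    · rw [← hκ, ← hS]; rw [hR] at h3
      have : 0 ≤ Real.exp (D / 8) * (L * (N * (n * Δ) ^ α)) := by positivity
      linarith
  set B := C * ((1 + γ) * (1 + N) ^ 5) with hB
  have hB0 : 0 ≤ B := by positivity
  -- On pieces that are not too short, 1 ≤ (3/ε)³(1+N)³T turns the additive constant into one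
  -- proportional to T, which sums over the pieces. It raises (1+N)² to (1+N)^5.
  have scale : ∀ n : ℕ, n * Δ ≤ 1 → ε / 3 ≤ v * (n * Δ) ^ α →
      2 * K * ((1 + γ) * (1 + N) ^ 2) ≤ B * (n * Δ) := by
    intro n hT1 hn
    have hT0 : 0 ≤ n * Δ := by positivity
    have h1 : 1 ≤ 3 / ε * (N * (n * Δ) ^ α) := by
      have := mul_le_mul_of_nonneg_right hvN (by positivity : 0 ≤ (n * Δ) ^ α)
      rw [div_mul_eq_mul_div, one_le_div hε0]; linarith
    have h2 : 1 ≤ (3 / ε * (N * (n * Δ) ^ α)) ^ 3 := one_le_pow₀ h1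
    have h3 : (N * (n * Δ) ^ α) ^ 3 ≤ (1 + N) ^ 3 * (n * Δ) := by
      rw [mul_pow]
      exact mul_le_mul (pow_le_pow_left₀ hN (by linarith) 3) (rpow_pow_three_le hα hT0 hT1)
        (by positivity) (by positivity)
    have h4 := mul_le_mul_of_nonneg_left h3 (by positivity : 0 ≤ (3 / ε) ^ 3)
    rw [mul_pow] at h2
    have h5 := mul_le_mul_of_nonneg_left (h2.trans h4)
      (by positivity : 0 ≤ 2 * K * ((1 + γ) * (1 + N) ^ 2))
    rw [mul_one] at h5
    refine h5.trans (le_of_eq ?_)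
    rw [hB, hC]
    ring
  have hN2 : K * ((1 + γ) * (1 + N)) ≤ K * ((1 + γ) * (1 + N) ^ 2) := by
    have : 1 + N ≤ (1 + N) ^ 2 := le_self_pow₀ (by linarith) (by norm_num)
    gcongr
  have hN5 : K * ((1 + γ) * (1 + N)) ≤ K * ((1 + γ) * (1 + N) ^ 5) := by
    have : 1 + N ≤ (1 + N) ^ 5 := le_self_pow₀ (by linarith) (by norm_num)
    gcongr
  intro n w hT1 hw y
  rcases le_or_gt (ε / 3) (v * (n * Δ) ^ α) with hn | hn
  · have main := halving_induction (p := fun n => ∀ w : PathSpace m α, n * Δ ≤ 1 →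
      IsHolderOn w N (n * Δ) → ∀ y : Vec d,
      (∀ k ≤ n, ‖euler f g Δ k w y‖ ≤ 2 * ‖y‖ + 2 * (B * (n * Δ))) ∧
      ‖euler f g Δ n w y‖ ≤ Real.exp (-(D / 16 * (n * Δ))) * ‖y‖ + B * (n * Δ))
      (by linarith : 0 < α) (by linarith : α ≤ 1) hv0 hΔ0 hε0 ?_ ?_ ?_ n hn w hT1 hw y
    · have h1 : B * (n * Δ) ≤ B := mul_le_of_le_one_right hB0 hT1
      have h2 : (2 * C + 2 * K) * ((1 + γ) * (1 + N) ^ 5)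
        = 2 * B + 2 * (K * ((1 + γ) * (1 + N) ^ 5)) := by rw [hB]; ring
      have h3 : 0 ≤ K * ((1 + γ) * (1 + N) ^ 5) := by positivity
      rw [h2]
      exact ⟨fun k hk => (main.1 k hk).trans (by linarith), main.2.trans (by linarith)⟩
    · intro n h1 h2 w hT1 hw y
      have h3 := small n h2 w hT1 hw y
      have h4 := scale n hT1 h1
      have h5 : 0 ≤ B * (n * Δ) := by positivity
      exact ⟨fun k hk => (h3.1 k hk).trans (by linarith), h3.2.trans (by linarith)⟩
    · intro h1 w hT1 hw y
      have h4 := scale 1 hT1 h1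
      have hσ : ∀ j ≤ 1, ‖rsum g w Δ (fun k => euler f g Δ k w y) 0 j‖ ≤ γ * N + N ^ 2 := by
        intro j hj
        interval_cases j
        · simp only [rsum, Finset.Ico_self, Finset.sum_empty, norm_zero]; positivity
        · have h5 := norm_germ_le hg hs hΔ0 one_pos hN (by linarith) hw
            (fun k => euler f g Δ k w y) (Nat.zero_le 1) le_rfl
          have h6 : N * (((1 : ℕ) : ℝ) * Δ) ^ α ≤ N :=
            mul_le_of_le_one_right hN (Real.rpow_le_one (by positivity) hT1 (by linarith))
          have h7 : 0 ≤ N * (((1 : ℕ) : ℝ) * Δ) ^ α := by positivity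
          have h8 : L * (N * (((1 : ℕ) : ℝ) * Δ) ^ α) ≤ N :=
            (mul_le_of_le_one_left h7 hs.le_one).trans h6
          have h9 := pow_le_pow_left₀ (by positivity) h8 2
          have h10 := mul_le_mul_of_nonneg_left h6 n0
          simp only [rsum, Nat.Ico_succ_singleton, Finset.sum_singleton, zero_add]
          linarith
      have h5 := norm_euler_le_of_rsum hf hΔ hT1 y hσ 1 le_rfl
      have h6 : κ * (γ * N + N ^ 2 + F) ≤ 2 * K * ((1 + γ) * (1 + N) ^ 2) := by
        have : γ * N + N ^ 2 + F ≤ 2 * (4 + 4 * F) * ((1 + γ) * (1 + N) ^ 2) := by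
          have : 0 ≤ γ * N := by positivity
          have : 0 ≤ γ * N ^ 2 := by positivity
          have : 0 ≤ F * (γ * N) := by positivity
          have : 0 ≤ F * (γ * N ^ 2) := by positivity
          have : 0 ≤ F * N := by positivity
          have : 0 ≤ F * N ^ 2 := by positivity
          have : 0 ≤ F * γ := by positivity
          have : 0 ≤ N ^ 2 := by positivity
          linarith
        have := mul_le_mul_of_nonneg_left this hκ0.le
        rw [hK]; linarith
      obtain ⟨t, ht⟩ : ∃ t, t = ((1 : ℕ) : ℝ) * Δ := ⟨_, rfl⟩
      have ht0 : 0 ≤ t := by rw [ht]; positivity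
      rw [← ht] at h4 h5 ⊢
      have h7 : Real.exp (-(D / 8) * t) ≤ Real.exp (-(D / 16 * t)) := by
        have : 0 ≤ D * t := by positivity
        exact Real.exp_le_exp.mpr (by linarith)
      have h8 := mul_le_mul_of_nonneg_right h7 (norm_nonneg y)
      have h9 : ‖euler f g Δ 1 w y‖ ≤ Real.exp (-(D / 16 * t)) * ‖y‖
          + B * t := by
        rw [← hκ, ← hF] at h5
        linarith
      have h10 : Real.exp (-(D / 16 * t)) * ‖y‖ ≤ ‖y‖ := by
        refine mul_le_of_le_one_left (norm_nonneg _) (Real.exp_le_one_iff.mpr ?_)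
        have : 0 ≤ D * t := by positivity
        linarith
      have h11 : 0 ≤ B * t := by positivity
      have h12 := norm_nonneg y
      refine ⟨fun k hk => ?_, h9⟩
      interval_cases k
      · change ‖y‖ ≤ _
        linarith
      · linarith
    · intro i j hi hj w hT1 hw y
      have e : ((i + j : ℕ) : ℝ) * Δ = i * Δ + j * Δ := by push_cast; ring
      have hi0 : 0 ≤ (i : ℝ) * Δ := by positivity
      have hj0 : 0 ≤ (j : ℝ) * Δ := by positivity
      rw [e] at hT1 hw
      have h1 := hi w (by linarith) (hw.mono (by linarith)) y
      have h2 := hj (shift (i * Δ) w) (by linarith) (hw.shift hi0 le_rfl) (euler f g Δ i w y)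
      have h3 : Real.exp (-(D / 16 * (i * Δ))) ≤ 1 := by
        refine Real.exp_le_one_iff.mpr ?_
        have : 0 ≤ D * ((i : ℝ) * Δ) := by positivity
        linarith
      have h4 : Real.exp (-(D / 16 * (j * Δ))) ≤ 1 := by
        refine Real.exp_le_one_iff.mpr ?_
        have : 0 ≤ D * ((j : ℝ) * Δ) := by positivity
        linarith
      have h5 : 0 ≤ B * (i * Δ) := by positivity
      have h6 : 0 ≤ B * (j * Δ) := by positivity
      have h7 := mul_le_of_le_one_left (norm_nonneg y) h3
      rw [e]
      refine ⟨fun k hk => ?_, ?_⟩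
      · rcases Nat.lt_or_ge i k with hik | hik
        · obtain ⟨l, rfl⟩ := Nat.exists_eq_add_of_lt hik
          rw [add_assoc, euler_add]
          have h8 := h2.1 (l + 1) (by omega)
          linarith [h1.2]
        · have h8 := h1.1 k hik
          linarith
      · rw [euler_add]
        have h8 := mul_le_mul_of_nonneg_left h1.2 (Real.exp_pos (-(D / 16 * (j * Δ)))).le
        have h9 : Real.exp (-(D / 16 * (j * Δ))) * (B * (i * Δ)) ≤ B * (i * Δ) :=
          mul_le_of_le_one_left h5 h4
        have h10 : Real.exp (-(D / 16 * (j * Δ))) * Real.exp (-(D / 16 * (i * Δ)))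
            = Real.exp (-(D / 16 * (i * Δ + j * Δ))) := by rw [← Real.exp_add]; congr 1; ring
        rw [← h10]
        linarith [h2.2]
  · have h3 := small n (by linarith) w hT1 hw y
    have h2 : (2 * C + 2 * K) * ((1 + γ) * (1 + N) ^ 5)
      = 2 * B + 2 * (K * ((1 + γ) * (1 + N) ^ 5)) := by rw [hB]; ring
    rw [h2]
    exact ⟨fun k hk => (h3.1 k hk).trans (by linarith), h3.2.trans (by linarith)⟩

end Absorption

/-! ### The Lyapunov function over one block. -/

section Block

variable {d m : ℕ} {α : ℝ} {f : Vec d → Vec d} {D Lf : ℝ}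

/-- Young's inequality. The contraction exponent is cubic in a(q + a⁵), with a = 1 + N and q the
scaled state; this places it below the Lyapunov function q^10 plus the noise power a^50. -/
theorem cube_le {a q : ℝ} (ha : 1 ≤ a) (hq : 0 ≤ q) :
    (a * (q + a ^ 5)) ^ 3 ≤ 8 * (q ^ 10 + a ^ 50) := by
  have ha0 : 0 ≤ a := by linarith
  have h1 : (q + a ^ 5) ^ 3 ≤ 2 ^ (3 - 1) * (q ^ 3 + (a ^ 5) ^ 3) := add_pow_le hq (by positivity) 3
  have h2 : a ^ 3 * q ^ 3 ≤ (a ^ 6 + q ^ 6) / 2 := by nlinarith [sq_nonneg (a ^ 3 - q ^ 3)]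
  have h3 : a ^ 6 ≤ a ^ 50 := pow_le_pow_right₀ ha (by norm_num)
  have h4 : a ^ 18 ≤ a ^ 50 := pow_le_pow_right₀ ha (by norm_num)
  have h5 : 1 ≤ a ^ 50 := one_le_pow₀ ha
  have h6 : q ^ 6 ≤ 1 + q ^ 10 := by
    rcases le_total q 1 with h | h
    · have : q ^ 6 ≤ 1 := pow_le_one₀ hq h
      have : 0 ≤ q ^ 10 := by positivity
      linarith
    · have : q ^ 6 ≤ q ^ 10 := pow_le_pow_right₀ h (by norm_num)
      linarith
  have h7 := mul_le_mul_of_nonneg_left h1 (by positivity : 0 ≤ a ^ 3)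
  have h8 : a ^ 3 * (a ^ 5) ^ 3 = a ^ 18 := by ring
  have h9 : 0 ≤ q ^ 10 := by positivity
  rw [mul_pow]
  norm_num at h7
  linarith

/-- Convexity of the tenth power, reading tq + b as a convex combination of q and b/(1−t); the decay
factor t in front of q^10 is kept. -/
theorem add_pow_ten_le {t q b : ℝ} (ht0 : 0 ≤ t) (ht1 : t < 1) (hq : 0 ≤ q) (hb : 0 ≤ b) :
    (t * q + b) ^ 10 ≤ t * q ^ 10 + (1 - t) * (b / (1 - t)) ^ 10 := by
  have h1 : 0 < 1 - t := by linarith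
  have h := (convexOn_pow 10).2 (x := q) (y := b / (1 - t)) hq
    (div_nonneg hb h1.le : (0 : ℝ) ≤ b / (1 - t)) ht0 h1.le (by ring)
  simp only [smul_eq_mul] at h
  rwa [mul_div_cancel₀ _ h1.ne'] at h

theorem add_mul_pow_ten_le {t q C a : ℝ} (ht0 : 0 ≤ t) (ht1 : t < 1) (hq : 0 ≤ q) (hC : 0 ≤ C)
    (ha : 0 ≤ a) :
    (t * q + C * a ^ 5) ^ 10 ≤ t * q ^ 10 + (1 - t) * (C / (1 - t)) ^ 10 * a ^ 50 := by
  have h := add_pow_ten_le (b := C * a ^ 5) ht0 ht1 hq (by positivity)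
  rwa [mul_div_right_comm, mul_pow _ (a ^ 5), ← pow_mul, ← mul_assoc] at h

/-- Since L ≤ 1, one factor L can be pulled out of the whole exponent; a small L_g later beats the
mean growth of the noise. -/
theorem add_cube_le {C L X R p Z : ℝ} (hC : 0 ≤ C) (hL : 0 ≤ L) (hL1 : L ≤ 1) (hX : 0 ≤ X)
    (hR : 0 ≤ R) (hXp : X ≤ R * p) (hp : 1 ≤ p) (hpZ : p ^ 3 ≤ 8 * Z) :
    C * (L * X + (L * X) ^ 3) ≤ L * (C * ((R + R ^ 3) * 8) * Z) := by
  have e1 : X ^ 3 ≤ R ^ 3 * p ^ 3 := by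
    rw [← mul_pow]; exact pow_le_pow_left₀ hX hXp 3
  have e2 : p ≤ p ^ 3 := le_self_pow₀ hp (by norm_num)
  have e3 := mul_le_mul_of_nonneg_left e2 hR
  have e4 := mul_le_mul_of_nonneg_left hpZ (by positivity : 0 ≤ R + R ^ 3)
  have e5 : X + X ^ 3 ≤ (R + R ^ 3) * (8 * Z) := by linarith
  have e6 : (L * X) ^ 3 ≤ L * X ^ 3 := by
    rw [mul_pow]
    exact mul_le_mul_of_nonneg_right (pow_le_of_le_one hL hL1 (by norm_num)) (by positivity)
  calc C * (L * X + (L * X) ^ 3) ≤ C * (L * X + L * X ^ 3) := by gcongr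
    _ = C * L * (X + X ^ 3) := by ring
    _ ≤ C * L * ((R + R ^ 3) * (8 * Z)) := by gcongr
    _ = _ := by ring

/-- Contraction over a block of length at most one, and the dissipation of the tenth power of the
norm over a block of length at least one half. -/
theorem exists_block_bound (hα : 1 / 3 < α) (hα' : α ≤ 1 / 2) (hf : DriftBound f D Lf) :
    ∃ C θ : ℝ, 0 ≤ C ∧ 0 ≤ θ ∧ θ < 1 ∧ ∀ {m : ℕ} {g : Vec d → (Vec m →L[ℝ] Vec d)}
      {Δ γ c₁ c₂ c₃ L N : ℝ}, StepBound Δ D Lf → CoefBound g γ c₁ c₂ c₃ →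
      SizeBound γ c₁ c₂ c₃ L → 0 ≤ N → ∀ (n : ℕ) (w : PathSpace m α), n * Δ ≤ 1 →
      IsHolderOn w N (n * Δ) → ∀ y : Vec d,
      (∀ u, ‖euler f g Δ n w u - euler f g Δ n w y‖ ≤ Real.exp (-(D / 8 * (n * Δ))
        + L * (C * ((‖y‖ / (1 + γ)) ^ 10 + (1 + N) ^ 50))) * ‖u - y‖) ∧
      (1 / 2 ≤ n * Δ → (‖euler f g Δ n w y‖ / (1 + γ)) ^ 10
        ≤ θ * (‖y‖ / (1 + γ)) ^ 10 + C * (1 + N) ^ 50) := by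
  have hD := hf.pos
  have hLf := hf.nonneg
  obtain ⟨C₁, hC₁, H₁⟩ := exists_norm_euler_sub_le hα hα' hD hLf
  obtain ⟨C₂, hC₂, H₂⟩ := exists_norm_euler_le hα hα' hf
  set t := Real.exp (-(D / 32)) with ht
  have ht0 : 0 ≤ t := (Real.exp_pos _).le
  have ht1 : t < 1 := Real.exp_lt_one_iff.mpr (by linarith)
  have ht2 : 0 < 1 - t := by linarith
  set F := ‖f 0‖ with hF
  have hF0 : 0 ≤ F := norm_nonneg _
  set R := 1 + Lf + F + 2 * Lf + Lf * C₂ with hR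
  have hR0 : 0 ≤ R := by positivity
  set K₁ := C₁ * ((R + R ^ 3) * 8) with hK₁
  set K₂ := (1 - t) * (C₂ / (1 - t)) ^ 10 with hK₂
  have hK₁0 : 0 ≤ K₁ := by positivity
  have hK₂0 : 0 ≤ K₂ := by positivity
  refine ⟨K₁ + K₂, t, by positivity, ht0, ht1, ?_⟩
  intro m g Δ γ c₁ c₂ c₃ L N hΔ hg hs hN n w hT1 hw y
  have hL := hs.nonneg
  have hL1 := hs.le_one
  have hΔ0 := hΔ.pos
  have hγ : 0 < 1 + γ := by linarith [hg.nonneg₀]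
  obtain ⟨hsup, hend⟩ := H₂ hΔ hg hs hN n w hT1 hw y
  have hq0 : 0 ≤ ‖y‖ / (1 + γ) := by positivity
  have hqy : ‖y‖ = (1 + γ) * (‖y‖ / (1 + γ)) := by field_simp
  -- In these units the absorption estimate and the bound Y on the drift contain no γ.
  set q := ‖y‖ / (1 + γ) with hq
  set a := 1 + N with ha
  have ha1 : 1 ≤ a := by linarith
  have ha0 : 0 ≤ a := by linarith
  have ha5 : 1 ≤ a ^ 5 := one_le_pow₀ ha1
  have hWQ : 0 ≤ q ^ 10 + a ^ 50 := by positivity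
  constructor
  · intro u
    set Y := F + Lf * (2 * q + C₂ * a ^ 5) with hY
    have hY0 : 0 ≤ Y := by positivity
    have hB : ∀ k < n, ‖f (euler f g Δ k w y)‖ ≤ (1 + γ) * Y := by
      intro k hk
      have h1 := mul_le_mul_of_nonneg_left (hsup k hk.le) hLf
      have h2 := hf.norm_le (euler f g Δ k w y)
      have h3 : 0 ≤ γ * F := mul_nonneg hg.nonneg₀ hF0
      rw [hqy] at h1
      rw [← hF] at h2
      rw [hY]
      linarith
    refine (H₁ hf hΔ hg hs hN hY0 n w hT1 hw y u hB).trans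
      (mul_le_mul_of_nonneg_right (Real.exp_le_exp.mpr ?_) (norm_nonneg _))
    refine add_le_add le_rfl ?_
    set X := N * (1 + Lf + Y) with hX
    have hX0 : 0 ≤ X := by positivity
    have hv : L * N * (1 + Lf + Y) = L * X := by rw [hX]; ring
    set p := a * (q + a ^ 5) with hp
    have hp1 : 1 ≤ p := by
      have : 1 * 1 ≤ a * (q + a ^ 5) := mul_le_mul ha1 (by linarith) zero_le_one ha0
      linarith
    have hXp : X ≤ R * p := by
      have h1 : 1 + Lf + Y ≤ R * (q + a ^ 5) := by
        have e1 := mul_le_mul_of_nonneg_left ha5 (by positivity : 0 ≤ 1 + Lf + F)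
        have e2 : 0 ≤ (1 + Lf + F + Lf * C₂) * q := by positivity
        have e3 : 0 ≤ 2 * Lf * a ^ 5 := by positivity
        rw [hR, hY]
        linarith
      have h2 := mul_le_mul (by linarith : N ≤ a) h1 (by positivity) ha0
      rw [hX, hp]
      linarith
    have h3 := add_cube_le hC₁ hL hL1 hX0 hR0 hXp hp1 (cube_le ha1 hq0)
    rw [hv]
    refine h3.trans (mul_le_mul_of_nonneg_left ?_ hL)
    exact mul_le_mul_of_nonneg_right (le_add_of_nonneg_right hK₂0) hWQ
  · intro hT
    have h1 : Real.exp (-(D / 16 * (n * Δ))) ≤ t := by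
      have := mul_le_mul_of_nonneg_left hT hD.le
      exact Real.exp_le_exp.mpr (by linarith)
    have h2 : ‖euler f g Δ n w y‖ / (1 + γ) ≤ t * q + C₂ * a ^ 5 := by
      rw [div_le_iff₀ hγ]
      have h3 := mul_le_mul_of_nonneg_right h1 (norm_nonneg y)
      have h4 : (t * q + C₂ * a ^ 5) * (1 + γ) = t * ((1 + γ) * q) + C₂ * ((1 + γ) * a ^ 5) := by
        ring
      rw [h4, ← hqy]
      linarith
    have h3 := pow_le_pow_left₀ (by positivity) h2 10
    have h4 := add_mul_pow_ten_le ht0 ht1 hq0 hC₂ ha0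
    exact h3.trans (h4.trans (add_le_add le_rfl
      (mul_le_mul_of_nonneg_right (le_add_of_nonneg_left hK₁0) (by positivity))))

end Block

/-! ### Chaining blocks and controlling their Hölder constants. -/

section Chain

variable {d m : ℕ} {α : ℝ} {f : Vec d → Vec d} {D Lf : ℝ}

/-- Contraction along a chain of blocks, in terms of the Hölder constants of the blocks. -/
theorem exists_chain_bound (hα : 1 / 3 < α) (hα' : α ≤ 1 / 2) (hf : DriftBound f D Lf) :
    ∃ C : ℝ, 0 ≤ C ∧ ∀ {m : ℕ} {g : Vec d → (Vec m →L[ℝ] Vec d)}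
      {Δ γ c₁ c₂ c₃ L : ℝ}, StepBound Δ D Lf → CoefBound g γ c₁ c₂ c₃ →
      SizeBound γ c₁ c₂ c₃ L → ∀ n₀ : ℕ, 1 / 2 ≤ n₀ * Δ → n₀ * Δ ≤ 1 →
      ∀ (J r : ℕ) (w : PathSpace m α) (W : ℕ → ℝ), r ≤ n₀ →
      (∀ j ≤ J, ∃ N : ℝ, 0 ≤ N ∧ IsHolderOn (shift (j * (n₀ * Δ)) w) N 1 ∧ (1 + N) ^ 50 ≤ W j) →
      ∀ y u : Vec d,
      ‖euler f g Δ (J * n₀ + r) w u - euler f g Δ (J * n₀ + r) w y‖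
        ≤ Real.exp (-(D / 8 * ((J * n₀ + r : ℕ) * Δ))
          + L * (C * (‖y‖ ^ 10 + ∑ j ∈ Finset.range (J + 1), W j))) * ‖u - y‖ := by
  obtain ⟨C, θ, hC, hθ0, hθ1, H⟩ := exists_block_bound hα hα' hf
  have hθ : 0 < 1 - θ := by linarith
  -- From Q_{j+1} ≤ θQ_j + CW_j one gets C·Q_j ≤ Ca(Q_j − Q_{j+1}) + Ca·C·W_j: the sum of the Q_j
  -- telescopes, leaving the initial value and the noise.
  set Ca := C / (1 - θ) with hCa
  have hCa0 : 0 ≤ Ca := by positivity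
  have hCCa : Ca * (1 - θ) = C := by rw [hCa]; field_simp
  have hCle : C ≤ Ca := by
    have := mul_nonneg hCa0 hθ0
    linarith
  set Cb := C + Ca * C with hCb
  have hCb0 : 0 ≤ Cb := by positivity
  refine ⟨Ca + Cb, by positivity, ?_⟩
  intro m g Δ γ c₁ c₂ c₃ L hΔ hg hs n₀ hτ hτ1 J r w W hr hW y u
  have hL := hs.nonneg
  have hΔ0 := hΔ.pos
  have hγ : 1 ≤ 1 + γ := by linarith [hg.nonneg₀]
  set Q : ℕ → ℝ := fun j => (‖euler f g Δ (j * n₀) w y‖ / (1 + γ)) ^ 10 with hQ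
  have hQ0 : ∀ j, 0 ≤ Q j := fun j => by positivity
  have hW0 : ∀ j ≤ J, 0 ≤ W j := fun j hj => by
    obtain ⟨N, hN, -, h⟩ := hW j hj
    exact le_trans (by positivity) h
  have cast : ∀ j : ℕ, ((j * n₀ : ℕ) : ℝ) * Δ = j * (n₀ * Δ) := fun j => by push_cast; ring
  have step : ∀ j ≤ J, ∀ i ≤ n₀,
      ‖euler f g Δ (j * n₀ + i) w u - euler f g Δ (j * n₀ + i) w y‖
        ≤ Real.exp (-(D / 8 * (i * Δ)) + L * (C * (Q j + W j)))
          * ‖euler f g Δ (j * n₀) w u - euler f g Δ (j * n₀) w y‖ ∧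
      Q (j + 1) ≤ θ * Q j + C * W j := by
    intro j hj i hi
    obtain ⟨N, hN, hw, hNW⟩ := hW j hj
    have hi' : (i : ℝ) * Δ ≤ n₀ * Δ := by gcongr
    have h1 := H hΔ hg hs hN i (shift (j * (n₀ * Δ)) w) (hi'.trans hτ1)
      (hw.mono (hi'.trans hτ1)) (euler f g Δ (j * n₀) w y)
    have h2 := H hΔ hg hs hN n₀ (shift (j * (n₀ * Δ)) w) hτ1 (hw.mono hτ1)
      (euler f g Δ (j * n₀) w y)
    rw [euler_add, euler_add, cast]
    constructor
    · refine (h1.1 _).trans (mul_le_mul_of_nonneg_right (Real.exp_le_exp.mpr ?_) (norm_nonneg _))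
      gcongr
    · have h3 := h2.2 hτ
      have h4 := mul_le_mul_of_nonneg_left hNW hC
      have e : Q (j + 1) = (‖euler f g Δ n₀ (shift (j * (n₀ * Δ)) w)
          (euler f g Δ (j * n₀) w y)‖ / (1 + γ)) ^ 10 := by
        simp only [hQ]
        rw [add_mul, one_mul, euler_add, cast]
      rw [e]
      linarith
  have chain : ∀ j ≤ J, ‖euler f g Δ (j * n₀) w u - euler f g Δ (j * n₀) w y‖
      ≤ Real.exp (-(D / 8 * (j * (n₀ * Δ)))
        + L * (Ca * (Q 0 - Q j) + Cb * ∑ i ∈ Finset.range j, W i)) * ‖u - y‖ := by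
    intro j
    induction j with
    | zero => intro _; simp [euler]
    | succ j ih =>
      intro hj
      obtain ⟨h1, h2⟩ := step j (by omega) n₀ le_rfl
      rw [add_mul, one_mul]
      refine h1.trans ((mul_le_mul_of_nonneg_left (ih (by omega)) (Real.exp_pos _).le).trans ?_)
      rw [← mul_assoc, ← Real.exp_add]
      refine mul_le_mul_of_nonneg_right (Real.exp_le_exp.mpr ?_) (norm_nonneg _)
      have h3 : C * Q j ≤ Ca * (Q j - Q (j + 1)) + Ca * C * W j := by
        have := mul_le_mul_of_nonneg_left h2 hCa0
        have e : C * Q j = Ca * (1 - θ) * Q j := by rw [hCCa]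
        rw [e]
        linarith
      have h4 := mul_le_mul_of_nonneg_left h3 hL
      rw [Finset.sum_range_succ, hCb]
      push_cast
      linarith
  have h1 := (step J le_rfl r hr).1
  refine h1.trans ((mul_le_mul_of_nonneg_left (chain J le_rfl) (Real.exp_pos _).le).trans ?_)
  rw [← mul_assoc, ← Real.exp_add]
  refine mul_le_mul_of_nonneg_right (Real.exp_le_exp.mpr ?_) (norm_nonneg _)
  have h2 : Q 0 ≤ ‖y‖ ^ 10 := by
    simp only [hQ, zero_mul, euler]
    exact pow_le_pow_left₀ (by positivity) (div_le_self (norm_nonneg _) hγ) 10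
  have h3 : C * Q J ≤ Ca * Q J := mul_le_mul_of_nonneg_right hCle (hQ0 J)
  have h4 : C * W J ≤ Cb * W J :=
    mul_le_mul_of_nonneg_right (by rw [hCb]; linarith [mul_nonneg hCa0 hC]) (hW0 J le_rfl)
  have h5 : 0 ≤ Ca * ∑ j ∈ Finset.range (J + 1), W j :=
    mul_nonneg hCa0 (Finset.sum_nonneg fun j hj => hW0 j (by
      have := Finset.mem_range.mp hj; omega))
  have h6 : 0 ≤ Cb * ‖y‖ ^ 10 := by positivity
  have h7 := mul_le_mul_of_nonneg_left h2 hCa0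
  have e : ((J * n₀ + r : ℕ) : ℝ) * Δ = J * (n₀ * Δ) + r * Δ := by push_cast; ring
  have h8 : C * (Q J + W J) + (Ca * (Q 0 - Q J) + Cb * ∑ i ∈ Finset.range J, W i)
      ≤ (Ca + Cb) * (‖y‖ ^ 10 + ∑ j ∈ Finset.range (J + 1), W j) := by
    rw [Finset.sum_range_succ] at h5 ⊢
    linarith
  have h9 := mul_le_mul_of_nonneg_left h8 hL
  rw [e]
  linarith

theorem sum_lintegral_Ico (φ : ℝ → ℝ≥0∞) {τ : ℝ} (hτ : 0 ≤ τ) (n : ℕ) :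
    ∑ j ∈ Finset.range (n + 1), ∫⁻ s in Set.Ico (((j : ℝ) - 1) * τ) (j * τ), φ s
      = ∫⁻ s in Set.Ico (-τ) (n * τ), φ s := by
  induction n with
  | zero => simp
  | succ n ih =>
    have h : (0 : ℝ) ≤ n * τ := by positivity
    rw [Finset.sum_range_succ, ih, Nat.cast_succ, add_sub_cancel_right,
      ← lintegral_union measurableSet_Ico (Set.Ico_disjoint_Ico_same),
      Set.Ico_union_Ico_eq_Ico (by linarith) (by linarith)]

theorem measurable_flow_left {Ω : Type*} [MeasurableSpace Ω] {V : Ω → ℝ≥0∞} {φ : ℝ → Ω → Ω}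
    (h : Measurable fun q : ℝ × Ω => V (φ q.1 q.2)) (w : Ω) : Measurable fun s : ℝ => V (φ s w) :=
  h.comp measurable_prodMk_right

theorem measurable_dyadicSum_shift_left (hα : 0 < α) (p : ℝ) (w : PathSpace m α) :
    Measurable fun s : ℝ => dyadicSum p (shift s w) :=
  measurable_flow_left (V := dyadicSum p) (φ := shift) (measurable_dyadicSum_shift hα p) w

theorem exists_le_of_lintegral_Ico_le {φ : ℝ → ℝ≥0∞} (hφ : Measurable φ) {a b v : ℝ}
    (h : 1 / 2 ≤ b - a) (hv : 0 ≤ v) (hI : ∫⁻ s in Set.Ico a b, φ s ≤ ENNReal.ofReal v) :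
    ∃ s ∈ Set.Ico a b, φ s ≤ ENNReal.ofReal (2 * v) := by
  have hvol : volume (Set.Ico a b) = ENNReal.ofReal (b - a) := Real.volume_Ico
  obtain ⟨s, hs, hsI⟩ := exists_le_setLAverage (μ := volume) (s := Set.Ico a b) (f := φ)
    (by rw [hvol]; exact (ENNReal.ofReal_pos.mpr (by linarith)).ne')
    (by rw [hvol]; exact ENNReal.ofReal_ne_top) hφ.aemeasurable
  refine ⟨s, hs, hsI.trans ?_⟩
  rw [setLAverage_eq, hvol]
  refine ENNReal.div_le_of_le_mul (hI.trans ?_)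
  rw [← ENNReal.ofReal_mul (by positivity)]
  refine ENNReal.ofReal_le_ofReal ?_
  have := mul_le_mul_of_nonneg_left h hv
  linarith

/-- Some time s in [a, b) has a dyadic sum of at most twice the integral, because b − a ≥ 1/2. That
sum governs [s, s + 2], which contains [b, b + 1] because b − a ≤ 1. Time integrals thus replace
values at the grid times, at the cost of looking back before b. -/
theorem exists_isHolderOn_one (m : ℕ) (hα : 0 < α) {p : ℝ} (hp : 50 ≤ p) :
    ∃ C : ℝ, 0 < C ∧ ∀ (w : PathSpace m α) (a b v : ℝ), 1 / 2 ≤ b - a → b - a ≤ 1 → 0 ≤ v →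
      ∫⁻ s in Set.Ico a b, dyadicSum p (shift s w) ≤ ENNReal.ofReal v →
      ∃ N : ℝ, 0 ≤ N ∧ IsHolderOn (shift b w) N 1 ∧ (1 + N) ^ 50 ≤ C * (1 + 2 * v) := by
  obtain ⟨C, hC, H⟩ := exists_isHolderOn m hα hp
  refine ⟨C, hC, fun w a b v h1 h2 hv hI => ?_⟩
  obtain ⟨s, hs, h3⟩ :=
    exists_le_of_lintegral_Ico_le (measurable_dyadicSum_shift_left hα p w) h1 hv hI
  obtain ⟨N, hN, hw, hb⟩ := H _ _ (mul_nonneg zero_le_two hv) h3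
  refine ⟨N, hN, ?_, hb⟩
  have h4 := hw.shift (h := b - s) (τ' := 1) (by linarith [hs.2]) (by linarith [hs.1])
  rwa [← shift_add, sub_add_cancel] at h4
/-- Pathwise contraction of the scheme, with a rate that is controlled by the integral of the
moment functional along the flow of shifts. -/
theorem exists_contraction (m : ℕ) (hα : 1 / 3 < α) (hα' : α ≤ 1 / 2) (hf : DriftBound f D Lf)
    {p : ℝ} (hp : 50 ≤ p) :
    ∃ C : ℝ, 0 < C ∧ ∀ {g : Vec d → (Vec m →L[ℝ] Vec d)}
      {Δ γ c₁ c₂ c₃ L : ℝ}, StepBound Δ D Lf → Δ ≤ 1 / 2 → CoefBound g γ c₁ c₂ c₃ →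
      SizeBound γ c₁ c₂ c₃ L → ∀ (k : ℕ) (w : PathSpace m α) (v : ℝ), 0 ≤ v →
      ∫⁻ s in Set.Ico (-1) (k * Δ), dyadicSum p (shift s w) ≤ ENNReal.ofReal v →
      ∀ y u : Vec d, ‖euler f g Δ k w u - euler f g Δ k w y‖
        ≤ Real.exp (-(D / 8 * (k * Δ)) + L * (C * (‖y‖ ^ 10 + 1 + k * Δ + v))) * ‖u - y‖ := by
  obtain ⟨C₁, hC₁, H₁⟩ := exists_chain_bound hα hα' hf
  obtain ⟨C₂, hC₂, H₂⟩ := exists_isHolderOn_one m (by linarith : 0 < α) hp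
  refine ⟨C₁ * (1 + 2 * C₂) + 1, by positivity, ?_⟩
  intro g Δ γ c₁ c₂ c₃ L hΔ hΔ1 hg hs k w v hv hI y u
  have hL := hs.nonneg
  have hΔ0 := hΔ.pos
  -- Blocks of n₀ steps last between 1/2 and 1 because Δ ≤ 1/2. Block j draws on the window before
  -- it, so the time integral starts at −1.
  set n₀ := ⌈1 / (2 * Δ)⌉₊ with hn₀
  have hτ : 1 / 2 ≤ n₀ * Δ := by
    have h1 := Nat.le_ceil (1 / (2 * Δ))
    have h2 := mul_le_mul_of_nonneg_right h1 hΔ0.le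
    have h3 : 1 / (2 * Δ) * Δ = 1 / 2 := by field_simp
    linarith
  have hτ1 : n₀ * Δ ≤ 1 := by
    have h1 := (Nat.ceil_lt_add_one (by positivity : 0 ≤ 1 / (2 * Δ))).le
    have h2 := mul_le_mul_of_nonneg_right h1 hΔ0.le
    have h3 : (1 / (2 * Δ) + 1) * Δ = 1 / 2 + Δ := by field_simp
    linarith
  have hn : 0 < n₀ := by
    rcases Nat.eq_zero_or_pos n₀ with h | h
    · rw [h, Nat.cast_zero, zero_mul] at hτ; norm_num at hτ
    · exact h
  set J := k / n₀ with hJ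
  have hk : J * n₀ + k % n₀ = k := by rw [mul_comm]; exact Nat.div_add_mod k n₀
  set τ := (n₀ : ℝ) * Δ with hτdef
  have hJk : (J : ℝ) * τ ≤ k * Δ := by
    have : ((J * n₀ : ℕ) : ℝ) ≤ k := by exact_mod_cast Nat.div_mul_le_self k n₀
    have := mul_le_mul_of_nonneg_right this hΔ0.le
    push_cast at this
    linarith
  set I : ℕ → ℝ≥0∞ := fun j =>
    ∫⁻ s in Set.Ico (((j : ℝ) - 1) * τ) (j * τ), dyadicSum p (shift s w) with hIdef
  have hsum : ∑ j ∈ Finset.range (J + 1), I j ≤ ENNReal.ofReal v := by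
    rw [hIdef, sum_lintegral_Ico _ (by positivity)]
    exact (lintegral_mono_set (Set.Ico_subset_Ico (by linarith) hJk)).trans hI
  have hfin : ∀ j ∈ Finset.range (J + 1), I j ≠ ⊤ :=
    fun j hj => ne_top_of_le_ne_top ENNReal.ofReal_ne_top
      ((Finset.single_le_sum (f := I) (fun _ _ => zero_le) hj).trans hsum)
  have hsum' : ∑ j ∈ Finset.range (J + 1), (I j).toReal ≤ v := by
    rw [← ENNReal.toReal_sum hfin]
    exact ENNReal.toReal_le_of_le_ofReal hv hsum
  have h1 := H₁ hΔ hg hs n₀ hτ hτ1 J (k % n₀) w (fun j => C₂ * (1 + 2 * (I j).toReal))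
    (Nat.mod_lt k hn).le (fun j hj => H₂ w (((j : ℝ) - 1) * τ) (j * τ) _ (by linarith) (by linarith)
      ENNReal.toReal_nonneg (by
        rw [ENNReal.ofReal_toReal (hfin j (by simpa using by omega))])) y u
  rw [hk] at h1
  refine h1.trans (mul_le_mul_of_nonneg_right (Real.exp_le_exp.mpr
    (add_le_add le_rfl (mul_le_mul_of_nonneg_left ?_ hL))) (norm_nonneg _))
  have h2 : ∑ j ∈ Finset.range (J + 1), C₂ * (1 + 2 * (I j).toReal)
      = C₂ * ((J + 1) + 2 * ∑ j ∈ Finset.range (J + 1), (I j).toReal) := by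
    rw [← Finset.mul_sum, Finset.sum_add_distrib, ← Finset.mul_sum]
    simp
  have h3 : (J : ℝ) ≤ 2 * (k * Δ) := by
    have := mul_le_mul_of_nonneg_left hτ (Nat.cast_nonneg J : (0 : ℝ) ≤ J)
    linarith
  have h4 : ∑ j ∈ Finset.range (J + 1), C₂ * (1 + 2 * (I j).toReal)
      ≤ 2 * C₂ * (1 + k * Δ + v) := by
    rw [h2]
    have := mul_le_mul_of_nonneg_left (by linarith :
      (J : ℝ) + 1 + 2 * ∑ j ∈ Finset.range (J + 1), (I j).toReal ≤ 2 * (1 + k * Δ + v)) hC₂.le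
    linarith
  have h5 : 0 ≤ ‖y‖ ^ 10 := by positivity
  have h6 : 0 ≤ (k : ℝ) * Δ := by positivity
  have h7 : ‖y‖ ^ 10 + ∑ j ∈ Finset.range (J + 1), C₂ * (1 + 2 * (I j).toReal)
      ≤ (1 + 2 * C₂) * (‖y‖ ^ 10 + 1 + k * Δ + v) := by
    have := mul_nonneg hC₂.le h5
    linarith
  have h8 := mul_le_mul_of_nonneg_left h7 hC₁
  linarith

end Chain

/-! ### Linear growth of the noise functional along the flow. -/

section Noise

/-- The smallest admissible constant is a countable supremum of truncated differences, hence
measurable, and the hypothesis makes it finite almost surely. -/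
theorem exists_measurable_bound {Ω : Type*} [MeasurableSpace Ω] {P : Measure Ω}
    {G : ℕ → Ω → ℝ≥0∞} (hG : ∀ k, Measurable (G k)) {a : ℕ → ℝ} (ha : ∀ k, 0 ≤ a k)
    (h : ∀ᵐ w ∂P, ∃ C : ℕ, ∀ k, G k w ≤ ENNReal.ofReal (a k) + C) :
    ∃ B : Ω → ℝ, Measurable B ∧ (∀ w, 0 ≤ B w) ∧
      ∀ᵐ w ∂P, ∀ k, G k w ≤ ENNReal.ofReal (a k + B w) := by
  refine ⟨fun w => (⨆ k, (G k w - ENNReal.ofReal (a k))).toReal,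
    (Measurable.iSup fun k => (hG k).sub measurable_const).ennreal_toReal,
    fun w => ENNReal.toReal_nonneg, ?_⟩
  filter_upwards [h] with w ⟨C, hC⟩ k
  have h1 : ⨆ k, (G k w - ENNReal.ofReal (a k)) ≠ ⊤ :=
    ne_top_of_le_ne_top (ENNReal.natCast_ne_top C)
      (iSup_le fun k => tsub_le_iff_left.mpr (hC k))
  rw [ENNReal.ofReal_add (ha k) ENNReal.toReal_nonneg, ENNReal.ofReal_toReal h1]
  exact tsub_le_iff_left.mp (le_iSup (fun k => G k w - ENNReal.ofReal (a k)) k)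

theorem lintegral_Ico_neg (φ : ℝ → ℝ≥0∞) (n : ℝ) :
    ∫⁻ s in Set.Ico (-n) 0, φ s = ∫⁻ s in Set.Ico 0 n, φ (-s) := by
  have h := (Measure.measurePreserving_neg (volume : Measure ℝ)).setLIntegral_comp_emb
    (MeasurableEquiv.neg ℝ).measurableEmbedding φ (Set.Ico 0 n)
  rw [h, Set.image_neg_eq_neg, Set.neg_Ico, neg_zero]
  exact setLIntegral_congr Ico_ae_eq_Ioc

/-- Linear bounds for the integral along the flow, with a measurable random constant. -/
theorem exists_flow_bound {Ω : Type*} [MeasurableSpace Ω] {P : Measure Ω} [IsProbabilityMeasure P]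
    {φ : ℝ → Ω → Ω} {V : Ω → ℝ≥0∞} (hzero : ∀ w, φ 0 w = w)
    (hadd : ∀ s t w, φ (s + t) w = φ s (φ t w)) (hmp : ∀ t, MeasurePreserving (φ t) P P)
    (herg : ∀ A, MeasurableSet A → (∀ t, φ t ⁻¹' A = A) → P A = 0 ∨ P A = 1)
    (hV : Measurable fun q : ℝ × Ω => V (φ q.1 q.2)) {c : ℝ} (hc : 0 < c)
    (hVc : ∫⁻ w, V w ∂P < ENNReal.ofReal c) {Δ : ℝ} (hΔ : 0 < Δ) :
    ∃ B : Ω → ℝ, Measurable B ∧ (∀ w, 0 ≤ B w) ∧ ∀ᵐ w ∂P, ∀ k : ℕ,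
      ∫⁻ s in Set.Ico (-1) (k * Δ), V (φ s w) ≤ ENNReal.ofReal (c * (k * Δ) + B w) ∧
      ∫⁻ s in Set.Ico (-1) (k * Δ), V (φ s (φ (-(k * Δ)) w))
        ≤ ENNReal.ofReal (c * (k * Δ) + B w) := by
  have hmeas : ∀ a b : ℝ, Measurable fun w => ∫⁻ s in Set.Ico a b, V (φ s w) := fun a b =>
    Measurable.lintegral_prod_left' (f := fun q : ℝ × Ω => V (φ q.1 q.2)) hV
  have hf := ae_lintegral_flow_le hzero hadd hmp herg hV hc hVc
  -- The reversed flow has the same invariant sets, so the forward result also bounds integrals over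
  -- the past.
  have hb := ae_lintegral_flow_le (φ := fun t => φ (-t)) (V := V) (μ := P)
    (by simpa using hzero) (fun s t w => by rw [neg_add, hadd]) (fun t => hmp (-t))
    (fun A hA h => herg A hA fun t => by simpa using h (-t))
    (hV.comp (measurable_fst.neg.prodMk measurable_snd)) hc hVc
  obtain ⟨B, hB, hB0, h⟩ := exists_measurable_bound (P := P)
    (G := fun k w => max (∫⁻ s in Set.Ico (-1) (k * Δ), V (φ s w))
      (∫⁻ s in Set.Ico (-1 + -(k * Δ)) (k * Δ + -(k * Δ)), V (φ s w)))
    (a := fun k => c * (k * Δ)) (fun k => (hmeas _ _).max (hmeas _ _)) (fun k => by positivity) (by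
      filter_upwards [hf, hb] with w ⟨C₁, h₁⟩ ⟨C₂, h₂⟩
      have h₁' : ∀ x : ℝ, 0 ≤ x → ∫⁻ s in Set.Ico 0 x, V (φ s w)
          ≤ ENNReal.ofReal (c * x) + (ENNReal.ofReal c + C₁) := by
        intro x hx
        refine (lintegral_mono_set (Set.Ico_subset_Ico_right (Nat.le_ceil x))).trans
          ((h₁ ⌈x⌉₊).trans ?_)
        rw [← add_assoc, ← ENNReal.ofReal_add (by positivity) hc.le]
        gcongr
        have := (Nat.ceil_lt_add_one hx).le
        have := mul_le_mul_of_nonneg_left this hc.le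
        linarith
      have h₂' : ∀ x : ℝ, 0 ≤ x → ∫⁻ s in Set.Ico (-x) 0, V (φ s w)
          ≤ ENNReal.ofReal (c * x) + (ENNReal.ofReal c + C₂) := by
        intro x hx
        rw [lintegral_Ico_neg]
        refine (lintegral_mono_set (Set.Ico_subset_Ico_right (Nat.le_ceil x))).trans
          ((h₂ ⌈x⌉₊).trans ?_)
        rw [← add_assoc, ← ENNReal.ofReal_add (by positivity) hc.le]
        gcongr
        have := (Nat.ceil_lt_add_one hx).le
        have := mul_le_mul_of_nonneg_left this hc.le
        linarith
      -- One c pays for [−1, 0), the other two for rounding the end points of the forward and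
      -- backward integrals up to integers.
      obtain ⟨C, hC⟩ := exists_nat_ge (3 * c)
      refine ⟨C + C₁ + C₂, fun k => ?_⟩
      have hk : (0 : ℝ) ≤ k * Δ := by positivity
      have hC' : ENNReal.ofReal c + ENNReal.ofReal c + ENNReal.ofReal c ≤ (C : ℝ≥0∞) := by
        rw [← ENNReal.ofReal_add hc.le hc.le, ← ENNReal.ofReal_add (by positivity) hc.le]
        exact ENNReal.ofReal_le_of_le_toReal (by simpa using by linarith)
      refine max_le ?_ ?_
      · rw [← Set.Ico_union_Ico_eq_Ico (by norm_num : (-1 : ℝ) ≤ 0) hk]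
        refine (lintegral_union_le _ _ _).trans ((add_le_add (h₂' 1 zero_le_one) (h₁' _ hk)).trans ?_)
        push_cast
        calc _ = ENNReal.ofReal (c * (k * Δ)) + (ENNReal.ofReal c + ENNReal.ofReal c
              + ENNReal.ofReal c + C₁ + C₂) := by rw [mul_one]; ring
          _ ≤ _ := by gcongr
      · rw [add_neg_cancel, ← neg_add]
        refine (h₂' _ (by positivity)).trans ?_
        rw [mul_add, mul_one, ENNReal.ofReal_add hc.le (by positivity)]
        push_cast
        calc _ = ENNReal.ofReal (c * (k * Δ)) + (ENNReal.ofReal c + ENNReal.ofReal c + 0 + 0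
              + C₂) := by ring
          _ ≤ ENNReal.ofReal (c * (k * Δ)) + (ENNReal.ofReal c + ENNReal.ofReal c
              + ENNReal.ofReal c + C₁ + C₂) := by gcongr <;> exact zero_le
          _ ≤ _ := by gcongr)
  refine ⟨B, hB, hB0, ?_⟩
  filter_upwards [h] with w hw k
  refine ⟨(le_max_left _ _).trans (hw k), ?_⟩
  rw [lintegral_flow_shift hadd]
  exact (le_max_right _ _).trans (hw k)

variable {m : ℕ} {α : ℝ}

/-- The coefficient-free part of the contraction estimate: under the moment bound, the integral of
the moment functional grows linearly along the flow, forward and backward. -/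
theorem exists_dyadicSum_flow_bound {ν : ℝ} (hα : 0 < α) (hαν : α < ν)
    {P : Measure (PathSpace m α)} [IsProbabilityMeasure P] (hS : StationaryIncrements P)
    (hE : ShiftErgodic P) (hM : MomentBound ν P) :
    ∃ p c : ℝ, 50 ≤ p ∧ 0 < c ∧ ∀ Δ : ℝ, 0 < Δ →
      ∃ B : PathSpace m α → ℝ, Measurable B ∧ (∀ w, 0 ≤ B w) ∧ ∀ᵐ w ∂P, ∀ k : ℕ,
      ∫⁻ s in Set.Ico (-1) (k * Δ), dyadicSum p (shift s w)
        ≤ ENNReal.ofReal (c * (k * Δ) + B w) ∧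
      ∫⁻ s in Set.Ico (-1) (k * Δ), dyadicSum p (shift s (shift (-(k * Δ)) w))
        ≤ ENNReal.ofReal (c * (k * Δ) + B w) := by
  have h1 : 0 < ν - α := by linarith
  -- The 50 serves the Hölder constants; the other entry makes p(ν − α) ≥ 2, so the dyadic sum is
  -- integrable. Its mean plus one is the slope c.
  set p := max 50 (2 / (ν - α)) with hp
  have hp50 : 50 ≤ p := le_max_left _ _
  have hp2 : 2 ≤ p * (ν - α) := by
    have h2 : 2 / (ν - α) ≤ p := le_max_right _ _
    rwa [div_le_iff₀ h1] at h2
  have hpα : 0 ≤ p * α := by positivity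
  have hfin := lintegral_dyadicSum_lt_top hM (p := p) (by linarith) (by linarith) (by linarith)
  refine ⟨p, (∫⁻ w, dyadicSum p w ∂P).toReal + 1, hp50, by positivity, fun Δ hΔ => ?_⟩
  refine exists_flow_bound (φ := shift) (V := dyadicSum p) shift_zero shift_add hS hE
    (measurable_dyadicSum_shift hα p) (by positivity) ?_ hΔ
  rw [ENNReal.ofReal_add ENNReal.toReal_nonneg zero_le_one, ENNReal.ofReal_toReal hfin.ne]
  exact ENNReal.lt_add_right hfin.ne (by simp)

end Noise

/-! ### Measurability, linear growth and random geometric series. -/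

section Regularity

variable {d m : ℕ} {α : ℝ} {f : Vec d → Vec d} {g : Vec d → (Vec m →L[ℝ] Vec d)} {Δ : ℝ}

/-- One step of the scheme, as a function of the state and of the increments of the noise. -/
noncomputable def stepMap (f : Vec d → Vec d) (g : Vec d → (Vec m →L[ℝ] Vec d)) (Δ : ℝ)
    (q : Vec d × Vec m × Tens m) : Vec d :=
  q.1 + Δ • f q.1 + g q.1 q.2.1 + secondOrder g q.1 q.2.2

theorem continuous_stepMap (hf : Continuous f) (hg : ContDiff ℝ 1 g) :
    Continuous (stepMap f g Δ) := by
  have h1 : Continuous g := hg.continuous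
  have h2 : Continuous (fderiv ℝ g) := hg.continuous_fderiv (by norm_num)
  refine ((continuous_fst.add ((hf.comp continuous_fst).const_smul Δ)).add
    ((h1.comp continuous_fst).clm_apply continuous_snd.fst)).add ?_
  refine continuous_finsetSum _ fun i _ => continuous_finsetSum _ fun j _ => ?_
  have h3 : Continuous fun q : Vec d × Vec m × Tens m => q.1 := continuous_fst
  have h4 : Continuous fun q : Vec d × Vec m × Tens m => q.2.2 (i, j) := by fun_prop
  exact h4.smul (((h2.comp h3).clm_apply
    ((h1.comp h3).clm_apply continuous_const)).clm_apply continuous_const)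

theorem euler_succ_eq_stepMap (k : ℕ) (w : PathSpace m α) (y : Vec d) :
    euler f g Δ (k + 1) w y = stepMap f g Δ (euler f g Δ k w y, lvl1 w (k * Δ) ((k + 1) * Δ),
      lvl2 w (k * Δ) ((k + 1) * Δ)) := rfl

theorem continuous_euler (hf : Continuous f) (hg : ContDiff ℝ 1 g) (k : ℕ) (w : PathSpace m α) :
    Continuous (euler f g Δ k w) := by
  induction k with
  | zero => exact continuous_id
  | succ k ih =>
    exact (continuous_stepMap hf hg).comp (ih.prodMk continuous_const)

theorem measurable_euler (hf : Continuous f) (hg : ContDiff ℝ 1 g) (k : ℕ) (y : Vec d) :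
    Measurable fun w : PathSpace m α => euler f g Δ k w y := by
  induction k with
  | zero => exact measurable_const
  | succ k ih =>
    have h := ih.prodMk ((measurable_lvl1 (m := m) (α := α) (k * Δ) ((k + 1) * Δ)).prodMk
      (measurable_lvl2 (k * Δ) ((k + 1) * Δ)))
    simp only [euler_succ_eq_stepMap]
    exact Measurable.comp (g := stepMap f g Δ) (continuous_stepMap hf hg).measurable h

theorem shift_iterate (t : ℝ) (k : ℕ) (w : PathSpace m α) : (shift t)^[k] w = shift (k * t) w := by
  induction k with
  | zero => simp [shift_zero]
  | succ k ih =>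
    rw [Function.iterate_succ_apply', ih, ← shift_add]
    congr 1
    push_cast
    ring

/-- One step of the scheme has linear growth, with an integrable random constant. -/
theorem exists_linear_growth {γ c₁ c₂ c₃ Lf ν : ℝ} (hf : ∀ x y, ‖f x - f y‖ ≤ Lf * ‖x - y‖)
    (hg : CoefBound g γ c₁ c₂ c₃) {P : Measure (PathSpace m α)} [IsProbabilityMeasure P]
    (hν : 1 / 3 < ν) (hM : MomentBound ν P) (hΔ : 0 < Δ) :
    ∃ b : PathSpace m α → ℝ, Measurable b ∧ (∀ w, 0 ≤ b w) ∧ ∫⁻ w, ENNReal.ofReal (b w) ∂P < ⊤ ∧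
      ∀ w y, ‖euler f g Δ 1 w y‖ ≤ (1 + Δ * Lf) * ‖y‖ + b w := by
  have n0 := hg.nonneg₀
  have n1 := hg.nonneg₁
  set A := γ + c₁ * γ * m ^ 2 with hA
  have hA0 : 0 ≤ A := by positivity
  refine ⟨fun w => Δ * ‖f 0‖ + A * (‖lvl1 w 0 Δ‖ + ‖lvl2 w 0 Δ‖), ?_, fun w => by positivity, ?_, ?_⟩
  · exact measurable_const.add
      (((measurable_lvl1 0 Δ).norm.add (measurable_lvl2 0 Δ).norm).const_mul A)
  · obtain ⟨C, hC, h⟩ := hM 4 (by linarith) Δ hΔ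
    have h1 := h 0 ⟨le_rfl, hΔ.le⟩ Δ ⟨hΔ.le, le_rfl⟩
    have h2 : ∀ w : PathSpace m α,
        ENNReal.ofReal (Δ * ‖f 0‖ + A * (‖lvl1 w 0 Δ‖ + ‖lvl2 w 0 Δ‖))
        ≤ ENNReal.ofReal (Δ * ‖f 0‖ + 2 * A) + ENNReal.ofReal A *
          (‖lvl1 w 0 Δ‖ₑ ^ (4 : ℝ) + ‖lvl2 w 0 Δ‖ₑ ^ ((4 : ℝ) / 2)) := by
      intro w
      rw [← ofReal_norm, ← ofReal_norm,
        ENNReal.ofReal_rpow_of_nonneg (norm_nonneg _) (by norm_num),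
        ENNReal.ofReal_rpow_of_nonneg (norm_nonneg _) (by norm_num),
        ← ENNReal.ofReal_add (by positivity) (by positivity), ← ENNReal.ofReal_mul hA0,
        ← ENNReal.ofReal_add (by positivity) (by positivity)]
      refine ENNReal.ofReal_le_ofReal ?_
      have e1 : ‖lvl1 w 0 Δ‖ ^ (4 : ℝ) = ‖lvl1 w 0 Δ‖ ^ 4 := by
        exact_mod_cast Real.rpow_natCast ‖lvl1 w 0 Δ‖ 4
      have e2 : ‖lvl2 w 0 Δ‖ ^ ((4 : ℝ) / 2) = ‖lvl2 w 0 Δ‖ ^ 2 := by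
        norm_num
      rw [e1, e2]
      have e3 : ‖lvl1 w 0 Δ‖ ≤ 1 + ‖lvl1 w 0 Δ‖ ^ 4 := by
        nlinarith [sq_nonneg (‖lvl1 w 0 Δ‖ ^ 2 - 1), sq_nonneg (‖lvl1 w 0 Δ‖ - 1)]
      have e4 : ‖lvl2 w 0 Δ‖ ≤ 1 + ‖lvl2 w 0 Δ‖ ^ 2 := by
        nlinarith [sq_nonneg (‖lvl2 w 0 Δ‖ - 1)]
      have := mul_le_mul_of_nonneg_left (add_le_add e3 e4) hA0
      linarith
    refine (lintegral_mono h2).trans_lt ?_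
    rw [lintegral_add_left measurable_const, lintegral_const_mul' _ _ ENNReal.ofReal_ne_top,
      lintegral_const, measure_univ, mul_one]
    exact ENNReal.add_lt_top.mpr ⟨ENNReal.ofReal_lt_top, ENNReal.mul_lt_top ENNReal.ofReal_lt_top
      (h1.trans_lt ENNReal.ofReal_lt_top)⟩
  · intro w y
    have e : euler f g Δ 1 w y = y + Δ • f y + g y (lvl1 w 0 Δ) + secondOrder g y (lvl2 w 0 Δ) := by
      simp [euler]
    have h1 : ‖f y‖ ≤ ‖f 0‖ + Lf * ‖y‖ := by
      have := hf y 0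
      rw [sub_zero] at this
      linarith [norm_le_norm_add_norm_sub' (f y) (f 0)]
    have h2 : ‖Δ • f y‖ ≤ Δ * (‖f 0‖ + Lf * ‖y‖) := by
      rw [norm_smul, Real.norm_of_nonneg hΔ.le]
      exact mul_le_mul_of_nonneg_left h1 hΔ.le
    have h3 := (g y).le_of_opNorm_le (hg.norm_le y) (lvl1 w 0 Δ)
    have h4 := (hg.norm_secondOrder_le y (lvl2 w 0 Δ)).trans
      (mul_le_mul_of_nonneg_left (l1_le _) (by positivity))
    have h5 : 0 ≤ c₁ * γ * m ^ 2 * ‖lvl1 w 0 Δ‖ := by positivity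
    have h6 : 0 ≤ γ * ‖lvl2 w 0 Δ‖ := by positivity
    rw [e]
    refine (norm_add_le _ _).trans ((add_le_add (norm_add₃_le.trans
      (add_le_add (add_le_add le_rfl h2) h3)) h4).trans ?_)
    rw [hA]
    linarith

/-- A geometric series along the iterates of a measure preserving map converges. -/
theorem ae_summable_geometric_iterate {Ω : Type*} [MeasurableSpace Ω] {P : Measure Ω}
    {b : Ω → ℝ} (hb : Measurable b) (hb0 : ∀ w, 0 ≤ b w)
    (hbi : ∫⁻ w, ENNReal.ofReal (b w) ∂P < ⊤) {T : ℕ → Ω → Ω}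
    (hT : ∀ k, MeasurePreserving (T k) P P) {q : ℝ} (hq0 : 0 ≤ q) (hq : q < 1) :
    ∀ᵐ w ∂P, Summable fun k : ℕ => q ^ k * b (T k w) := by
  have h1 : ∫⁻ w, ∑' k : ℕ, ENNReal.ofReal (q ^ k * b (T k w)) ∂P < ⊤ := by
    have hm : ∀ k, Measurable fun w => ENNReal.ofReal (q ^ k * b (T k w)) := fun k =>
      ((hb.comp (hT k).measurable).const_mul _).ennreal_ofReal
    rw [lintegral_tsum fun k => (hm k).aemeasurable]
    have h2 : ∀ k, ∫⁻ w, ENNReal.ofReal (q ^ k * b (T k w)) ∂P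
        = ENNReal.ofReal (q ^ k) * ∫⁻ w, ENNReal.ofReal (b w) ∂P := by
      intro k
      rw [← (hT k).lintegral_comp hb.ennreal_ofReal,
        ← lintegral_const_mul' _ _ ENNReal.ofReal_ne_top]
      exact lintegral_congr fun w => ENNReal.ofReal_mul (by positivity)
    simp_rw [h2]
    rw [ENNReal.tsum_mul_right]
    refine ENNReal.mul_lt_top ?_ hbi
    rw [← ENNReal.ofReal_tsum_of_nonneg (fun k => by positivity) (summable_geometric_of_lt_one hq0 hq)]
    exact ENNReal.ofReal_lt_top
  have hm : AEMeasurable (fun w => ∑' k : ℕ, ENNReal.ofReal (q ^ k * b (T k w))) P :=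
    (Measurable.tsum fun k =>
      ((hb.comp (hT k).measurable).const_mul _).ennreal_ofReal).aemeasurable
  filter_upwards [ae_lt_top' hm h1.ne] with w hw
  have h3 := ENNReal.summable_toReal hw.ne
  refine h3.congr fun k => ?_
  rw [ENNReal.toReal_ofReal]
  have := hb0 (T k w)
  positivity

end Regularity

/-! ### Stationary solution: existence, uniqueness, stability. -/

section Attractor

variable {d m : ℕ} {α : ℝ} {f : Vec d → Vec d} {g : Vec d → (Vec m →L[ℝ] Vec d)} {Δ : ℝ}
  {P : Measure (PathSpace m α)}

/-- The scheme contracts at an exponential rate, up to a random constant that depends on one of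
the two initial values, both forward and in the pullback sense. -/
structure IsContracting (P : Measure (PathSpace m α)) (f : Vec d → Vec d)
    (g : Vec d → (Vec m →L[ℝ] Vec d)) (Δ μ C : ℝ) (B : PathSpace m α → ℝ) : Prop where
  rate_pos : 0 < μ
  step_pos : 0 < Δ
  measurable : Measurable B
  forward : ∀ᵐ w ∂P, ∀ (k : ℕ) (y u : Vec d), ‖euler f g Δ k w u - euler f g Δ k w y‖
    ≤ Real.exp (-μ * (k * Δ) + C * (‖y‖ ^ 10 + 1 + B w)) * ‖u - y‖
  pullback : ∀ᵐ w ∂P, ∀ (k : ℕ) (y u : Vec d),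
    ‖euler f g Δ k (shift (-(k * Δ)) w) u - euler f g Δ k (shift (-(k * Δ)) w) y‖
    ≤ Real.exp (-μ * (k * Δ) + C * (‖y‖ ^ 10 + 1 + B w)) * ‖u - y‖

/-- One step of the scheme has linear growth, with an integrable random constant. -/
structure IsLinearGrowth (P : Measure (PathSpace m α)) (f : Vec d → Vec d)
    (g : Vec d → (Vec m →L[ℝ] Vec d)) (Δ q : ℝ) (b : PathSpace m α → ℝ) : Prop where
  one_lt : 1 < q
  measurable : Measurable b
  nonneg : ∀ w, 0 ≤ b w
  integrable : ∫⁻ w, ENNReal.ofReal (b w) ∂P < ⊤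
  growth : ∀ w y, ‖euler f g Δ 1 w y‖ ≤ q * ‖y‖ + b w

variable {μ C q : ℝ} {B b : PathSpace m α → ℝ}

theorem exp_neg_mul_nat_mul (μ Δ : ℝ) (k : ℕ) :
    Real.exp (-μ * (k * Δ)) = Real.exp (-(μ * Δ)) ^ k := by
  rw [← Real.exp_nat_mul]; congr 1; ring

theorem IsContracting.exp_lt_one (h : IsContracting P f g Δ μ C B) : Real.exp (-(μ * Δ)) < 1 :=
  Real.exp_lt_one_iff.mpr (neg_lt_zero.mpr (mul_pos h.rate_pos h.step_pos))

theorem shift_shift_neg (t : ℝ) (w : PathSpace m α) : shift t (shift (-t) w) = w := by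
  rw [← shift_add, add_neg_cancel, shift_zero]

/-- The pullback limits of the solution started at `0` exist. -/
theorem exists_pullback_limit (hS : StationaryIncrements P) (hf : Continuous f)
    (hg : ContDiff ℝ 1 g) (h : IsContracting P f g Δ μ C B) (hb : IsLinearGrowth P f g Δ q b) :
    ∃ a : PathSpace m α → Vec d, Measurable a ∧ ∀ᵐ w ∂P,
      Tendsto (fun k : ℕ => euler f g Δ k (shift (-(k * Δ)) w) 0) atTop (𝓝 (a w)) := by
  refine measurable_limit_of_tendsto_metrizable_ae
    (f := fun (k : ℕ) w => euler f g Δ k (shift (-(k * Δ)) w) 0) (fun k =>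
      (Measurable.comp (g := fun w => euler f g Δ k w 0) (f := shift (-(k * Δ)))
        (measurable_euler hf hg k 0) (hS (-(k * Δ))).measurable).aemeasurable) ?_
  have hsum := ae_summable_geometric_iterate hb.measurable hb.nonneg hb.integrable
    (T := fun k => shift (-((k + 1 : ℕ) * Δ))) (fun k => hS _) (Real.exp_pos _).le h.exp_lt_one
  filter_upwards [h.pullback, hsum] with w hw hs
  refine cauchySeq_tendsto_of_complete (cauchySeq_of_summable_dist ?_)
  refine Summable.of_nonneg_of_le (fun k => dist_nonneg) (fun k => ?_)
    (hs.mul_left (Real.exp (C * (‖(0 : Vec d)‖ ^ 10 + 1 + B w))))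
  -- Starting one step earlier means starting k steps back from the image of 0 under one step. The
  -- pullback estimate around 0, with its constant at the fixed w, bounds the change by a geometric
  -- factor times b.
  have e1 : euler f g Δ (k + 1) (shift (-((k + 1 : ℕ) * Δ)) w) 0
      = euler f g Δ k (shift (-(k * Δ)) w) (euler f g Δ 1 (shift (-((k + 1 : ℕ) * Δ)) w) 0) := by
    rw [add_comm k 1, euler_add, ← shift_add]
    congr 2
    push_cast
    ring
  have h1 := hw k 0 (euler f g Δ 1 (shift (-((k + 1 : ℕ) * Δ)) w) 0)
  have h2 := hb.growth (shift (-((k + 1 : ℕ) * Δ)) w) 0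
  rw [norm_zero, mul_zero, zero_add] at h2
  rw [sub_zero, Real.exp_add, exp_neg_mul_nat_mul] at h1
  rw [dist_comm, dist_eq_norm, e1]
  refine h1.trans ((mul_le_mul_of_nonneg_left h2 (by positivity)).trans (le_of_eq ?_))
  ring

theorem ae_shift (hS : StationaryIncrements P) {p : PathSpace m α → Prop} (h : ∀ᵐ w ∂P, p w)
    (t : ℕ → ℝ) : ∀ᵐ w ∂P, ∀ k, p (shift (t k) w) :=
  ae_all_iff.mpr fun k => (hS (t k)).quasiMeasurePreserving.ae h

variable {a : PathSpace m α → Vec d}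

/-- By continuity φ(k, ω) commutes with the limit, and the cocycle property makes its image of the
n-step pullback at ω the (n+k)-step pullback at θ_{kΔ}ω. -/
theorem isStationarySolution_of_tendsto (hS : StationaryIncrements P) (hf : Continuous f)
    (hg : ContDiff ℝ 1 g) (ha : Measurable a) (h : ∀ᵐ w ∂P,
      Tendsto (fun k : ℕ => euler f g Δ k (shift (-(k * Δ)) w) 0) atTop (𝓝 (a w))) :
    IsStationarySolution P f g Δ a := by
  refine ⟨ha, ?_⟩
  filter_upwards [h, ae_shift hS h fun k => k * Δ] with w hw hw' k
  have h1 := ((continuous_euler (Δ := Δ) hf hg k w).tendsto (a w)).comp hw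
  have h2 := (hw' k).comp (tendsto_add_atTop_nat k)
  refine tendsto_nhds_unique h1 (h2.congr fun n => ?_)
  have e : shift (-(((n + k : ℕ) : ℝ) * Δ)) (shift (k * Δ) w) = shift (-(n * Δ)) w := by
    rw [← shift_add]
    congr 1
    push_cast
    ring
  simp only [Function.comp]
  rw [e, euler_add, shift_shift_neg]

/-- The truncated distance of two stationary solutions tends to 0 along forward orbits, while its
mean is constant by invariance of P; so the mean is 0. Neither temperedness nor integrability of a'
is needed. -/
theorem IsStationarySolution.ae_eq [IsProbabilityMeasure P] (hS : StationaryIncrements P)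
    (h : IsContracting P f g Δ μ C B) (ha : IsStationarySolution P f g Δ a)
    {a' : PathSpace m α → Vec d} (ha' : IsStationarySolution P f g Δ a') : a' =ᵐ[P] a := by
  set F : PathSpace m α → ℝ≥0∞ := fun w => min 1 (ENNReal.ofReal ‖a' w - a w‖) with hF
  have hFm : Measurable F := measurable_const.min (ha'.1.sub ha.1).norm.ennreal_ofReal
  have hlim : Tendsto (fun k : ℕ => ∫⁻ w, F (shift (k * Δ) w) ∂P) atTop (𝓝 0) := by
    have h0 : (0 : ℝ≥0∞) = ∫⁻ _, 0 ∂P := by simp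
    rw [h0]
    refine tendsto_lintegral_of_dominated_convergence (fun _ => 1)
      (fun k => hFm.comp (hS _).measurable) (fun k => ae_of_all _ fun w => min_le_left _ _)
      (by simp) ?_
    filter_upwards [h.forward, ha.2, ha'.2] with w h1 h2 h3
    have h4 : ∀ k : ℕ, F (shift (k * Δ) w) ≤ ENNReal.ofReal (Real.exp (-(μ * Δ)) ^ k *
        (Real.exp (C * (‖a w‖ ^ 10 + 1 + B w)) * ‖a' w - a w‖)) := by
      intro k
      refine (min_le_right _ _).trans (ENNReal.ofReal_le_ofReal ?_)
      have := h1 k (a w) (a' w)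
      rw [h2, h3, Real.exp_add, exp_neg_mul_nat_mul, mul_assoc] at this
      exact this
    refine tendsto_of_tendsto_of_tendsto_of_le_of_le tendsto_const_nhds ?_ (fun k => zero_le) h4
    rw [← ENNReal.ofReal_zero]
    refine ENNReal.tendsto_ofReal ?_
    have := (tendsto_pow_atTop_nhds_zero_of_lt_one (Real.exp_pos _).le h.exp_lt_one).mul_const
      (Real.exp (C * (‖a w‖ ^ 10 + 1 + B w)) * ‖a' w - a w‖)
    rwa [zero_mul] at this
  have hconst : ∀ k : ℕ, ∫⁻ w, F (shift (k * Δ) w) ∂P = ∫⁻ w, F w ∂P := fun k =>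
    (hS (k * Δ)).lintegral_comp hFm
  simp_rw [hconst] at hlim
  have h0 : ∫⁻ w, F w ∂P = 0 := tendsto_nhds_unique tendsto_const_nhds hlim
  filter_upwards [(lintegral_eq_zero_iff hFm).mp h0] with w hw
  have h1 : min 1 (ENNReal.ofReal ‖a' w - a w‖) = 0 := hw
  rcases min_eq_iff.mp h1 with h2 | h2
  · exact absurd h2.1 one_ne_zero
  · have h3 := ENNReal.ofReal_eq_zero.mp h2.1
    exact sub_eq_zero.mp (norm_eq_zero.mp (le_antisymm h3 (norm_nonneg _)))

/-- Every stationary solution is exponentially stable. -/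
theorem IsStationarySolution.isExponentiallyStable (h : IsContracting P f g Δ μ C B)
    (ha : IsStationarySolution P f g Δ a) : IsExponentiallyStable P f g Δ a := by
  set β : PathSpace m α → ℝ := fun w => Real.exp (C * (‖a w‖ ^ 10 + 1 + B w)) with hβ
  have hβm : Measurable β :=
    ((((ha.1.norm.pow_const 10).add_const 1).add h.measurable).const_mul C).exp
  have hβ0 : ∀ w, 0 < β w := fun w => Real.exp_pos _
  have key : ∀ᵐ w ∂P, ∀ (y : Vec d) (k : ℕ),
      ‖euler f g Δ k w y - a (shift (k * Δ) w)‖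
        ≤ β w * Real.exp (-μ * (k * Δ)) * ‖y - a w‖ := by
    filter_upwards [h.forward, ha.2] with w h1 h2 y k
    have := h1 k (a w) y
    rw [h2, Real.exp_add, mul_comm (Real.exp _)] at this
    exact this
  have hexp : ∀ k : ℕ, Real.exp (-μ * (k * Δ)) ≤ 1 := fun k => by
    rw [exp_neg_mul_nat_mul]
    exact pow_le_one₀ (Real.exp_pos _).le h.exp_lt_one.le
  refine ⟨fun ε hε => ⟨fun w => ε / (2 * β w), measurable_const.div (hβm.const_mul 2),
    fun w => by have := hβ0 w; positivity, ?_⟩, fun _ => 1, β, μ, measurable_const, hβm,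
    fun _ => one_pos, hβ0, h.rate_pos, ?_⟩
  · filter_upwards [key] with w hw y hy
    refine lt_of_le_of_lt (b := ENNReal.ofReal (ε / 2)) (iSup_le fun k => ?_)
      ((ENNReal.ofReal_lt_ofReal_iff hε).mpr (by linarith))
    rw [edist_dist, dist_eq_norm]
    refine ENNReal.ofReal_le_ofReal ((hw y k).trans ?_)
    have h1 := hβ0 w
    calc β w * Real.exp (-μ * (k * Δ)) * ‖y - a w‖ ≤ β w * 1 * (ε / (2 * β w)) := by
          gcongr
          exact hexp k
      _ = ε / 2 := by field_simp
  · filter_upwards [key] with w hw y hy k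
    refine (hw y k).trans (mul_le_of_le_one_right ?_ hy.le)
    have := hβ0 w
    positivity

end Attractor

/-! ### Temperedness, pullback attraction and the choice of constants. -/

section Attraction

variable {d m : ℕ} {α : ℝ} {f : Vec d → Vec d} {g : Vec d → (Vec m →L[ℝ] Vec d)} {Δ : ℝ}
  {P : Measure (PathSpace m α)} {μ C q : ℝ} {B b : PathSpace m α → ℝ} {a : PathSpace m α → Vec d}

theorem IsLinearGrowth.norm_euler_le (hb : IsLinearGrowth P f g Δ q b) (w : PathSpace m α)
    (y : Vec d) (k : ℕ) : ‖euler f g Δ k w y‖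
      ≤ q ^ k * (‖y‖ + ∑ j ∈ Finset.range k, q⁻¹ ^ j * b (shift (j * Δ) w)) := by
  have hq : 0 < q := by linarith [hb.one_lt]
  induction k with
  | zero => simp [euler]
  | succ k ih =>
    have h1 := hb.growth (shift (k * Δ) w) (euler f g Δ k w y)
    have h2 := mul_le_mul_of_nonneg_left ih hq.le
    have h3 : b (shift (k * Δ) w) ≤ q ^ (k + 1) * (q⁻¹ ^ k * b (shift (k * Δ) w)) := by
      have e : q ^ (k + 1) * (q⁻¹ ^ k * b (shift (k * Δ) w)) = q * b (shift (k * Δ) w) := by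
        rw [pow_succ, inv_pow]; field_simp
      rw [e]
      exact le_mul_of_one_le_left (hb.nonneg _) hb.one_lt.le
    rw [euler_add, Finset.sum_range_succ]
    refine h1.trans ((add_le_add h2 h3).trans (le_of_eq ?_))
    ring

/-- A stationary solution is tempered. -/
theorem IsStationarySolution.isTempered [IsProbabilityMeasure P] (hS : StationaryIncrements P)
    (hb : IsLinearGrowth P f g Δ q b) (ha : IsStationarySolution P f g Δ a) :
    IsTempered P Δ fun w => {a w} := by
  refine ⟨fun w => ‖a w‖, ha.1.norm, ae_of_all _ fun w => by simp, ?_⟩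
  have hq : 0 < q := by linarith [hb.one_lt]
  have hsum := ae_summable_geometric_iterate hb.measurable hb.nonneg hb.integrable
    (T := fun k => shift (k * Δ)) (fun k => hS _) (inv_nonneg.mpr hq.le)
    (inv_lt_one_of_one_lt₀ hb.one_lt)
  have hu : Measurable fun w => Real.posLog ‖a w‖ :=
    Real.continuous_posLog.measurable.comp ha.1.norm
  -- Iterating the linear growth bounds log⁺‖a‖ along forward orbits with slope log⁺ q. Recurrence
  -- makes the growth sublinear in both time directions.
  have main := ae_tendsto_iterate_div_of_le (hS Δ) (hS (-Δ)) (shift_shift_neg Δ) hu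
    (fun _ => Real.posLog_nonneg) (c := Real.posLog q) Real.posLog_nonneg (by
      filter_upwards [hsum, ha.2] with w hs hw
      set S := ∑' k : ℕ, q⁻¹ ^ k * b (shift (k * Δ) w) with hSdef
      refine ⟨Real.posLog (‖a w‖ + S), fun k => ?_⟩
      rw [shift_iterate, ← hw]
      have h1 : ‖euler f g Δ k w (a w)‖ ≤ q ^ k * (‖a w‖ + S) := by
        refine (hb.norm_euler_le w (a w) k).trans (mul_le_mul_of_nonneg_left ?_ (by positivity))
        refine add_le_add le_rfl (hs.sum_le_tsum _ fun j _ => ?_)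
        have := hb.nonneg (shift (j * Δ) w)
        positivity
      refine (Real.posLog_le_posLog (norm_nonneg _) h1).trans (Real.posLog_mul.trans ?_)
      rw [Real.posLog_pow]
      linarith)
  simp only [shift_iterate, mul_neg] at main
  exact main

theorem le_exp_posLog (x : ℝ) : x ≤ Real.exp (Real.posLog x) := by
  rcases le_or_gt x 1 with h | h
  · exact h.trans (Real.one_le_exp Real.posLog_nonneg)
  · rw [Real.posLog_eq_log (h.le.trans (le_abs_self x)), Real.exp_log (by linarith)]

/-- The stationary solution attracts tempered families. -/
theorem IsContracting.attracts (hS : StationaryIncrements P) (h : IsContracting P f g Δ μ C B)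
    (ha : ∀ᵐ w ∂P, Tendsto (fun k : ℕ => euler f g Δ k (shift (-(k * Δ)) w) 0) atTop (𝓝 (a w)))
    {S : PathSpace m α → Set (Vec d)} (hST : IsTempered P Δ S) :
    ∀ᵐ w ∂P, Tendsto (fun k : ℕ => ⨆ y ∈ S (shift (-(k * Δ)) w),
      Metric.infEDist (euler f g Δ k (shift (-(k * Δ)) w) y) {a w}) atTop (𝓝 0) := by
  obtain ⟨r, -, hr, hlog⟩ := hST
  have hrate : 0 < μ * Δ := mul_pos h.rate_pos h.step_pos
  filter_upwards [h.pullback, ha, hlog, ae_shift hS hr fun k => -(k * Δ)] with w h1 h2 h3 h4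
  set K := C * (‖(0 : Vec d)‖ ^ 10 + 1 + B w) with hK
  -- Temperedness bounds the radius by exp(μΔk/2) for large k, which uses up half of the contraction
  -- rate; the second summand compares the solution from 0 with a.
  set δ : ℕ → ℝ := fun k => Real.exp K * Real.exp (-(μ * Δ / 2)) ^ k
    + dist (euler f g Δ k (shift (-(k * Δ)) w) 0) (a w) with hδ
  have hδ0 : Tendsto δ atTop (𝓝 0) := by
    have e1 := (tendsto_pow_atTop_nhds_zero_of_lt_one (Real.exp_pos (-(μ * Δ / 2))).le
      (Real.exp_lt_one_iff.mpr (by linarith))).const_mul (Real.exp K)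
    have e2 := tendsto_iff_dist_tendsto_zero.mp h2
    simpa using e1.add e2
  have hδ' : Tendsto (fun k => ENNReal.ofReal (δ k)) atTop (𝓝 0) := by
    rw [← ENNReal.ofReal_zero]
    exact ENNReal.tendsto_ofReal hδ0
  refine tendsto_of_tendsto_of_tendsto_of_le_of_le' tendsto_const_nhds hδ'
    (Eventually.of_forall fun _ => zero_le) ?_
  have hev : ∀ᶠ k : ℕ in atTop, Real.posLog (r (shift (-(k * Δ)) w)) / k < μ * Δ / 2 :=
    h3.2.eventually_lt_const (by linarith)
  filter_upwards [hev, eventually_gt_atTop 0] with k hk hk0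
  have hk0' : (0 : ℝ) < k := by exact_mod_cast hk0
  refine iSup₂_le fun y hy => ?_
  rw [Metric.infEDist_singleton, edist_dist]
  refine ENNReal.ofReal_le_ofReal ((dist_triangle _
    (euler f g Δ k (shift (-(k * Δ)) w) 0) _).trans (add_le_add ?_ le_rfl))
  have h5 : ‖y‖ ≤ r (shift (-(k * Δ)) w) := mem_closedBall_zero_iff.mp (h4 k hy)
  have h6 : ‖y‖ ≤ Real.exp (μ * Δ / 2 * k) := by
    refine h5.trans ((le_exp_posLog _).trans (Real.exp_le_exp.mpr ?_))
    exact ((div_lt_iff₀ hk0').mp hk).le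
  have h7 := h1 k 0 y
  rw [sub_zero, ← hK] at h7
  rw [dist_eq_norm]
  refine h7.trans ((mul_le_mul_of_nonneg_left h6 (Real.exp_pos _).le).trans (le_of_eq ?_))
  rw [← Real.exp_nat_mul, ← Real.exp_add, ← Real.exp_add]
  congr 1
  ring

/-- A contracting scheme of linear growth has a unique stationary solution; it is the pullback
attractor and is exponentially stable. -/
theorem IsContracting.exists_stationarySolution [IsProbabilityMeasure P]
    (hS : StationaryIncrements P) (hf : Continuous f) (hg : ContDiff ℝ 1 g)
    (h : IsContracting P f g Δ μ C B) (hb : IsLinearGrowth P f g Δ q b) :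
    ∃ a : PathSpace m α → Vec d, IsStationarySolution P f g Δ a ∧
      (∀ a' : PathSpace m α → Vec d, IsStationarySolution P f g Δ a' → a' =ᵐ[P] a) ∧
      IsPullbackAttractor P f g Δ (fun w => {a w}) ∧ IsExponentiallyStable P f g Δ a := by
  obtain ⟨a, ham, hlim⟩ := exists_pullback_limit hS hf hg h hb
  have ha := isStationarySolution_of_tendsto hS hf hg ham hlim
  refine ⟨a, ha, fun a' ha' => ha.ae_eq hS h ha', ?_, ha.isExponentiallyStable h⟩
  refine ⟨fun w => Set.singleton_nonempty _, fun w => isCompact_singleton, fun y => ?_,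
    ha.isTempered hS hb, ?_, fun S hST => h.attracts hS hlim hST⟩
  · simp only [Metric.infDist_singleton]
    exact measurable_const.dist ham
  · filter_upwards [ha.2] with w hw k
    rw [Set.image_singleton, hw]

/-- A `C¹` strictly dissipative drift with bounded derivative. -/
theorem exists_driftBound (hf : ContDiff ℝ 1 f)
    (hLf : BddAbove (Set.range fun y : Vec d => ‖fderiv ℝ f y‖)) (hd : StrictlyDissipative f) :
    ∃ D Lf : ℝ, 0 < Lf ∧ DriftBound f D Lf := by
  obtain ⟨D, hD, hdiss⟩ := hd
  obtain ⟨K, hK⟩ := hLf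
  refine ⟨D, |K| + 1, by positivity, hD, by positivity, fun x y => ?_, hdiss⟩
  refine norm_sub_le_of_hasFDerivAt (φ' := fderiv ℝ f)
    (fun z => (hf.differentiable (by norm_num) z).hasFDerivAt) (fun z => ?_) y x
  have h1 : ‖fderiv ℝ f z‖ ≤ K := hK ⟨z, rfl⟩
  linarith [le_abs_self K]

/-- Under the moment bound, the scheme contracts if the diffusion coefficient is small. -/
theorem exists_isContracting {D Lf ν : ℝ} (hf : DriftBound f D Lf) (hα : 1 / 3 < α) (hαν : α < ν)
    (hν : ν ≤ 1 / 2) [IsProbabilityMeasure P] (hS : StationaryIncrements P)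
    (hE : ShiftErgodic P) (hM : MomentBound ν P) :
    ∃ Cstar : ℝ, 0 < Cstar ∧ ∀ g : Vec d → (Vec m →L[ℝ] Vec d), IsC3b g →
      Lg g < Cstar → ∀ Δ : ℝ, StepBound Δ D Lf → Δ ≤ 1 / 2 →
      ∃ (μ C : ℝ) (B : PathSpace m α → ℝ), IsContracting P f g Δ μ C B := by
  obtain ⟨p, c, hp, hc, hflow⟩ := exists_dyadicSum_flow_bound (by linarith) hαν hS hE hM
  obtain ⟨C, hC, H⟩ := exists_contraction m hα (by linarith : α ≤ 1 / 2) hf hp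
  have hD := hf.pos
  -- The noise contributes at most L_g·C(1+c) per unit time. The threshold keeps this below D/16,
  -- half of the rate D/8; neither g nor Δ enters C or c.
  refine ⟨min 1 (D / 16 / (C * (1 + c))), by positivity, ?_⟩
  intro g hg hL Δ hΔ hΔ1
  obtain ⟨B, hB, hB0, hw⟩ := hflow Δ hΔ.pos
  have hL1 : Lg g ≤ 1 := hL.le.trans (min_le_left _ _)
  have hs := sizeBound_Lg g hL1
  have hLC : Lg g * (C * (1 + c)) ≤ D / 16 := by
    have := hL.le.trans (min_le_right _ _)
    rwa [le_div_iff₀ (by positivity)] at this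
  have key : ∀ (k : ℕ) (w v : PathSpace m α) (y u : Vec d),
      ∫⁻ s in Set.Ico (-1) (k * Δ), dyadicSum p (shift s v)
        ≤ ENNReal.ofReal (c * (k * Δ) + B w) →
      ‖euler f g Δ k v u - euler f g Δ k v y‖
        ≤ Real.exp (-(D / 16) * (k * Δ) + C * (‖y‖ ^ 10 + 1 + B w)) * ‖u - y‖ := by
    intro k w v y u hI
    have hk : 0 ≤ k * Δ := mul_nonneg (Nat.cast_nonneg k) hΔ.pos.le
    have hBw := hB0 w
    refine (H hΔ hΔ1 hg.coefBound hs k v _ (by positivity) hI y u).trans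
      (mul_le_mul_of_nonneg_right (Real.exp_le_exp.mpr ?_) (norm_nonneg _))
    have h1 := mul_le_mul_of_nonneg_right hLC hk
    have h2 : Lg g * (C * (‖y‖ ^ 10 + 1 + B w)) ≤ C * (‖y‖ ^ 10 + 1 + B w) :=
      mul_le_of_le_one_left (by positivity) hL1
    linarith
  refine ⟨D / 16, C, B, by linarith, hΔ.pos, hB, ?_, ?_⟩
  · filter_upwards [hw] with w h k y u
    exact key k w w y u (h k).1
  · filter_upwards [hw] with w h k y u
    exact key k w _ y u (h k).2

end Attraction

end RoughEuler

theorem mainTheorem6 (d : ℕ) (f : RoughEuler.Vec d → RoughEuler.Vec d)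
    (hf : ContDiff ℝ 1 f)
    (hLf : BddAbove (Set.range fun y : RoughEuler.Vec d => ‖fderiv ℝ f y‖))
    (hdiss : RoughEuler.StrictlyDissipative f) :
    ∃ Δstar : ℝ, 0 < Δstar ∧
      ∀ (m : ℕ) (α ν : ℝ), 1 / 3 < α → α < ν → ν ≤ 1 / 2 →
      ∀ (P : Measure (RoughEuler.PathSpace m α)), IsProbabilityMeasure P →
        RoughEuler.StationaryIncrements P → RoughEuler.ShiftErgodic P →
        RoughEuler.MomentBound ν P →
      ∃ Cstar : ℝ, 0 < Cstar ∧
        ∀ g : RoughEuler.Vec d → (RoughEuler.Vec m →L[ℝ] RoughEuler.Vec d),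
          RoughEuler.IsC3b g → RoughEuler.Lg g < Cstar →
        ∀ Δ : ℝ, 0 < Δ → Δ < Δstar →
          ∃ a : RoughEuler.PathSpace m α → RoughEuler.Vec d,
            RoughEuler.IsStationarySolution P f g Δ a ∧
            (∀ b : RoughEuler.PathSpace m α → RoughEuler.Vec d,
              RoughEuler.IsStationarySolution P f g Δ b → b =ᵐ[P] a) ∧
            RoughEuler.IsPullbackAttractor P f g Δ (fun w => {a w}) ∧
            RoughEuler.IsExponentiallyStable P f g Δ a := by
  obtain ⟨D, Lf, hLf0, hfb⟩ := RoughEuler.exists_driftBound hf hLf hdiss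
  have hD := hfb.pos
  -- The bound 1/2 permits blocks of length between 1/2 and 1; the other two are the conditions of
  -- `StepBound`. All depend on f only.
  refine ⟨min (1 / 2) (min (D / Lf ^ 2) (4 / D)), by positivity, ?_⟩
  intro m α ν hα hαν hν P hP hS hE hM
  obtain ⟨Cstar, hC, H⟩ := RoughEuler.exists_isContracting hfb hα hαν hν hS hE hM
  refine ⟨Cstar, hC, fun g hg hgL Δ hΔ hΔs => ?_⟩
  have h1 := hΔs.le.trans (min_le_left _ _)
  have h2 := hΔs.le.trans ((min_le_right _ _).trans (min_le_left _ _))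
  have h3 := hΔs.le.trans ((min_le_right _ _).trans (min_le_right _ _))
  rw [le_div_iff₀ (by positivity)] at h2 h3
  obtain ⟨μ, C, B, hcon⟩ := H g hg hgL Δ ⟨hΔ, h2, h3⟩ h1
  obtain ⟨b, hbm, hb0, hbi, hb⟩ := RoughEuler.exists_linear_growth hfb.lipschitz hg.coefBound
    (hα.trans hαν) hM hΔ
  exact hcon.exists_stationarySolution hS hf.continuous (hg.1.of_le (by norm_num))
    (⟨by linarith [mul_pos hΔ hLf0], hbm, hb0, hbi, hb⟩ :
      RoughEuler.IsLinearGrowth P f g Δ (1 + Δ * Lf) b)
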